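/- Let $L_\omega$ be the language of higher-order arithmetic in all finite types ($0$ is a type, and $\sigma\to\tau$ is a type whenever $\sigma,\tau$ are; $1:=0\to 0$, $2:=1\to 0$). Primitive equality $=_0$ and order $<_0$ are between objects of type $0$, and equality at higher types is the defined pointwise one. Let $\mathsf{RCA}_0^\omega$ be Kohlenbach's base theory, in classical many-sorted logic: the basic axioms of arithmetic for $0,S,+,\times,<$; the defining axioms of the combinators $\Pi,\Sigma$ and of the recursor $R_0$ of type $0$; the axiom of extensionality at all types; induction for quantifier-free formulas of $L_\omega$; and $\mathsf{QF\text{-}AC}^{1,0}$, i.e. $(\forall x^1)(\exists y^0)A(x,y)\to(\exists Y^2)(\forall x^1)A(x,Y(x))$ for quantifier-free $A$. Let $\mathsf{ACA}_0^\omega$ be $\mathsf{RCA}_0^\omega$ plus $$(\exists^2):\qquad (\exists \varphi^2\le_2 1)(\forall f^1)\big[(\exists n)(f(n)=0)\leftrightarrow \varphi(f)=0\big].$$ In this language, a real number is a sequence $x=(q_k)_{k\in\mathbb N}$ of (codes of) rationals with $|q_k-q_{k+i}|\le 2^{-k}$ for all $k,i$; for reals $x=(q_k)$ and $y=(r_k)$,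 $x=_{\mathbb R}y$ means $|q_k-r_k|\le 2^{-k+1}$ for all $k$, and $x\le_{\mathbb R}y$ means $q_k\le r_k+2^{-k+1}$ for all $k$. For $X$ equal to $[0,1]$, $\mathbb R$ (with equality $=_{\mathbb R}$) or $\mathbb N^{\mathbb N}$ (all objects of type $1$, with equality $=_1$), let $\mathsf{NBI}^X$ be the sentence stating that there is no bijection from $X$ to $\mathbb N$, i.e. no $Y^2$ that maps equal elements of $X$ to equal numbers, maps elements of $X$ with equal values to equal elements only (injectivity), and takes every $n\in\mathbb N$ as value at some element of $X$ (surjectivity). Write $\mathsf{NBI}$ for $\mathsf{NBI}^{[0,1]}$. **Theorem.** The system $\mathsf{ACA}_0^\omega$ proves $\mathsf{NBI}\leftrightarrow\mathsf{NBI}^{\mathbb R}$, and it proves $\mathsf{NBI}\to\mathsf{NBI}^{\mathbb N^{\mathbb N}}$. -/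

import Mathlib

/-! Higher-order arithmetic in all finite types: the language, classical natural deduction,
the theories RCA₀^ω and ACA₀^ω, real numbers as fast-converging Cauchy sequences of rationals,
and the principles stating that there is no bijection from `[0,1]`, `ℝ`, `ℕ^ℕ` to `ℕ`. -/

namespace HigherOrderArith

/-- The finite types: type `0` and function types. -/
inductive Ty : Type
  | nat : Ty
  | arrow : Ty → Ty → Ty
  deriving DecidableEq

infixr:60 " ⇾ " => Ty.arrow

/-- Type `1`: functions from numbers to numbers. -/
abbrev Ty.one : Ty := Ty.nat ⇾ Ty.nat

/-- Type `2`: functionals from type `1` to type `0`. -/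
abbrev Ty.two : Ty := Ty.one ⇾ Ty.nat

/-- Typed terms. There are countably many variables `var σ 0, var σ 1, …` of each type `σ`; they
are used as de Bruijn indices, counted separately for each type. The constants are zero, successor,
addition, multiplication, the combinators `Π` (`K`) and `Σ` (`S`), and the recursor `R₀` of
type `0`. -/
inductive Tm : Ty → Type
  | var (σ : Ty) (i : ℕ) : Tm σ
  | zero : Tm Ty.nat
  | succ : Tm (Ty.nat ⇾ Ty.nat)
  | add : Tm (Ty.nat ⇾ Ty.nat ⇾ Ty.nat)
  | mul : Tm (Ty.nat ⇾ Ty.nat ⇾ Ty.nat)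
  | combK (ρ τ : Ty) : Tm (ρ ⇾ τ ⇾ ρ)
  | combS (δ ρ τ : Ty) : Tm ((δ ⇾ ρ ⇾ τ) ⇾ (δ ⇾ ρ) ⇾ δ ⇾ τ)
  | recursor : Tm (Ty.nat ⇾ (Ty.nat ⇾ Ty.nat ⇾ Ty.nat) ⇾ Ty.nat ⇾ Ty.nat)
  | app {σ τ : Ty} : Tm (σ ⇾ τ) → Tm σ → Tm τ

infixl:90 " ⬝ " => Tm.app

/-- Formulas of the language `L_ω`. The only primitive relations are `=₀` and `<₀` between objects
of type `0`. The quantifier `all σ φ` binds the variable `var σ 0` of `φ`; in `φ`, the index of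
every other variable of type `σ` is raised by one, and variables of other types are unaffected. -/
inductive Formula : Type
  | eq : Tm Ty.nat → Tm Ty.nat → Formula
  | lt : Tm Ty.nat → Tm Ty.nat → Formula
  | falsum : Formula
  | imp : Formula → Formula → Formula
  | all : Ty → Formula → Formula

infix:50 " ≐ " => Formula.eq
infix:50 " ≺ " => Formula.lt
infixr:30 " ⟹ " => Formula.imp

/-! ### Renaming and substitution -/

/-- A renaming of variables. -/
abbrev Ren := Ty → ℕ → ℕ

/-- A simultaneous substitution of terms for variables. -/
abbrev Subst := (σ : Ty) → ℕ → Tm σ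

/-- Raise by one the indices of the variables of type `σ`. -/
def shift (σ : Ty) : Ren := fun τ i => if τ = σ then i + 1 else i

def Tm.rename (r : Ren) : {σ : Ty} → Tm σ → Tm σ
  | _, .var σ i => .var σ (r σ i)
  | _, .zero => .zero
  | _, .succ => .succ
  | _, .add => .add
  | _, .mul => .mul
  | _, .combK ρ τ => .combK ρ τ
  | _, .combS δ ρ τ => .combS δ ρ τ
  | _, .recursor => .recursor
  | _, .app f x => .app (f.rename r) (x.rename r)

def Tm.subst (s : Subst) : {σ : Ty} → Tm σ → Tm σ
  | _, .var σ i => s σ i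
  | _, .zero => .zero
  | _, .succ => .succ
  | _, .add => .add
  | _, .mul => .mul
  | _, .combK ρ τ => .combK ρ τ
  | _, .combS δ ρ τ => .combS δ ρ τ
  | _, .recursor => .recursor
  | _, .app f x => .app (f.subst s) (x.subst s)

/-- The substitution `s` carried under a quantifier of type `σ`. -/
def Subst.under (σ : Ty) (s : Subst) : Subst := fun τ i =>
  if τ = σ then
    match i with
    | 0 => .var τ 0
    | j + 1 => (s τ j).rename (shift σ)
  else (s τ i).rename (shift σ)

def Formula.subst : Formula → Subst → Formula
  | .eq t u, s => .eq (t.subst s) (u.subst s)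
  | .lt t u, s => .lt (t.subst s) (u.subst s)
  | .falsum, _ => .falsum
  | .imp φ ψ, s => .imp (φ.subst s) (ψ.subst s)
  | .all σ φ, s => .all σ (φ.subst (s.under σ))

/-- Weakening of `φ` by one fresh variable `var σ 0`. -/
def Formula.lift (σ : Ty) (φ : Formula) : Formula :=
  φ.subst fun τ i => .var τ (shift σ τ i)

/-- The substitution of `t` for `var σ 0` that lowers by one the other variables of type `σ`. -/
def Subst.single {σ : Ty} (t : Tm σ) : Subst := fun τ i =>
  if h : τ = σ then
    match i with
    | 0 => h ▸ t
    | j + 1 => .var τ j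
  else .var τ i

/-- The instance `φ(t)` of the body `φ` of a quantifier of type `σ`. -/
def Formula.inst {σ : Ty} (φ : Formula) (t : Tm σ) : Formula := φ.subst (Subst.single t)

/-- The substitution of `S n` for `n = var 0 0`, leaving the other variables alone. -/
def Subst.succZero : Subst
  | .nat, 0 => .succ ⬝ .var .nat 0
  | τ, i => .var τ i

/-! ### Defined connectives and quantifiers (classical logic) -/

def Formula.neg (φ : Formula) : Formula := φ ⟹ .falsum

def Formula.and (φ ψ : Formula) : Formula := (φ ⟹ ψ.neg).neg

def Formula.or (φ ψ : Formula) : Formula := φ.neg ⟹ ψ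

def Formula.iff (φ ψ : Formula) : Formula := (φ ⟹ ψ).and (ψ ⟹ φ)

def Formula.ex (σ : Ty) (φ : Formula) : Formula := (Formula.all σ φ.neg).neg

/-- Quantifier-free formulas. -/
def Formula.QF : Formula → Prop
  | .eq _ _ => True
  | .lt _ _ => True
  | .falsum => True
  | .imp φ ψ => φ.QF ∧ ψ.QF
  | .all _ _ => False

/-- Equality `s =_τ t` at type `τ`, i.e. `∀ x₁ … xₖ, s x₁ … xₖ =₀ t x₁ … xₖ`. -/
def eqAt : (τ : Ty) → Tm τ → Tm τ → Formula
  | .nat, s, t => s ≐ t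
  | .arrow σ τ, s, t =>
      .all σ (eqAt τ (s.rename (shift σ) ⬝ .var σ 0) (t.rename (shift σ) ⬝ .var σ 0))

/-! ### Derivability -/

/-- `Proves T Γ φ`: there is a derivation of `φ` from the axioms `T` and the assumptions `Γ` in
classical many-sorted natural deduction with equality at type `0`. Free variables of axioms are read
as universally quantified; free variables of `Γ` and `φ` are parameters. -/
inductive Proves (T : Set Formula) : List Formula → Formula → Prop
  | ax {Γ : List Formula} {φ : Formula} : φ ∈ T → Proves T Γ φ
  | hyp {Γ : List Formula} {φ : Formula} : φ ∈ Γ → Proves T Γ φ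
  | impIntro {Γ : List Formula} {φ ψ : Formula} : Proves T (φ :: Γ) ψ → Proves T Γ (φ ⟹ ψ)
  | impElim {Γ : List Formula} {φ ψ : Formula} :
      Proves T Γ (φ ⟹ ψ) → Proves T Γ φ → Proves T Γ ψ
  | byContra {Γ : List Formula} {φ : Formula} :
      Proves T (φ.neg :: Γ) .falsum → Proves T Γ φ
  | allIntro {Γ : List Formula} {σ : Ty} {φ : Formula} :
      Proves T (Γ.map (Formula.lift σ)) φ → Proves T Γ (.all σ φ)
  | allElim {Γ : List Formula} {σ : Ty} {φ : Formula} (t : Tm σ) :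
      Proves T Γ (.all σ φ) → Proves T Γ (φ.inst t)
  | eqRefl {Γ : List Formula} (t : Tm Ty.nat) : Proves T Γ (t ≐ t)
  | eqSubst {Γ : List Formula} {s t : Tm Ty.nat} (φ : Formula) :
      Proves T Γ (s ≐ t) → Proves T Γ (φ.inst s) → Proves T Γ (φ.inst t)

/-! ### The theories -/

/-- The axioms of `RCA₀^ω`: the basic axioms of arithmetic, the defining axioms of the combinators
and of the recursor `R₀`, extensionality at all types, quantifier-free induction, and
quantifier-free choice `QF-AC^{1,0}`. In `induction`, the formula `A(n)` has `n = var 0 0`; in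
`choice`, the formula `A(x, y)` has `x = var 1 0` and `y = var 0 0`. Both may contain further
variables of all types as parameters. -/
inductive RCA : Formula → Prop
  | succ_ne_zero (x : Tm Ty.nat) : RCA (.neg (.succ ⬝ x ≐ .zero))
  | succ_inj (x y : Tm Ty.nat) : RCA (.succ ⬝ x ≐ .succ ⬝ y ⟹ x ≐ y)
  | add_zero (x : Tm Ty.nat) : RCA (.add ⬝ x ⬝ .zero ≐ x)
  | add_succ (x y : Tm Ty.nat) :
      RCA (.add ⬝ x ⬝ (.succ ⬝ y) ≐ .succ ⬝ (.add ⬝ x ⬝ y))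
  | mul_zero (x : Tm Ty.nat) : RCA (.mul ⬝ x ⬝ .zero ≐ .zero)
  | mul_succ (x y : Tm Ty.nat) :
      RCA (.mul ⬝ x ⬝ (.succ ⬝ y) ≐ .add ⬝ (.mul ⬝ x ⬝ y) ⬝ x)
  | not_lt_zero (x : Tm Ty.nat) : RCA (.neg (x ≺ .zero))
  | lt_succ (x y : Tm Ty.nat) :
      RCA (.iff (x ≺ .succ ⬝ y) (.or (x ≺ y) (x ≐ y)))
  | combK {ρ τ : Ty} (x : Tm ρ) (y : Tm τ) : RCA (eqAt ρ (.combK ρ τ ⬝ x ⬝ y) x)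
  | combS {δ ρ τ : Ty} (x : Tm (δ ⇾ ρ ⇾ τ)) (y : Tm (δ ⇾ ρ)) (z : Tm δ) :
      RCA (eqAt τ (.combS δ ρ τ ⬝ x ⬝ y ⬝ z) (x ⬝ z ⬝ (y ⬝ z)))
  | rec_zero (m : Tm Ty.nat) (f : Tm (Ty.nat ⇾ Ty.nat ⇾ Ty.nat)) :
      RCA (.recursor ⬝ m ⬝ f ⬝ .zero ≐ m)
  | rec_succ (m : Tm Ty.nat) (f : Tm (Ty.nat ⇾ Ty.nat ⇾ Ty.nat)) (n : Tm Ty.nat) :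
      RCA (.recursor ⬝ m ⬝ f ⬝ (.succ ⬝ n) ≐ f ⬝ n ⬝ (.recursor ⬝ m ⬝ f ⬝ n))
  | ext {ρ τ : Ty} (F : Tm (ρ ⇾ τ)) (x y : Tm ρ) :
      RCA (eqAt ρ x y ⟹ eqAt τ (F ⬝ x) (F ⬝ y))
  | induction (A : Formula) (hA : A.QF) :
      RCA (A.inst Tm.zero ⟹ .all .nat (A ⟹ A.subst Subst.succZero) ⟹ .all .nat A)
  | choice (A : Formula) (hA : A.QF) :
      RCA (.all .one (.ex .nat A) ⟹
        .ex .two (.all .one ((A.lift .two).inst (Tm.var .two 0 ⬝ .var .one 0))))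

/-- `s ≤₀ t`, i.e. `s < t + 1`. -/
def le (s t : Tm Ty.nat) : Formula := s ≺ .succ ⬝ t

/-- The axiom `(∃²)`: there is `E` of type `2`, bounded by `1`, such that for all `f` of type `1`,
`∃ n, f n = 0` if and only if `E f = 0`. -/
def existsTwo : Formula :=
  .ex .two (.and
    (.all .one (le (.var .two 0 ⬝ .var .one 0) (.succ ⬝ .zero)))
    (.all .one (.iff (.ex .nat (.var .one 0 ⬝ .var .nat 0 ≐ .zero))
      (.var .two 0 ⬝ .var .one 0 ≐ .zero))))

/-- `ACA₀^ω`, which is `RCA₀^ω` together with `(∃²)`. -/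
def ACA : Set Formula := {φ | RCA φ ∨ φ = existsTwo}

/-! ### Rational and real numbers -/

/-- The numeral of `n`. -/
def num : ℕ → Tm Ty.nat
  | 0 => .zero
  | n + 1 => .succ ⬝ num n

/-- `2 ^ k`, by recursion. -/
def pow2 (k : Tm Ty.nat) : Tm Ty.nat :=
  .recursor ⬝ num 1 ⬝ (.combK _ _ ⬝ (.mul ⬝ num 2)) ⬝ k

/-- The injective pairing `(i, j) ↦ (i + j)² + i` of natural numbers. -/
def pair (i j : Tm Ty.nat) : Tm Ty.nat :=
  .add ⬝ (.mul ⬝ (.add ⬝ i ⬝ j) ⬝ (.add ⬝ i ⬝ j)) ⬝ i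

/-- The code of the rational number `(a - b) / (d + 1)`. -/
def ratCode (a b d : Tm Ty.nat) : Tm Ty.nat := pair (pair a b) d

/-- Raise by `m` the indices of the variables of type `0`. -/
def Tm.liftNat (m : ℕ) {σ : Ty} (t : Tm σ) : Tm σ :=
  t.rename fun τ i => if τ = Ty.nat then i + m else i

/-- `q` and `r` are codes of rational numbers with `q - r ≤ c / 2 ^ k`: there are `a b d a' b' d'`
(the variables `5, …, 0` of type `0`) with `q = (a - b) / (d + 1)`, `r = (a' - b') / (d' + 1)` and
`2 ^ k * (a * (d' + 1) + b' * (d + 1)) ≤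
  c * ((d + 1) * (d' + 1)) + 2 ^ k * (b * (d' + 1) + a' * (d + 1))`. -/
def diffLe (q r k : Tm Ty.nat) (c : ℕ) : Formula :=
  let a : Tm Ty.nat := .var .nat 5
  let b : Tm Ty.nat := .var .nat 4
  let d : Tm Ty.nat := .var .nat 3
  let a' : Tm Ty.nat := .var .nat 2
  let b' : Tm Ty.nat := .var .nat 1
  let d' : Tm Ty.nat := .var .nat 0
  let e : Tm Ty.nat := pow2 (k.liftNat 6)
  .ex .nat (.ex .nat (.ex .nat (.ex .nat (.ex .nat (.ex .nat (.and
    (q.liftNat 6 ≐ ratCode a b d) (.and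
    (r.liftNat 6 ≐ ratCode a' b' d')
    (le (.mul ⬝ e ⬝ (.add ⬝ (.mul ⬝ a ⬝ (.succ ⬝ d')) ⬝ (.mul ⬝ b' ⬝ (.succ ⬝ d))))
      (.add ⬝ (.mul ⬝ num c ⬝ (.mul ⬝ (.succ ⬝ d) ⬝ (.succ ⬝ d')))
        ⬝ (.mul ⬝ e ⬝ (.add ⬝ (.mul ⬝ b ⬝ (.succ ⬝ d')) ⬝ (.mul ⬝ a' ⬝ (.succ ⬝ d)))))))))))))

/-- `q` and `r` are codes of rational numbers with `|q - r| ≤ c / 2 ^ k`. -/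
def distLe (q r k : Tm Ty.nat) (c : ℕ) : Formula := (diffLe q r k c).and (diffLe r q k c)

/-- `x ∈ ℝ`: `x` is a sequence of rationals with `|x k - x (k + i)| ≤ 2 ^ (-k)` for all `k`, `i`
(the variables `1` and `0` of type `0`). -/
def isReal (x : Tm Ty.one) : Formula :=
  .all .nat (.all .nat (distLe (x.liftNat 2 ⬝ .var .nat 1)
    (x.liftNat 2 ⬝ (.add ⬝ .var .nat 1 ⬝ .var .nat 0)) (.var .nat 1) 1))

/-- `x =_ℝ y`: `|x k - y k| ≤ 2 ^ (-k + 1)` for all `k`. -/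
def realEq (x y : Tm Ty.one) : Formula :=
  .all .nat (distLe (x.liftNat 1 ⬝ .var .nat 0) (y.liftNat 1 ⬝ .var .nat 0) (.var .nat 0) 2)

/-- `x ≤_ℝ y`: `x k ≤ y k + 2 ^ (-k + 1)` for all `k`. -/
def realLe (x y : Tm Ty.one) : Formula :=
  .all .nat (diffLe (x.liftNat 1 ⬝ .var .nat 0) (y.liftNat 1 ⬝ .var .nat 0) (.var .nat 0) 2)

/-- The real number `0`, as a constant sequence. -/
def realZero : Tm Ty.one := .combK _ _ ⬝ ratCode (num 0) (num 0) (num 0)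

/-- The real number `1`, as a constant sequence. -/
def realOne : Tm Ty.one := .combK _ _ ⬝ ratCode (num 1) (num 0) (num 0)

/-- `x ∈ [0, 1]`. -/
def inUnitInterval (x : Tm Ty.one) : Formula :=
  (isReal x).and ((realLe realZero x).and (realLe x realOne))

/-! ### Absence of bijections -/

/-- There is no bijection from `X` to `ℕ`, where `X` is a class of objects of type `1` with
equality `E`: no `Y` of type `2` respects `E` on `X`, is injective on `X` with respect to `E`, and
takes every value on `X`. In the first two clauses `var 1 1` and `var 1 0` are two elements of `X`;
in the third, `var 0 0` is a number and `var 1 0` an element of `X`. -/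
def noBijection (X : Tm Ty.one → Formula) (E : Tm Ty.one → Tm Ty.one → Formula) : Formula :=
  let Y : Tm Ty.two := .var .two 0
  let f : Tm Ty.one := .var .one 1
  let g : Tm Ty.one := .var .one 0
  .neg (.ex .two (.and
    (.all .one (.all .one (X f ⟹ X g ⟹ E f g ⟹ Y ⬝ f ≐ Y ⬝ g))) (.and
    (.all .one (.all .one (X f ⟹ X g ⟹ Y ⬝ f ≐ Y ⬝ g ⟹ E f g)))
    (.all .nat (.ex .one ((X g).and (Y ⬝ g ≐ .var .nat 0)))))))

/-- `NBI`: there is no bijection from `[0, 1]` to `ℕ`. -/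
def NBI : Formula := noBijection inUnitInterval realEq

/-- `NBI^ℝ`: there is no bijection from `ℝ` to `ℕ`. -/
def NBIReal : Formula := noBijection isReal realEq

/-- `NBI` for Baire space `ℕ^ℕ`: there is no bijection from `ℕ^ℕ` to `ℕ`. Every object of type `1`
is an element of Baire space, and equality is that of type `1`. -/
def NBIBaire : Formula := noBijection (fun _ => .neg .falsum) (eqAt .one)

end HigherOrderArith

/-! By completeness it suffices to compare the two sides of each equivalence in every extensional
model of `ACA₀^ω`. Its numbers may be nonstandard, but quantifier-free choice and `(∃²)` make every
arithmetically defined function on them an object of the model, and induction applies to every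
arithmetical property.

Inside such a model, choose for each real number the binary expansion with infinitely many digits
one. The integer part and the successive gaps between these digits identify `ℝ` with `ℕ^ℕ`, and
`(0, 1]` with the sequences whose first entry is `0`, hence also with `ℕ^ℕ`. The interval `[0, 1]`
has one more point, which Hilbert's hotel absorbs: from a bijection of either set to `ℕ`, one of the
other is obtained by adding or deleting a value. -/

namespace HigherOrderArith

/-! ### Substitution -/

/-- The identity substitution. -/
def Subst.id : Subst := fun τ i => .var τ i

/-- Composition of substitutions in diagrammatic order: first `s`, then `s'`. -/
def Subst.comp (s s' : Subst) : Subst := fun τ i => (s τ i).subst s'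

/-- The substitution that makes room for a fresh variable `var σ 0`. -/
def Subst.weaken (σ : Ty) : Subst := fun τ i => .var τ (shift σ τ i)

/-- The substitution of `t` for `var σ 0` and of `s` for the remaining variables, those of type `σ`
being lowered by one. -/
def Subst.push {σ : Ty} (t : Tm σ) (s : Subst) : Subst := fun τ i =>
  if h : τ = σ then
    match i with
    | 0 => h ▸ t
    | j + 1 => s τ j
  else s τ i

theorem Tm.subst_id {σ : Ty} (t : Tm σ) : t.subst .id = t := by
  induction t <;> simp_all [Tm.subst, Subst.id]

theorem Tm.subst_subst {σ : Ty} (t : Tm σ) (s s' : Subst) :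
    (t.subst s).subst s' = t.subst (s.comp s') := by
  induction t <;> simp_all [Tm.subst, Subst.comp]

theorem Tm.rename_eq_subst (r : Ren) {σ : Ty} (t : Tm σ) :
    t.rename r = t.subst fun τ i => .var τ (r τ i) := by
  induction t <;> simp_all [Tm.rename, Tm.subst]

theorem Tm.rename_shift (ρ : Ty) {σ : Ty} (t : Tm σ) :
    t.rename (shift ρ) = t.subst (.weaken ρ) :=
  t.rename_eq_subst _

namespace Subst

theorem comp_id (s : Subst) : s.comp .id = s :=
  funext₂ fun τ i => (s τ i).subst_id

theorem comp_assoc (s s' s'' : Subst) : (s.comp s').comp s'' = s.comp (s'.comp s'') :=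
  funext₂ fun τ i => (s τ i).subst_subst s' s''

theorem push_zero {σ : Ty} (t : Tm σ) (s : Subst) : push t s σ 0 = t := by
  simp [push]

theorem push_succ {σ : Ty} (t : Tm σ) (s : Subst) (i : ℕ) : push t s σ (i + 1) = s σ i := by
  simp [push]

theorem push_of_ne {σ τ : Ty} (h : τ ≠ σ) (t : Tm σ) (s : Subst) (i : ℕ) :
    push t s τ i = s τ i := by
  simp [push, h]

theorem eq_push {σ : Ty} {t : Tm σ} {s s' : Subst} (h_zero : s' σ 0 = t)
    (h_succ : ∀ i, s' σ (i + 1) = s σ i) (h_ne : ∀ τ, τ ≠ σ → s' τ = s τ) : s' = push t s := by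
  funext τ i
  rcases eq_or_ne τ σ with rfl | h
  · cases i with
    | zero => rw [push_zero, h_zero]
    | succ i => rw [push_succ, h_succ]
  · rw [push_of_ne h, h_ne τ h]

theorem push_comp {σ : Ty} (t : Tm σ) (s s' : Subst) :
    (push t s).comp s' = push (t.subst s') (s.comp s') :=
  eq_push (by simp only [comp, push_zero]) (fun i => by simp only [comp, push_succ])
    fun τ h => funext fun i => by simp only [comp, push_of_ne h]

theorem weaken_comp_push {σ : Ty} (t : Tm σ) (s : Subst) : (weaken σ).comp (push t s) = s := by
  funext τ i
  rcases eq_or_ne τ σ with rfl | h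
  · simp [comp, weaken, Tm.subst, shift, push_succ]
  · simp [comp, weaken, Tm.subst, shift, push_of_ne h, h]

theorem weaken_comm (σ ρ : Ty) :
    (weaken σ).comp (weaken ρ) = (weaken ρ).comp (weaken σ) := by
  funext τ i
  simp only [comp, weaken, Tm.subst, shift]
  split_ifs <;> rfl

theorem push_comm {σ ρ : Ty} (h : σ ≠ ρ) (t : Tm σ) (u : Tm ρ) (s : Subst) :
    push t (push u s) = push u (push t s) := by
  refine eq_push (by rw [push_of_ne h.symm, push_zero])
    (fun i => by rw [push_of_ne h.symm, push_succ, push_of_ne h.symm])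
    fun τ hτ => funext fun i => ?_
  rcases eq_or_ne τ σ with rfl | h
  · cases i with
    | zero => rw [push_zero, push_zero]
    | succ i => rw [push_succ, push_succ, push_of_ne hτ]
  · rw [push_of_ne h, push_of_ne h, push_of_ne hτ]

theorem single_eq_push {σ : Ty} (t : Tm σ) : single t = push t .id :=
  eq_push (by simp [single]) (fun i => by simp [single, Subst.id])
    fun τ h => funext fun i => by simp [single, Subst.id, h]

theorem under_eq_push (σ : Ty) (s : Subst) :
    s.under σ = push (.var σ 0) (s.comp (weaken σ)) :=
  eq_push (by simp [under]) (fun i => by simp [under, comp, Tm.rename_shift])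
    fun τ h => funext fun i => by simp [under, comp, Tm.rename_shift, h]

theorem succZero_eq_push : succZero = push (.succ ⬝ .var .nat 0) (weaken .nat) :=
  eq_push rfl (fun i => by simp [succZero, weaken, shift])
    fun τ h => funext fun i => by cases τ <;> simp_all [succZero, weaken, shift]

theorem weaken_comp_under (σ : Ty) (s : Subst) :
    (weaken σ).comp (s.under σ) = s.comp (weaken σ) := by
  rw [under_eq_push, weaken_comp_push]

theorem under_comp_push {σ : Ty} (t : Tm σ) (s s' : Subst) :
    (s.under σ).comp (push t s') = push t (s.comp s') := by
  rw [under_eq_push, push_comp, comp_assoc, weaken_comp_push, Tm.subst, push_zero]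

theorem under_comp (σ : Ty) (s s' : Subst) :
    (s.under σ).comp (s'.under σ) = (s.comp s').under σ := by
  rw [under_eq_push σ s', under_comp_push, under_eq_push, comp_assoc]

theorem under_id (σ : Ty) : under σ .id = .id := by
  rw [under_eq_push]
  exact (eq_push rfl (fun i => by simp [comp, weaken, Subst.id, Tm.subst, shift])
    fun τ h => funext fun i => by simp [comp, weaken, Subst.id, Tm.subst, shift, h]).symm

theorem under_comm {σ ρ : Ty} (h : σ ≠ ρ) (s : Subst) :
    (s.under σ).under ρ = (s.under ρ).under σ := by
  have hσ : weaken ρ σ 0 = .var σ 0 := by simp [weaken, shift, h]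
  have hρ : weaken σ ρ 0 = .var ρ 0 := by simp [weaken, shift, h.symm]
  simp only [under_eq_push, push_comp, Tm.subst, hσ, hρ, comp_assoc, weaken_comm ρ σ,
    push_comm h]

theorem succZero_comp_under (s : Subst) :
    succZero.comp (s.under .nat) = (s.under .nat).comp succZero := by
  rw [succZero_eq_push, push_comp, weaken_comp_under, under_comp_push]
  simp [Tm.subst, under]

end Subst

theorem Formula.subst_id (φ : Formula) : φ.subst .id = φ := by
  induction φ <;> simp_all [Formula.subst, Tm.subst_id, Subst.under_id]

theorem Formula.subst_subst (φ : Formula) (s s' : Subst) :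
    (φ.subst s).subst s' = φ.subst (s.comp s') := by
  induction φ generalizing s s' <;>
    simp_all [Formula.subst, Tm.subst_subst, Subst.under_comp]

theorem Formula.lift_eq_subst (σ : Ty) (φ : Formula) : φ.lift σ = φ.subst (.weaken σ) := rfl

theorem Formula.inst_eq_subst {σ : Ty} (φ : Formula) (t : Tm σ) :
    φ.inst t = φ.subst (.push t .id) := by
  rw [inst, Subst.single_eq_push]

theorem Formula.subst_under_inst {σ : Ty} (φ : Formula) (s : Subst) (t : Tm σ) :
    (φ.subst (s.under σ)).inst t = φ.subst (.push t s) := by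
  rw [inst_eq_subst, subst_subst, Subst.under_comp_push, Subst.comp_id]

theorem Formula.inst_subst {σ : Ty} (φ : Formula) (s : Subst) (t : Tm σ) :
    (φ.inst t).subst s = (φ.subst (s.under σ)).inst (t.subst s) := by
  rw [subst_under_inst, inst_eq_subst, subst_subst, Subst.push_comp]
  rfl

theorem Formula.lift_subst_under (σ : Ty) (φ : Formula) (s : Subst) :
    (φ.lift σ).subst (s.under σ) = (φ.subst s).lift σ := by
  simp only [lift_eq_subst, subst_subst, Subst.weaken_comp_under]

theorem Formula.subst_ex (σ : Ty) (φ : Formula) (s : Subst) :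
    (Formula.ex σ φ).subst s = .ex σ (φ.subst (s.under σ)) := rfl

theorem Formula.QF.subst {φ : Formula} (h : φ.QF) (s : Subst) : (φ.subst s).QF := by
  induction φ with
  | imp φ ψ ih₁ ih₂ => exact ⟨ih₁ h.1, ih₂ h.2⟩
  | all => exact h.elim
  | _ => trivial

theorem eqAt_subst (τ : Ty) (t u : Tm τ) (s : Subst) :
    (eqAt τ t u).subst s = eqAt τ (t.subst s) (u.subst s) := by
  induction τ generalizing s with
  | nat => rfl
  | arrow σ τ _ ih =>
    simp only [eqAt, Formula.subst, ih, Tm.subst, Tm.rename_shift, Tm.subst_subst,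
      Subst.weaken_comp_under]
    simp [Subst.under]

/-! ### Derivability under substitution -/

/-- Schemes of axioms, whose free variables may be instantiated by arbitrary terms. -/
def SubstClosed (T : Set Formula) : Prop := ∀ φ ∈ T, ∀ s, φ.subst s ∈ T

theorem Proves.subst {T : Set Formula} (hT : SubstClosed T) {Γ : List Formula} {φ : Formula}
    (h : Proves T Γ φ) (s : Subst) : Proves T (Γ.map (·.subst s)) (φ.subst s) := by
  induction h generalizing s with
  | ax h => exact .ax (hT _ h s)
  | hyp h => exact .hyp (List.mem_map_of_mem h)
  | impIntro _ ih => exact .impIntro (ih s)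
  | impElim _ _ ih₁ ih₂ => exact .impElim (ih₁ s) (ih₂ s)
  | byContra _ ih => exact .byContra (ih s)
  | @allIntro Γ σ φ _ ih =>
    refine .allIntro ?_
    simpa only [List.map_map, Function.comp_def, Formula.lift_subst_under] using ih (s.under σ)
  | allElim t _ ih =>
    rw [Formula.inst_subst]
    exact .allElim _ (ih s)
  | eqRefl t => exact .eqRefl _
  | eqSubst φ _ _ ih₁ ih₂ =>
    rw [Formula.inst_subst]
    exact .eqSubst _ (ih₁ s) (Formula.inst_subst φ s _ ▸ ih₂ s)

theorem Proves.weaken {T : Set Formula} {Γ Δ : List Formula} {φ : Formula} (h : Proves T Γ φ)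
    (hΓ : Γ ⊆ Δ) : Proves T Δ φ := by
  induction h generalizing Δ with
  | ax h => exact .ax h
  | hyp h => exact .hyp (hΓ h)
  | impIntro _ ih => exact .impIntro (ih (List.cons_subset_cons _ hΓ))
  | impElim _ _ ih₁ ih₂ => exact .impElim (ih₁ hΓ) (ih₂ hΓ)
  | byContra _ ih => exact .byContra (ih (List.cons_subset_cons _ hΓ))
  | allIntro _ ih => exact .allIntro (ih (List.map_subset _ hΓ))
  | allElim t _ ih => exact .allElim _ (ih hΓ)
  | eqRefl t => exact .eqRefl _
  | eqSubst φ _ _ ih₁ ih₂ => exact .eqSubst _ (ih₁ hΓ) (ih₂ hΓ)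

theorem Formula.choice_matrix_subst (A : Formula) (s : Subst) :
    ((A.lift .two).inst (Tm.var .two 0 ⬝ .var .one 0)).subst ((s.under .two).under .one) =
      ((A.subst ((s.under .one).under .nat)).lift .two).inst
        (Tm.var .two 0 ⬝ .var .one 0) := by
  have h_app : (Tm.var .two 0 ⬝ .var .one 0).subst ((s.under .two).under .one) =
      Tm.var .two 0 ⬝ .var .one 0 := by
    simp [Tm.subst, Subst.under, Tm.rename, shift]
  rw [inst_subst, h_app, ← lift_subst_under, Subst.under_comm (σ := .two) (ρ := .one) (by decide),
    Subst.under_comm (σ := .two) (ρ := .nat) (by decide)]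

theorem RCA.subst {φ : Formula} (h : RCA φ) (s : Subst) : RCA (φ.subst s) := by
  cases h with
  | succ_ne_zero x => exact .succ_ne_zero _
  | succ_inj x y => exact .succ_inj _ _
  | add_zero x => exact .add_zero _
  | add_succ x y => exact .add_succ _ _
  | mul_zero x => exact .mul_zero _
  | mul_succ x y => exact .mul_succ _ _
  | not_lt_zero x => exact .not_lt_zero _
  | lt_succ x y => exact .lt_succ _ _
  | combK x y => exact eqAt_subst .. ▸ .combK _ _
  | combS x y z => exact eqAt_subst .. ▸ .combS _ _ _
  | rec_zero m f => exact .rec_zero _ _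
  | rec_succ m f n => exact .rec_succ _ _ _
  | ext F x y =>
    simp only [Formula.subst, eqAt_subst]
    exact .ext _ _ _
  | induction A hA =>
    simp only [Formula.subst, Formula.inst_subst, Tm.subst, Formula.subst_subst,
      Subst.succZero_comp_under]
    simpa only [Formula.subst_subst] using RCA.induction (A.subst (s.under .nat)) (hA.subst _)
  | choice A hA =>
    simp only [Formula.subst, Formula.subst_ex, Formula.choice_matrix_subst]
    exact .choice _ (hA.subst _)

theorem substClosed_ACA : SubstClosed ACA := by
  rintro φ (h | rfl) s
  · exact .inl (h.subst s)
  · right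
    simp [existsTwo, Formula.subst, Formula.and, Formula.iff, Formula.ex, Formula.neg, le,
      Tm.subst, Subst.under, Tm.rename, shift]

/-! ### Countability of the language -/

/-- An injective numbering of types. -/
def Ty.code : Ty → ℕ
  | .nat => 0
  | .arrow σ τ => Nat.pair σ.code τ.code + 1

theorem Ty.code_injective : Function.Injective Ty.code := by
  intro σ
  induction σ with
  | nat => intro τ h; cases τ <;> simp_all [code]
  | arrow σ τ ih₁ ih₂ =>
    intro ρ h
    cases ρ with
    | nat => simp [code] at h
    | arrow σ' τ' =>
      simp only [code, Nat.add_right_cancel_iff, Nat.pair_eq_pair] at h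
      rw [ih₁ h.1, ih₂ h.2]

theorem Ty.code_inj {σ τ : Ty} : σ.code = τ.code ↔ σ = τ :=
  code_injective.eq_iff

/-- A numbering of terms that is injective on the terms of all types together. -/
def Tm.code : {σ : Ty} → Tm σ → ℕ
  | _, .var σ i => Nat.pair 0 (Nat.pair σ.code i)
  | _, .zero => Nat.pair 1 0
  | _, .succ => Nat.pair 2 0
  | _, .add => Nat.pair 3 0
  | _, .mul => Nat.pair 4 0
  | _, .combK ρ τ => Nat.pair 5 (Nat.pair ρ.code τ.code)
  | _, .combS δ ρ τ => Nat.pair 6 (Nat.pair δ.code (Nat.pair ρ.code τ.code))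
  | _, .recursor => Nat.pair 7 0
  | _, .app f x => Nat.pair 8 (Nat.pair f.code x.code)

theorem Tm.sigma_eq_of_code_eq {σ τ : Ty} (t : Tm σ) (u : Tm τ) (h : t.code = u.code) :
    (⟨σ, t⟩ : (σ : Ty) × Tm σ) = ⟨τ, u⟩ := by
  induction t generalizing τ with
  | app f x ih₁ ih₂ =>
    cases u <;> simp only [code, Nat.pair_eq_pair] at h <;> try omega
    cases ih₁ _ h.2.1
    cases ih₂ _ h.2.2
    rfl
  | _ => cases u <;> simp only [code, Nat.pair_eq_pair, Ty.code_inj] at h <;> grind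

theorem Tm.code_inj {σ : Ty} {t u : Tm σ} : t.code = u.code ↔ t = u :=
  ⟨fun h => by cases sigma_eq_of_code_eq t u h; rfl, fun h => by rw [h]⟩

/-- An injective numbering of formulas. -/
def Formula.code : Formula → ℕ
  | .eq t u => Nat.pair 0 (Nat.pair t.code u.code)
  | .lt t u => Nat.pair 1 (Nat.pair t.code u.code)
  | .falsum => Nat.pair 2 0
  | .imp φ ψ => Nat.pair 3 (Nat.pair φ.code ψ.code)
  | .all σ φ => Nat.pair 4 (Nat.pair σ.code φ.code)

theorem Formula.code_injective : Function.Injective Formula.code := by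
  intro φ
  induction φ with
  | imp φ₁ φ₂ ih₁ ih₂ =>
    intro ψ h
    cases ψ <;> simp only [code, Nat.pair_eq_pair] at h <;> try omega
    rw [ih₁ h.2.1, ih₂ h.2.2]
  | all σ φ ih =>
    intro ψ h
    cases ψ <;> simp only [code, Nat.pair_eq_pair] at h <;> try omega
    rw [Ty.code_inj.1 h.2.1, ih h.2.2]
  | _ =>
    intro ψ h
    cases ψ <;> simp_all [code, Nat.pair_eq_pair, Tm.code_inj]

instance : Countable Formula := Formula.code_injective.countable

/-! ### Fresh variables -/

/-- Agreement of two substitutions on all variables of index less than `n`. -/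
def Subst.AgreeBelow (n : ℕ) (s s' : Subst) : Prop := ∀ τ, ∀ i < n, s τ i = s' τ i

theorem Subst.AgreeBelow.under {n : ℕ} {s s' : Subst} (h : AgreeBelow n s s') (σ : Ty) :
    AgreeBelow n (s.under σ) (s'.under σ) := by
  intro τ i hi
  cases i with
  | zero => simp [Subst.under, h τ 0 hi]
  | succ i => simp [Subst.under, h τ i (by omega), h τ (i + 1) hi]

theorem Tm.eventually_subst_congr {σ : Ty} (t : Tm σ) :
    ∀ᶠ n in Filter.atTop, ∀ s s', Subst.AgreeBelow n s s' → t.subst s = t.subst s' := by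
  induction t with
  | var σ i =>
    filter_upwards [Filter.eventually_gt_atTop i] with n hn s s' h using h σ i hn
  | app f x ih₁ ih₂ =>
    filter_upwards [ih₁, ih₂] with n h₁ h₂ s s' h
    rw [subst, subst, h₁ s s' h, h₂ s s' h]
  | _ => exact .of_forall fun _ _ _ _ => rfl

theorem Formula.eventually_subst_congr (φ : Formula) :
    ∀ᶠ n in Filter.atTop, ∀ s s', Subst.AgreeBelow n s s' → φ.subst s = φ.subst s' := by
  induction φ with
  | falsum => exact .of_forall fun _ _ _ _ => rfl
  | eq t u | lt t u =>
    filter_upwards [t.eventually_subst_congr, u.eventually_subst_congr] with n h₁ h₂ s s' h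
    rw [subst, subst, h₁ s s' h, h₂ s s' h]
  | imp φ ψ ih₁ ih₂ =>
    filter_upwards [ih₁, ih₂] with n h₁ h₂ s s' h
    rw [subst, subst, h₁ s s' h, h₂ s s' h]
  | all σ φ ih =>
    filter_upwards [ih] with n hn s s' h
    rw [subst, subst, hn _ _ (h.under σ)]

theorem Proves.exists_generalize {T : Set Formula} (hT : SubstClosed T) (Γ : List Formula)
    (σ : Ty) (φ : Formula) :
    ∃ i : ℕ, Proves T Γ (φ.inst (.var σ i)) → Proves T Γ (.all σ φ) := by
  obtain ⟨n, hn⟩ := ((Filter.eventually_all_finite (φ :: Γ).finite_toSet).2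
    fun ψ _ => ψ.eventually_subst_congr).exists
  refine ⟨n, fun h => .allIntro ?_⟩
  let r : Subst := fun τ j => if τ = σ ∧ j = n then .var τ 0 else .var τ (shift σ τ j)
  have hr : Subst.AgreeBelow n r (.weaken σ) := fun τ i hi => by
    simp [r, Subst.weaken, hi.ne]
  have h_assumptions : Γ.map (·.subst r) = Γ.map (Formula.lift σ) :=
    List.map_congr_left fun ψ hψ => hn ψ (List.mem_cons_of_mem _ hψ) _ _ hr
  have h_conclusion : (φ.inst (.var σ n)).subst r = φ := by
    rw [Formula.inst_eq_subst, Formula.subst_subst, Subst.push_comp]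
    conv_rhs => rw [← φ.subst_id]
    refine hn φ List.mem_cons_self _ _ fun τ i hi => ?_
    rcases eq_or_ne τ σ with rfl | hτ
    · cases i with
      | zero => simp [Subst.push, Tm.subst, Subst.id, r]
      | succ j =>
        simp [Subst.push, Subst.comp, Tm.subst, Subst.id, r, shift, (show j ≠ n by omega)]
    · simp [Subst.push, Subst.comp, Tm.subst, Subst.id, r, hτ, shift]
  simpa only [h_assumptions, h_conclusion] using h.subst hT r

/-! ### Henkin theories -/

/-- Consistency of the assumptions `Γ` with the axioms `T`. -/
def Consistent (T : Set Formula) (Γ : List Formula) : Prop := ¬ Proves T Γ .falsum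

/-- `φ` or its negation is a member of `Δ`; if it is the negation of a universal formula, then `Δ`
also contains a counterexample. -/
def Formula.DecidedIn (φ : Formula) (Δ : List Formula) : Prop :=
  φ ∈ Δ ∨ φ.neg ∈ Δ ∧ ∀ σ ψ, φ = .all σ ψ → ∃ t : Tm σ, (ψ.inst t).neg ∈ Δ

/-- A complete set of formulas that is closed under derivability from `T` and contains, with each
negated universal formula, a counterexample. -/
structure IsHenkin (T H : Set Formula) : Prop where
  closed : ∀ {Γ : List Formula} {φ : Formula}, (∀ ψ ∈ Γ, ψ ∈ H) → Proves T Γ φ → φ ∈ H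
  consistent : Formula.falsum ∉ H
  complete : ∀ φ, φ ∈ H ∨ φ.neg ∈ H
  witness : ∀ {σ : Ty} {φ : Formula}, (Formula.all σ φ).neg ∈ H → ∃ t : Tm σ, (φ.inst t).neg ∈ H

theorem Consistent.exists_decidedIn {T : Set Formula} (hT : SubstClosed T) {Γ : List Formula}
    (hΓ : Consistent T Γ) (φ : Formula) :
    ∃ Δ, Consistent T Δ ∧ Γ ⊆ Δ ∧ φ.DecidedIn Δ := by
  by_cases h : Consistent T (φ :: Γ)
  · exact ⟨φ :: Γ, h, List.subset_cons_self _ _, .inl List.mem_cons_self⟩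
  have h_neg : Consistent T (φ.neg :: Γ) := fun h' =>
    hΓ (.impElim (.impIntro (not_not.1 h)) (.byContra h'))
  by_cases h_all : ∃ σ ψ, φ = .all σ ψ
  · obtain ⟨σ, ψ, rfl⟩ := h_all
    obtain ⟨i, hi⟩ := Proves.exists_generalize hT ((Formula.all σ ψ).neg :: Γ) σ ψ
    refine ⟨(ψ.inst (.var σ i)).neg :: (Formula.all σ ψ).neg :: Γ, fun h' => h_neg ?_,
      fun χ hχ => by simp [hχ], .inr ⟨by simp, ?_⟩⟩
    · exact .impElim (.hyp List.mem_cons_self) (hi (.byContra h'))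
    · rintro _ _ ⟨⟩
      exact ⟨.var σ i, List.mem_cons_self⟩
  · exact ⟨φ.neg :: Γ, h_neg, List.subset_cons_self _ _, .inr ⟨List.mem_cons_self,
      fun σ ψ e => (h_all ⟨σ, ψ, e⟩).elim⟩⟩

theorem exists_subset_of_monotone {α : Type*} {Δ : ℕ → List α} (h_mono : ∀ n, Δ n ⊆ Δ (n + 1))
    {Γ : List α} (hΓ : ∀ a ∈ Γ, ∃ n, a ∈ Δ n) : ∃ n, Γ ⊆ Δ n := by
  classical
  have h_dir : Monotone fun n => {a | a ∈ Δ n} := monotone_nat_of_le_succ fun n _ ha => h_mono n ha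
  obtain ⟨n, hn⟩ := h_dir.directed_le.exists_mem_subset_of_finset_subset_biUnion
    (s := Γ.toFinset) fun a ha => Set.mem_iUnion.2 (hΓ a (by simpa using ha))
  exact ⟨n, fun a ha => hn (by simpa using ha)⟩

theorem isHenkin_of_chain {T : Set Formula} {Δ : ℕ → List Formula}
    (h_mono : ∀ n, Δ n ⊆ Δ (n + 1)) (h_cons : ∀ n, Consistent T (Δ n))
    (h_dec : ∀ φ : Formula, ∃ n, φ.DecidedIn (Δ n)) : IsHenkin T {φ | ∃ n, φ ∈ Δ n} := by
  have complete : ∀ φ, (∃ n, φ ∈ Δ n) ∨ ∃ n, φ.neg ∈ Δ n := fun φ => by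
    obtain ⟨n, h | h⟩ := h_dec φ
    exacts [.inl ⟨n, h⟩, .inr ⟨n, h.1⟩]
  have closed : ∀ {Γ : List Formula} {φ : Formula}, (∀ ψ ∈ Γ, ∃ n, ψ ∈ Δ n) → Proves T Γ φ →
      ∃ n, φ ∈ Δ n := by
    intro Γ φ hΓ h
    refine (complete φ).resolve_right fun h_neg => ?_
    obtain ⟨n, hn⟩ := exists_subset_of_monotone h_mono (List.forall_mem_cons.2 ⟨h_neg, hΓ⟩)
    have h_falsum : Proves T (φ.neg :: Γ) .falsum :=
      .impElim (.hyp List.mem_cons_self) (h.weaken (List.subset_cons_self _ _))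
    exact h_cons n (h_falsum.weaken hn)
  have consistent : ¬ ∃ n, Formula.falsum ∈ Δ n := fun ⟨n, hn⟩ => h_cons n (.hyp hn)
  refine ⟨closed, consistent, complete, fun {σ φ} h => ?_⟩
  obtain ⟨n, h' | h'⟩ := h_dec (.all σ φ)
  · refine (consistent (closed (Γ := [(Formula.all σ φ).neg, .all σ φ]) ?_
      (.impElim (φ := .all σ φ) (.hyp List.mem_cons_self) (.hyp (by simp))))).elim
    simpa using ⟨h, n, h'⟩
  · exact (h'.2 σ φ rfl).imp fun t ht => ⟨n, ht⟩

theorem exists_isHenkin {T : Set Formula} (hT : SubstClosed T) {φ : Formula}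
    (hφ : ¬ Proves T [] φ) : ∃ H, IsHenkin T H ∧ φ.neg ∈ H := by
  have : Nonempty Formula := ⟨φ⟩
  obtain ⟨enum, h_enum⟩ := exists_surjective_nat Formula
  choose extend h_cons h_sub h_dec using
    fun Γ : {Γ // Consistent T Γ} => Γ.2.exists_decidedIn hT
  let Δ : ℕ → {Γ // Consistent T Γ} := fun n =>
    n.rec ⟨[φ.neg], fun h => hφ (.byContra h)⟩ fun n Γ => ⟨extend Γ (enum n), h_cons Γ (enum n)⟩
  refine ⟨{ψ | ∃ n, ψ ∈ (Δ n).1}, isHenkin_of_chain (fun n => h_sub (Δ n) (enum n))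
    (fun n => (Δ n).2) fun ψ => ?_, 0, List.mem_cons_self⟩
  obtain ⟨n, rfl⟩ := h_enum ψ
  exact ⟨n + 1, h_dec (Δ n) (enum n)⟩

/-! ### Structures and satisfaction -/

/-- A structure for the language `L_ω`, with an arbitrary domain for each type. Equality at type `0`
is interpreted by equality of objects. -/
structure Str where
  Obj : Ty → Type
  app : {σ τ : Ty} → Obj (σ ⇾ τ) → Obj σ → Obj τ
  zero : Obj .nat
  succ : Obj (.nat ⇾ .nat)
  add : Obj (.nat ⇾ .nat ⇾ .nat)
  mul : Obj (.nat ⇾ .nat ⇾ .nat)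
  combK (ρ τ : Ty) : Obj (ρ ⇾ τ ⇾ ρ)
  combS (δ ρ τ : Ty) : Obj ((δ ⇾ ρ ⇾ τ) ⇾ (δ ⇾ ρ) ⇾ δ ⇾ τ)
  recursor : Obj (.nat ⇾ (.nat ⇾ .nat ⇾ .nat) ⇾ .nat ⇾ .nat)
  lt : Obj .nat → Obj .nat → Prop

namespace Str

/-- An assignment of objects to the variables. -/
abbrev Env (M : Str) := (σ : Ty) → ℕ → M.Obj σ

/-- The assignment of `x` to `var σ 0` and of the values of `e` to the remaining variables, those of
type `σ` being lowered by one. -/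
def Env.push {M : Str} {σ : Ty} (x : M.Obj σ) (e : M.Env) : M.Env := fun τ i =>
  if h : τ = σ then
    match i with
    | 0 => h ▸ x
    | j + 1 => e τ j
  else e τ i

/-- The value of a term. -/
def eval (M : Str) (e : M.Env) : {σ : Ty} → Tm σ → M.Obj σ
  | _, .var σ i => e σ i
  | _, .zero => M.zero
  | _, .succ => M.succ
  | _, .add => M.add
  | _, .mul => M.mul
  | _, .combK ρ τ => M.combK ρ τ
  | _, .combS δ ρ τ => M.combS δ ρ τ
  | _, .recursor => M.recursor
  | _, .app f x => M.app (M.eval e f) (M.eval e x)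

/-- The assignment of the values of the terms of `s` under `e`. -/
def Env.subst {M : Str} (e : M.Env) (s : Subst) : M.Env := fun τ i => M.eval e (s τ i)

/-- Truth of a formula under an assignment. -/
def Sat (M : Str) : Formula → M.Env → Prop
  | .eq t u, e => M.eval e t = M.eval e u
  | .lt t u, e => M.lt (M.eval e t) (M.eval e u)
  | .falsum, _ => False
  | .imp φ ψ, e => M.Sat φ e → M.Sat ψ e
  | .all σ φ, e => ∀ x : M.Obj σ, M.Sat φ (e.push x)

/-- Functional objects with the same values are equal. -/
def Extensional (M : Str) : Prop :=
  ∀ {σ τ : Ty} (F G : M.Obj (σ ⇾ τ)), (∀ x, M.app F x = M.app G x) → F = G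

variable {M : Str} {σ : Ty}

theorem Env.push_zero (x : M.Obj σ) (e : M.Env) : push x e σ 0 = x := by
  simp [push]

theorem Env.push_succ (x : M.Obj σ) (e : M.Env) (i : ℕ) : push x e σ (i + 1) = e σ i := by
  simp [push]

theorem Env.push_of_ne {τ : Ty} (h : τ ≠ σ) (x : M.Obj σ) (e : M.Env) (i : ℕ) :
    push x e τ i = e τ i := by
  simp [push, h]

theorem Env.eq_push {x : M.Obj σ} {e e' : M.Env} (h_zero : e' σ 0 = x)
    (h_succ : ∀ i, e' σ (i + 1) = e σ i) (h_ne : ∀ τ, τ ≠ σ → e' τ = e τ) : e' = push x e := by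
  funext τ i
  rcases eq_or_ne τ σ with rfl | h
  · cases i with
    | zero => rw [push_zero, h_zero]
    | succ i => rw [push_succ, h_succ]
  · rw [push_of_ne h, h_ne τ h]

theorem eval_subst (e : M.Env) (s : Subst) (t : Tm σ) :
    M.eval e (t.subst s) = M.eval (e.subst s) t := by
  induction t <;> simp_all [Tm.subst, eval, Env.subst]

theorem Env.subst_id (e : M.Env) : e.subst .id = e := rfl

theorem Env.subst_push (e : M.Env) (t : Tm σ) (s : Subst) :
    e.subst (.push t s) = (e.subst s).push (M.eval e t) :=
  eq_push (by simp only [subst, Subst.push_zero]) (fun i => by simp only [subst, Subst.push_succ])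
    fun τ h => funext fun i => by simp only [subst, Subst.push_of_ne h]

theorem Env.push_subst_weaken (e : M.Env) (x : M.Obj σ) : (e.push x).subst (.weaken σ) = e := by
  funext τ i
  rcases eq_or_ne τ σ with rfl | h
  · simp [subst, Subst.weaken, shift, eval, push_succ]
  · simp [subst, Subst.weaken, shift, eval, h, push_of_ne h]

theorem Env.subst_comp (e : M.Env) (s s' : Subst) : e.subst (s.comp s') = (e.subst s').subst s :=
  funext₂ fun τ i => eval_subst e s' (s τ i)

theorem Env.push_subst_under (e : M.Env) (x : M.Obj σ) (s : Subst) :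
    (e.push x).subst (s.under σ) = (e.subst s).push x := by
  rw [Subst.under_eq_push, subst_push, subst_comp, push_subst_weaken, eval, push_zero]

theorem eval_rename_shift {τ : Ty} (e : M.Env) (x : M.Obj σ) (t : Tm τ) :
    M.eval (e.push x) (t.rename (shift σ)) = M.eval e t := by
  rw [Tm.rename_shift, eval_subst, Env.push_subst_weaken]

theorem sat_subst (φ : Formula) (e : M.Env) (s : Subst) :
    M.Sat (φ.subst s) e ↔ M.Sat φ (e.subst s) := by
  induction φ generalizing e s <;>
    simp_all [Formula.subst, Sat, eval_subst, Env.push_subst_under]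

theorem sat_inst (φ : Formula) (e : M.Env) (t : Tm σ) :
    M.Sat (φ.inst t) e ↔ M.Sat φ (e.push (M.eval e t)) := by
  rw [Formula.inst_eq_subst, sat_subst, Env.subst_push, Env.subst_id]

theorem sat_neg (φ : Formula) (e : M.Env) : M.Sat φ.neg e ↔ ¬ M.Sat φ e := Iff.rfl

theorem sat_and (φ ψ : Formula) (e : M.Env) :
    M.Sat (φ.and ψ) e ↔ M.Sat φ e ∧ M.Sat ψ e := by
  simp [Formula.and, Formula.neg, Sat]

theorem sat_or (φ ψ : Formula) (e : M.Env) :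
    M.Sat (φ.or ψ) e ↔ M.Sat φ e ∨ M.Sat ψ e := by
  simp only [Formula.or, Formula.neg, Sat]; tauto

theorem sat_iff (φ ψ : Formula) (e : M.Env) :
    M.Sat (φ.iff ψ) e ↔ (M.Sat φ e ↔ M.Sat ψ e) := by
  simp only [Formula.iff, sat_and, Sat]; tauto

theorem sat_ex (σ : Ty) (φ : Formula) (e : M.Env) :
    M.Sat (.ex σ φ) e ↔ ∃ x : M.Obj σ, M.Sat φ (e.push x) := by
  simp [Formula.ex, Formula.neg, Sat]

theorem sat_eqAt (hM : M.Extensional) (t u : Tm σ) (e : M.Env) :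
    M.Sat (eqAt σ t u) e ↔ M.eval e t = M.eval e u := by
  induction σ generalizing e with
  | nat => rfl
  | arrow σ τ _ ih =>
    simp only [eqAt, Sat, ih, eval, eval_rename_shift, Env.push_zero]
    exact ⟨hM _ _, fun h x => by rw [h]⟩

end Str

/-! ### Completeness -/

theorem Tm.rename_shift_subst_single {σ τ : Ty} (t : Tm σ) (u : Tm τ) :
    (u.rename (shift σ)).subst (.single t) = u := by
  rw [Subst.single_eq_push, rename_shift, subst_subst, Subst.weaken_comp_push, subst_id]

/-- `T` contains the axioms of extensionality at all types. -/
def HasExt (T : Set Formula) : Prop :=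
  ∀ ⦃ρ τ : Ty⦄ (F : Tm (ρ ⇾ τ)) (x y : Tm ρ), (eqAt ρ x y ⟹ eqAt τ (F ⬝ x) (F ⬝ y)) ∈ T

namespace IsHenkin

variable {T H : Set Formula}

theorem imp_mem_iff (h : IsHenkin T H) {φ ψ : Formula} : (φ ⟹ ψ) ∈ H ↔ (φ ∈ H → ψ ∈ H) := by
  constructor
  · intro h₁ h₂
    refine h.closed (Γ := [φ ⟹ ψ, φ]) ?_
      (.impElim (φ := φ) (.hyp List.mem_cons_self) (.hyp (by simp)))
    simp [h₁, h₂]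
  · intro h'
    rcases h.complete φ with h₁ | h₁
    · exact h.closed (Γ := [ψ]) (by simpa using h' h₁) (.impIntro (.hyp (by simp)))
    · refine h.closed (Γ := [φ.neg]) (by simpa using h₁) (.impIntro (.byContra ?_))
      exact .impElim (φ := φ) (.hyp (by simp [Formula.neg])) (.hyp (by simp))

theorem all_mem_iff (h : IsHenkin T H) {σ : Ty} {φ : Formula} :
    .all σ φ ∈ H ↔ ∀ t : Tm σ, φ.inst t ∈ H := by
  constructor
  · intro h₁ t
    exact h.closed (Γ := [.all σ φ]) (by simpa using h₁) (.allElim t (.hyp (by simp)))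
  · intro h'
    refine (h.complete _).resolve_right fun hn => ?_
    obtain ⟨t, ht⟩ := h.witness hn
    exact h.consistent (h.imp_mem_iff.1 ht (h' t))

theorem mem_of_ax (h : IsHenkin T H) {φ : Formula} (hφ : φ ∈ T) : φ ∈ H :=
  h.closed (Γ := []) (by simp) (.ax hφ)

theorem inst_mem_of_eq_mem (h : IsHenkin T H) {s t : Tm .nat} (φ : Formula) (h₁ : (s ≐ t) ∈ H)
    (h₂ : φ.inst s ∈ H) : φ.inst t ∈ H :=
  h.closed (Γ := [s ≐ t, φ.inst s]) (by simp [h₁, h₂])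
    (.eqSubst (s := s) φ (.hyp (by simp)) (.hyp (by simp)))

theorem eqAt_arrow_mem_iff (h : IsHenkin T H) {σ τ : Ty} {f g : Tm (σ ⇾ τ)} :
    eqAt (σ ⇾ τ) f g ∈ H ↔ ∀ t : Tm σ, eqAt τ (f ⬝ t) (g ⬝ t) ∈ H := by
  simp only [eqAt, h.all_mem_iff, Formula.inst, eqAt_subst, Tm.subst,
    Tm.rename_shift_subst_single]
  simp [Subst.single]

theorem eqAt_refl (h : IsHenkin T H) {σ : Ty} (t : Tm σ) : eqAt σ t t ∈ H := by
  induction σ with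
  | nat => exact h.closed (Γ := []) (by simp) (.eqRefl t)
  | arrow σ τ _ ih => exact h.eqAt_arrow_mem_iff.2 fun _ => ih _

theorem eq_symm (h : IsHenkin T H) {t u : Tm .nat} (h₁ : (t ≐ u) ∈ H) : (u ≐ t) ∈ H := by
  have := h.inst_mem_of_eq_mem (.var .nat 0 ≐ t.rename (shift .nat)) h₁
  simp only [Formula.inst, Formula.subst, Tm.rename_shift_subst_single] at this
  exact this (h.eqAt_refl t)

theorem eq_trans (h : IsHenkin T H) {t u v : Tm .nat} (h₁ : (t ≐ u) ∈ H) (h₂ : (u ≐ v) ∈ H) :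
    (t ≐ v) ∈ H := by
  have := h.inst_mem_of_eq_mem (t.rename (shift .nat) ≐ .var .nat 0) h₂
  simp only [Formula.inst, Formula.subst, Tm.rename_shift_subst_single] at this
  exact this h₁

theorem lt_congr (h : IsHenkin T H) {t t' u u' : Tm .nat} (h₁ : (t ≐ t') ∈ H)
    (h₂ : (u ≐ u') ∈ H) (h₃ : (t ≺ u) ∈ H) : (t' ≺ u') ∈ H := by
  have h_left := h.inst_mem_of_eq_mem (.var .nat 0 ≺ u.rename (shift .nat)) h₁
  have h_right := h.inst_mem_of_eq_mem (t'.rename (shift .nat) ≺ .var .nat 0) h₂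
  simp only [Formula.inst, Formula.subst, Tm.rename_shift_subst_single] at h_left h_right
  exact h_right (h_left h₃)

theorem eqAt_symm (h : IsHenkin T H) {σ : Ty} {t u : Tm σ} (h₁ : eqAt σ t u ∈ H) :
    eqAt σ u t ∈ H := by
  induction σ with
  | nat => exact h.eq_symm h₁
  | arrow σ τ _ ih =>
    rw [h.eqAt_arrow_mem_iff] at h₁ ⊢
    exact fun v => ih (h₁ v)

theorem eqAt_trans (h : IsHenkin T H) {σ : Ty} {t u v : Tm σ} (h₁ : eqAt σ t u ∈ H)
    (h₂ : eqAt σ u v ∈ H) : eqAt σ t v ∈ H := by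
  induction σ with
  | nat => exact h.eq_trans h₁ h₂
  | arrow σ τ _ ih =>
    rw [h.eqAt_arrow_mem_iff] at h₁ h₂ ⊢
    exact fun w => ih (h₁ w) (h₂ w)

/-- Provable extensional equality of terms. -/
def setoid (h : IsHenkin T H) (σ : Ty) : Setoid (Tm σ) where
  r t u := eqAt σ t u ∈ H
  iseqv := ⟨h.eqAt_refl, h.eqAt_symm, h.eqAt_trans⟩

theorem app_congr (h : IsHenkin T H) (hT : HasExt T) {σ τ : Ty} {f g : Tm (σ ⇾ τ)}
    {t u : Tm σ} (h₁ : eqAt (σ ⇾ τ) f g ∈ H) (h₂ : eqAt σ t u ∈ H) :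
    eqAt τ (f ⬝ t) (g ⬝ u) ∈ H :=
  h.eqAt_trans (h.imp_mem_iff.1 (h.mem_of_ax (hT f t u)) h₂) (h.eqAt_arrow_mem_iff.1 h₁ u)

/-- The structure of terms modulo provable extensional equality. -/
def termStr (h : IsHenkin T H) (hT : HasExt T) : Str where
  Obj σ := Quotient (h.setoid σ)
  app := Quotient.map₂ (fun f t => f ⬝ t) fun _ _ h₁ _ _ h₂ => h.app_congr hT h₁ h₂
  zero := Quotient.mk _ .zero
  succ := Quotient.mk _ .succ
  add := Quotient.mk _ .add
  mul := Quotient.mk _ .mul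
  combK ρ τ := Quotient.mk _ (.combK ρ τ)
  combS δ ρ τ := Quotient.mk _ (.combS δ ρ τ)
  recursor := Quotient.mk _ .recursor
  lt := Quotient.lift₂ (fun t u => (t ≺ u) ∈ H) fun _ _ _ _ h₁ h₂ =>
    propext ⟨h.lt_congr h₁ h₂, h.lt_congr (h.eq_symm h₁) (h.eq_symm h₂)⟩

variable (h : IsHenkin T H) (hT : HasExt T)

/-- The assignment to each variable of the class of the term substituted for it. -/
def env (s : Subst) : (h.termStr hT).Env := fun σ i => Quotient.mk (h.setoid σ) (s σ i)

theorem eval_env (s : Subst) {σ : Ty} (t : Tm σ) :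
    (h.termStr hT).eval (h.env hT s) t = Quotient.mk (h.setoid σ) (t.subst s) := by
  induction t with
  | app f t ih₁ ih₂ => simp only [Str.eval, ih₁, ih₂]; rfl
  | _ => rfl

theorem env_push {σ : Ty} (s : Subst) (t : Tm σ) :
    h.env hT (.push t s) =
      Str.Env.push (M := h.termStr hT) (Quotient.mk (h.setoid σ) t) (h.env hT s) :=
  Str.Env.eq_push (by rw [env, Subst.push_zero]) (fun i => by rw [env, Subst.push_succ]; rfl)
    fun τ hτ => funext fun i => by rw [env, Subst.push_of_ne hτ]; rfl

theorem sat_env (φ : Formula) (s : Subst) :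
    (h.termStr hT).Sat φ (h.env hT s) ↔ φ.subst s ∈ H := by
  induction φ generalizing s with
  | eq t u =>
    simp only [Str.Sat, eval_env, Formula.subst]
    exact Quotient.eq (r := h.setoid .nat)
  | lt t u =>
    simp only [Str.Sat, eval_env, Formula.subst]
    rfl
  | falsum => exact ⟨False.elim, h.consistent⟩
  | imp φ ψ ih₁ ih₂ => simp only [Str.Sat, ih₁, ih₂, Formula.subst, h.imp_mem_iff]
  | all σ φ ih =>
    simp only [Str.Sat, Formula.subst, h.all_mem_iff, Formula.subst_under_inst, ← ih, env_push]
    exact ⟨fun h' t => h' _, fun h' x => Quotient.inductionOn x h'⟩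

theorem exists_env_eq (e : (h.termStr hT).Env) : ∃ s, h.env hT s = e :=
  ⟨fun σ i => Quotient.out (s := h.setoid σ) (e σ i),
    funext₂ fun σ i => Quotient.out_eq (s := h.setoid σ) (e σ i)⟩

theorem termStr_extensional : (h.termStr hT).Extensional := by
  intro σ τ F G
  refine Quotient.inductionOn₂ (s₁ := h.setoid _) (s₂ := h.setoid _) F G fun f g hfg => ?_
  refine Quotient.sound (s := h.setoid _) (h.eqAt_arrow_mem_iff.2 fun t => ?_)
  exact Quotient.exact (s := h.setoid τ) (hfg (Quotient.mk _ t))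

end IsHenkin

theorem Proves.of_forall_sat {T : Set Formula} (h_ext : HasExt T) (hT : SubstClosed T)
    {φ : Formula}
    (h : ∀ M : Str, M.Extensional → (∀ ψ ∈ T, ∀ e, M.Sat ψ e) → ∀ e, M.Sat φ e) :
    Proves T [] φ := by
  by_contra hφ
  obtain ⟨H, hH, h_neg⟩ := exists_isHenkin hT hφ
  have h_model : ∀ ψ ∈ T, ∀ e, (hH.termStr h_ext).Sat ψ e := fun ψ hψ e => by
    obtain ⟨s, rfl⟩ := hH.exists_env_eq h_ext e
    exact (hH.sat_env h_ext ψ s).2 (hH.mem_of_ax (hT ψ hψ s))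
  have h_sat := h _ (hH.termStr_extensional h_ext) h_model (hH.env h_ext .id)
  rw [hH.sat_env, Formula.subst_id] at h_sat
  exact hH.consistent (hH.imp_mem_iff.1 h_neg h_sat)

/-! ### Models of `ACA₀^ω` -/

infixl:90 " ⬩ " => Str.app _

namespace Str

/-- An extensional structure satisfying the axioms of `ACA₀^ω`. -/
class IsModel (M : Str) : Prop where
  extensional : M.Extensional
  sat_of_mem : ∀ φ ∈ ACA, ∀ e, M.Sat φ e

/-- The numbers of a structure, which may be nonstandard. -/
abbrev N (M : Str) : Type := M.Obj .nat

/-- The constant zero functional of each type. -/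
def default (M : Str) : (σ : Ty) → M.Obj σ
  | .nat => M.zero
  | .arrow _ τ => M.combK _ _ ⬩ M.default τ

instance (M : Str) (σ : Ty) : Nonempty (M.Obj σ) := ⟨M.default σ⟩

/-- The assignment of the constant zero functionals to all variables. -/
def env₀ (M : Str) : M.Env := fun σ _ => M.default σ

attribute [simp] Env.push_zero Env.push_succ

theorem Env.push_comm {M : Str} {σ τ : Ty} (h : σ ≠ τ) (e : M.Env) (x : M.Obj σ)
    (y : M.Obj τ) : (e.push x).push y = (e.push y).push x := by
  refine eq_push (by rw [push_of_ne h, push_zero])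
    (fun i => by rw [push_of_ne h, push_succ, push_of_ne h]) fun ρ hρ => funext fun i => ?_
  rcases eq_or_ne ρ τ with rfl | h'
  · cases i with
    | zero => rw [push_zero, push_zero]
    | succ i => rw [push_succ, push_succ, push_of_ne hρ]
  · rw [push_of_ne h', push_of_ne h', push_of_ne hρ]

theorem sat_lift {M : Str} {σ : Ty} (φ : Formula) (e : M.Env) (x : M.Obj σ) :
    M.Sat (φ.lift σ) (e.push x) ↔ M.Sat φ e := by
  rw [Formula.lift_eq_subst, sat_subst, Env.push_subst_weaken]

section Models

variable {M : Str} [M.IsModel]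

theorem ext {σ τ : Ty} {F G : M.Obj (σ ⇾ τ)} (h : ∀ x, F ⬩ x = G ⬩ x) : F = G :=
  IsModel.extensional F G h

theorem sat_rca {φ : Formula} (h : RCA φ) (e : M.Env) : M.Sat φ e :=
  IsModel.sat_of_mem _ (.inl h) e

theorem app_succ_ne_zero (x : M.N) : M.succ ⬩ x ≠ M.zero := by
  simpa [sat_neg, Sat, eval] using sat_rca (.succ_ne_zero (.var .nat 0)) (M.env₀.push x)

theorem app_succ_injective : Function.Injective (M.succ ⬩ · : M.N → M.N) := fun x y h => by
  simpa [Sat, eval, h] using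
    sat_rca (.succ_inj (.var .nat 1) (.var .nat 0)) ((M.env₀.push x).push y)

theorem app_add_zero (x : M.N) : M.add ⬩ x ⬩ M.zero = x := by
  simpa [Sat, eval] using sat_rca (.add_zero (.var .nat 0)) (M.env₀.push x)

theorem app_add_succ (x y : M.N) : M.add ⬩ x ⬩ (M.succ ⬩ y) = M.succ ⬩ (M.add ⬩ x ⬩ y) := by
  simpa [Sat, eval, Env.push] using
    sat_rca (.add_succ (.var .nat 1) (.var .nat 0)) ((M.env₀.push x).push y)

theorem app_mul_zero (x : M.N) : M.mul ⬩ x ⬩ M.zero = M.zero := by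
  simpa [Sat, eval] using sat_rca (.mul_zero (.var .nat 0)) (M.env₀.push x)

theorem app_mul_succ (x y : M.N) :
    M.mul ⬩ x ⬩ (M.succ ⬩ y) = M.add ⬩ (M.mul ⬩ x ⬩ y) ⬩ x := by
  simpa [Sat, eval, Env.push] using
    sat_rca (.mul_succ (.var .nat 1) (.var .nat 0)) ((M.env₀.push x).push y)

theorem not_lt_zero (x : M.N) : ¬ M.lt x M.zero := by
  simpa [sat_neg, Sat, eval] using sat_rca (.not_lt_zero (.var .nat 0)) (M.env₀.push x)

theorem lt_app_succ_iff (x y : M.N) : M.lt x (M.succ ⬩ y) ↔ M.lt x y ∨ x = y := by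
  simpa [sat_iff, sat_or, Sat, eval, Env.push] using
    sat_rca (.lt_succ (.var .nat 1) (.var .nat 0)) ((M.env₀.push x).push y)

theorem app_combK {ρ τ : Ty} (x : M.Obj ρ) (y : M.Obj τ) : M.combK ρ τ ⬩ x ⬩ y = x := by
  let e : M.Env := fun σ i =>
    if h : i = 0 ∧ σ = ρ then h.2 ▸ x
    else if h : i = 1 ∧ σ = τ then h.2 ▸ y
    else M.default σ
  have := sat_rca (.combK (.var ρ 0) (.var τ 1)) e
  rw [sat_eqAt IsModel.extensional] at this
  simpa [eval, e] using this

theorem app_combS {δ ρ τ : Ty} (x : M.Obj (δ ⇾ ρ ⇾ τ)) (y : M.Obj (δ ⇾ ρ)) (z : M.Obj δ) :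
    M.combS δ ρ τ ⬩ x ⬩ y ⬩ z = x ⬩ z ⬩ (y ⬩ z) := by
  let e : M.Env := fun σ i =>
    if h : i = 0 ∧ σ = (δ ⇾ ρ ⇾ τ) then h.2 ▸ x
    else if h : i = 1 ∧ σ = (δ ⇾ ρ) then h.2 ▸ y
    else if h : i = 2 ∧ σ = δ then h.2 ▸ z
    else M.default σ
  have := sat_rca (.combS (.var (δ ⇾ ρ ⇾ τ) 0) (.var (δ ⇾ ρ) 1) (.var δ 2)) e
  rw [sat_eqAt IsModel.extensional] at this
  simpa [eval, e] using this

theorem recursor_zero (m : M.N) (f : M.Obj (.nat ⇾ .nat ⇾ .nat)) :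
    M.recursor ⬩ m ⬩ f ⬩ M.zero = m := by
  simpa [Sat, eval, Env.push] using
    sat_rca (.rec_zero (.var .nat 0) (.var _ 0)) ((M.env₀.push m).push f)

theorem recursor_succ (m : M.N) (f : M.Obj (.nat ⇾ .nat ⇾ .nat)) (n : M.N) :
    M.recursor ⬩ m ⬩ f ⬩ (M.succ ⬩ n) = f ⬩ n ⬩ (M.recursor ⬩ m ⬩ f ⬩ n) := by
  simpa [Sat, eval, Env.push] using
    sat_rca (.rec_succ (.var .nat 1) (.var _ 0) (.var .nat 0))
      (((M.env₀.push m).push n).push f)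

theorem eq_zero_of_induction (f : M.Obj .one) (h_zero : f ⬩ M.zero = M.zero)
    (h_succ : ∀ n, f ⬩ n = M.zero → f ⬩ (M.succ ⬩ n) = M.zero) (n : M.N) : f ⬩ n = M.zero := by
  have := sat_rca (.induction (.var .one 0 ⬝ .var .nat 0 ≐ .zero) trivial) (M.env₀.push f)
  simp only [Sat, sat_inst, sat_subst] at this
  simp only [eval, Env.subst, Env.push, Subst.succZero, reduceCtorEq, ↓reduceDIte] at this
  exact this h_zero h_succ n

theorem exists_choice {A : Formula} (hA : A.QF) (e : M.Env)
    (h : ∀ x : M.Obj .one, ∃ y : M.N, M.Sat A ((e.push x).push y)) :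
    ∃ Y : M.Obj .two, ∀ x : M.Obj .one, M.Sat A ((e.push x).push (Y ⬩ x)) := by
  have := sat_rca (.choice A hA) e
  simp only [Sat, sat_ex, sat_inst] at this
  obtain ⟨Y, hY⟩ := this h
  refine ⟨Y, fun x => ?_⟩
  have h' := hY x
  rw [Env.push_comm (by decide) e Y x, Env.push_comm (by decide) _ Y, sat_lift] at h'
  simpa [eval, Env.push] using h'

/-! ### Functionals given by choice -/

theorem exists_characteristic {P : Formula} (hP : P.QF) (e : M.Env) :
    ∃ Y : M.Obj .two, ∀ x : M.Obj .one, Y ⬩ x = M.zero ↔ M.Sat P (e.push x) := by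
  let A : Formula :=
    .and (P.lift .nat ⟹ .var .nat 0 ≐ .zero) ((P.lift .nat).neg ⟹ .neg (.var .nat 0 ≐ .zero))
  have hA : A.QF := by
    have : (P.lift .nat).QF := hP.subst _
    simp [A, Formula.and, Formula.neg, Formula.QF, this]
  have h_sat : ∀ (x : M.Obj .one) (y : M.N), M.Sat A ((e.push x).push y) ↔
      (y = M.zero ↔ M.Sat P (e.push x)) := fun x y => by
    simp only [A, sat_and, sat_neg, Sat, sat_lift, eval, Env.push_zero]
    tauto
  obtain ⟨Y, hY⟩ := exists_choice hA e fun x => by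
    by_cases h : M.Sat P (e.push x)
    · exact ⟨M.zero, (h_sat x _).2 (by simp [h])⟩
    · exact ⟨M.succ ⬩ M.zero, (h_sat x _).2 (by simp [h, app_succ_ne_zero])⟩
  exact ⟨Y, fun x => (h_sat x _).1 (hY x)⟩

theorem exists_ltTest : ∃ Y : M.Obj .two, ∀ x : M.Obj .one,
    Y ⬩ x = M.zero ↔ M.lt (x ⬩ M.zero) (x ⬩ (M.succ ⬩ M.zero)) := by
  simpa [Sat, eval] using exists_characteristic
    (P := .var .one 0 ⬝ .zero ≺ .var .one 0 ⬝ (.succ ⬝ .zero)) trivial M.env₀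

theorem exists_eqTest : ∃ Y : M.Obj .two, ∀ x : M.Obj .one,
    Y ⬩ x = M.zero ↔ x ⬩ M.zero = x ⬩ (M.succ ⬩ M.zero) := by
  simpa [Sat, eval] using exists_characteristic
    (P := .var .one 0 ⬝ .zero ≐ .var .one 0 ⬝ (.succ ⬝ .zero)) trivial M.env₀

theorem exists_impTest : ∃ Y : M.Obj .two, ∀ x : M.Obj .one,
    Y ⬩ x = M.zero ↔ (x ⬩ M.zero = M.zero → x ⬩ (M.succ ⬩ M.zero) = M.zero) := by
  simpa [Sat, eval] using exists_characteristic
    (P := .var .one 0 ⬝ .zero ≐ .zero ⟹ .var .one 0 ⬝ (.succ ⬝ .zero) ≐ .zero)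
    ⟨trivial, trivial⟩ M.env₀

theorem exists_search : ∃ m : M.Obj .two, ∀ f : M.Obj .one,
    (∃ n, f ⬩ n = M.zero) → f ⬩ (m ⬩ f) = M.zero := by
  have h := IsModel.sat_of_mem existsTwo (.inr rfl) M.env₀
  simp only [existsTwo, sat_ex, sat_and, sat_iff, Sat] at h
  obtain ⟨E, -, hE⟩ := h
  replace hE : ∀ f : M.Obj .one, (∃ n, f ⬩ n = M.zero) ↔ E ⬩ f = M.zero := by
    simpa [eval, Env.push] using hE
  let A : Formula := .var .two 0 ⬝ .var .one 0 ≐ .zero ⟹ .var .one 0 ⬝ .var .nat 0 ≐ .zero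
  have h_sat : ∀ (f : M.Obj .one) (n : M.N), M.Sat A (((M.env₀.push E).push f).push n) ↔
      (E ⬩ f = M.zero → f ⬩ n = M.zero) := fun f n => by
    simp [A, Sat, eval, Env.push]
  obtain ⟨m, hm⟩ := exists_choice (A := A) ⟨trivial, trivial⟩ (M.env₀.push E) fun f => by
    simp only [h_sat, ← hE]
    by_cases h : ∃ n, f ⬩ n = M.zero
    · exact h.imp fun n hn _ => hn
    · exact ⟨M.zero, fun h' => (h h').elim⟩
  exact ⟨m, fun f hf => (h_sat f _).1 (hm f) ((hE f).1 hf)⟩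

end Models

/-! ### Representable functions -/

section Representable

variable {M : Str}

/-- Tuples of objects whose types are listed in `Γ`. -/
def Tuple (M : Str) : List Ty → Type
  | [] => Unit
  | σ :: Γ => M.Obj σ × M.Tuple Γ

/-- `p` is given by currying by an object of the structure, except that every function of the empty
tuple is admitted. -/
def Curried {τ : Ty} : (Γ : List Ty) → (M.Tuple Γ → M.Obj τ) → Prop
  | [], _ => True
  | σ :: Γ, p => ∃ F : M.Tuple Γ → M.Obj (σ ⇾ τ), Curried Γ F ∧ ∀ x c, p (x, c) = F c ⬩ x

section Curried

variable [M.IsModel] {σ τ : Ty}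

theorem Curried.const (Γ : List Ty) (x : M.Obj τ) : Curried Γ (fun _ => x) := by
  induction Γ generalizing τ with
  | nil => trivial
  | cons σ Γ ih => exact ⟨_, ih (M.combK _ _ ⬩ x), fun y _ => (app_combK x y).symm⟩

theorem Curried.app {Γ : List Ty} {p : M.Tuple Γ → M.Obj (σ ⇾ τ)} {q : M.Tuple Γ → M.Obj σ}
    (hp : Curried Γ p) (hq : Curried Γ q) : Curried Γ (fun c => p c ⬩ q c) := by
  induction Γ generalizing σ τ with
  | nil => trivial
  | cons ρ Γ ih =>
    obtain ⟨F, hF, hpF⟩ := hp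
    obtain ⟨G, hG, hqG⟩ := hq
    refine ⟨_, ih (ih (Curried.const Γ (M.combS _ _ _)) hF) hG, fun x c => ?_⟩
    change p (x, c) ⬩ q (x, c) = _
    rw [app_combS, hpF, hqG]

theorem Curried.weaken {Γ : List Ty} {p : M.Tuple Γ → M.Obj τ} (hp : Curried Γ p) :
    Curried (σ :: Γ) (fun c => p c.2) :=
  ⟨_, (Curried.const Γ (M.combK _ _)).app hp, fun x c => (app_combK (p c) x).symm⟩

theorem Curried.head {Γ : List Ty} :
    Curried (σ :: Γ) (fun c => c.1 : M.Tuple (σ :: Γ) → M.Obj σ) :=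
  ⟨_, Curried.const Γ (M.combS σ (σ ⇾ σ) σ ⬩ M.combK _ _ ⬩ M.combK _ _), fun x c => by
    rw [app_combS, app_combK]⟩

end Curried

/-- A type with a distinguished class of families indexed by tuples of objects, as in a
diffeological space. Objects, propositions and pairs of these carry such a class. -/
class Space (M : Str) (A : Type) where
  plot : (Γ : List Ty) → (M.Tuple Γ → A) → Prop
  const : ∀ Γ a, plot Γ fun _ => a
  weaken : ∀ {Γ p} (σ : Ty), plot Γ p → plot (σ :: Γ) fun c => p c.2

instance (σ : Ty) [M.IsModel] : Space M (M.Obj σ) where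
  plot _ p := Curried _ p
  const Γ a := Curried.const Γ a
  weaken _ h := h.weaken

instance [M.IsModel] : Space M Prop where
  plot Γ P := ∃ χ : M.Tuple Γ → M.N, Curried Γ χ ∧ ∀ c, P c ↔ χ c = M.zero
  const Γ P := by
    by_cases h : P
    · exact ⟨_, Curried.const Γ M.zero, fun c => by simp [h]⟩
    · exact ⟨_, Curried.const Γ (M.succ ⬩ M.zero), fun c => by simp [h, app_succ_ne_zero]⟩
  weaken _ := fun ⟨χ, h, h'⟩ => ⟨_, h.weaken, fun c => h' c.2⟩

instance {A B : Type} [Space M A] [Space M B] : Space M (A × B) where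
  plot Γ p := Space.plot (M := M) Γ (fun c => (p c).1) ∧ Space.plot (M := M) Γ (fun c => (p c).2)
  const Γ a := ⟨Space.const Γ a.1, Space.const Γ a.2⟩
  weaken σ h := ⟨Space.weaken σ h.1, Space.weaken σ h.2⟩

/-- Representable functions: those that preserve the distinguished families. -/
@[fun_prop]
def Rep (M : Str) {A B : Type} [Space M A] [Space M B] (f : A → B) : Prop :=
  ∀ Γ (p : M.Tuple Γ → A), Space.plot (M := M) Γ p → Space.plot (M := M) Γ fun c => f (p c)

namespace Rep

variable {A B C : Type} [Space M A] [Space M B] [Space M C]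

@[fun_prop] theorem id : Rep M fun a : A => a := fun _ _ h => h

@[fun_prop] theorem const (b : B) : Rep M fun _ : A => b := fun Γ _ _ => Space.const Γ b

@[fun_prop] theorem comp {g : B → C} {f : A → B} (hg : Rep M g) (hf : Rep M f) :
    Rep M fun a => g (f a) := fun Γ _ h => hg Γ _ (hf Γ _ h)

@[fun_prop] theorem prodMk {f : A → B} {g : A → C} (hf : Rep M f) (hg : Rep M g) :
    Rep M fun a => (f a, g a) := fun Γ _ h => ⟨hf Γ _ h, hg Γ _ h⟩

@[fun_prop] theorem fst {f : A → B × C} (hf : Rep M f) : Rep M fun a => (f a).1 :=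
  fun Γ _ h => (hf Γ _ h).1

@[fun_prop] theorem snd {f : A → B × C} (hf : Rep M f) : Rep M fun a => (f a).2 :=
  fun Γ _ h => (hf Γ _ h).2

theorem curry_right {f : A → B → C}
    (hf : Rep M fun p : A × B => f p.1 p.2) (a : A) : Rep M (f a) := by
  have : Rep M fun b : B => (a, b) := by fun_prop
  exact comp (g := fun p : A × B => f p.1 p.2) hf this

end Rep

variable [M.IsModel] {A : Type} [Space M A]

@[fun_prop] theorem Rep.app {σ τ : Ty} {f : A → M.Obj (σ ⇾ τ)} {g : A → M.Obj σ}
    (hf : Rep M f) (hg : Rep M g) : Rep M fun a => f a ⬩ g a :=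
  fun Γ _ h => Curried.app (hf Γ _ h) (hg Γ _ h)

/-- The object representing `f`, if there is one; arbitrary otherwise. -/
noncomputable def lam {σ τ : Ty} (f : M.Obj σ → M.Obj τ) : M.Obj (σ ⇾ τ) :=
  Classical.epsilon fun F => ∀ x, F ⬩ x = f x

theorem lam_app {σ τ : Ty} {f : M.Obj σ → M.Obj τ} (hf : Rep M f) (x : M.Obj σ) :
    lam f ⬩ x = f x := by
  obtain ⟨F, -, hF⟩ := hf [σ] _ (Curried.head (Γ := []))
  exact Classical.epsilon_spec (p := fun F => ∀ x, F ⬩ x = f x) ⟨F (), fun x => (hF x ()).symm⟩ x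

@[fun_prop] theorem Rep.lam {σ τ : Ty} {f : A → M.Obj σ → M.Obj τ}
    (hf : Rep M fun p : A × M.Obj σ => f p.1 p.2) : Rep M fun a => lam (f a) := by
  intro Γ p hp
  obtain ⟨F, hF, hfF⟩ := hf (σ :: Γ) (fun c => (p c.2, c.1)) ⟨Space.weaken σ hp, Curried.head⟩
  suffices h : (fun c => Str.lam (f (p c))) = F by rwa [h]
  funext c
  refine ext fun x => ?_
  rw [lam_app (hf.curry_right _), ← hfF]

/-- The function with values `a` at `0` and `b` elsewhere. -/
def pairFun (a b : M.N) : M.Obj .one := M.recursor ⬩ a ⬩ (M.combK _ _ ⬩ (M.combK _ _ ⬩ b))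

@[fun_prop] theorem Rep.pairFun {f g : A → M.N} (hf : Rep M f) (hg : Rep M g) :
    Rep M fun a => Str.pairFun (f a) (g a) := by
  unfold Str.pairFun; fun_prop

theorem pairFun_zero (a b : M.N) : pairFun a b ⬩ M.zero = a := recursor_zero _ _

theorem pairFun_one (a b : M.N) : pairFun a b ⬩ (M.succ ⬩ M.zero) = b := by
  rw [pairFun, recursor_succ, app_combK, app_combK]

theorem rep_of_iff_eq_zero {P : A → Prop} {χ : A → M.N} (h : Rep M χ)
    (hP : ∀ a, P a ↔ χ a = M.zero) : Rep M P :=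
  fun Γ p hp => ⟨_, h Γ p hp, fun _ => hP _⟩

theorem Rep.congr {P Q : A → Prop} (hP : Rep M P) (h : ∀ a, P a ↔ Q a) : Rep M Q := by
  rwa [show Q = P from funext fun a => propext (h a).symm]

theorem rep_eq : Rep M fun p : M.N × M.N => p.1 = p.2 := by
  obtain ⟨Y, hY⟩ := exists_eqTest (M := M)
  refine rep_of_iff_eq_zero (χ := fun p : M.N × M.N => Y ⬩ pairFun p.1 p.2) (by fun_prop)
    fun p => ?_
  rw [hY, pairFun_zero, pairFun_one]

theorem rep_lt : Rep M fun p : M.N × M.N => M.lt p.1 p.2 := by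
  obtain ⟨Y, hY⟩ := exists_ltTest (M := M)
  refine rep_of_iff_eq_zero (χ := fun p : M.N × M.N => Y ⬩ pairFun p.1 p.2) (by fun_prop)
    fun p => ?_
  rw [hY, pairFun_zero, pairFun_one]

@[fun_prop] theorem Rep.eq {f g : A → M.N} (hf : Rep M f) (hg : Rep M g) :
    Rep M fun a => f a = g a := rep_eq.comp (hf.prodMk hg)

@[fun_prop] theorem Rep.imp {P Q : A → Prop} (hP : Rep M P) (hQ : Rep M Q) :
    Rep M fun a => P a → Q a := by
  obtain ⟨Y, hY⟩ := exists_impTest (M := M)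
  intro Γ p hp
  obtain ⟨χ, hχ, hPχ⟩ := hP Γ p hp
  obtain ⟨ξ, hξ, hQξ⟩ := hQ Γ p hp
  have hY_rep : Rep M fun q : M.N × M.N => Y ⬩ Str.pairFun q.1 q.2 := by fun_prop
  refine ⟨_, hY_rep Γ (fun c => (χ c, ξ c)) ⟨hχ, hξ⟩, fun c => ?_⟩
  rw [hY, pairFun_zero, pairFun_one]
  exact imp_congr (hPχ c) (hQξ c)

@[fun_prop] theorem Rep.not {P : A → Prop} (hP : Rep M P) : Rep M fun a => ¬ P a :=
  hP.imp (Rep.const False)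

@[fun_prop] theorem Rep.or {P Q : A → Prop} (hP : Rep M P) (hQ : Rep M Q) :
    Rep M fun a => P a ∨ Q a := (hP.not.imp hQ).congr fun a => by tauto

@[fun_prop] theorem Rep.and {P Q : A → Prop} (hP : Rep M P) (hQ : Rep M Q) :
    Rep M fun a => P a ∧ Q a := (hP.imp hQ.not).not.congr fun a => by tauto

theorem Rep.exists_search {P : A → M.N → Prop} (hP : Rep M fun p : A × M.N => P p.1 p.2)
    (Γ : List Ty) (p : M.Tuple Γ → A) (hp : Space.plot (M := M) Γ p) :
    ∃ s : M.Tuple Γ → M.N, Curried Γ s ∧ ∀ c, (∃ n, P (p c) n) → P (p c) (s c) := by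
  obtain ⟨m, hm⟩ := Str.exists_search (M := M)
  obtain ⟨χ, ⟨F, hF, hχF⟩, hPχ⟩ :=
    hP (.nat :: Γ) (fun c => (p c.2, c.1)) ⟨Space.weaken _ hp, Curried.head⟩
  have hPF : ∀ n c, P (p c) n ↔ F c ⬩ n = M.zero := fun n c => by
    rw [← hχF]
    exact hPχ (n, c)
  refine ⟨_, (Curried.const Γ m).app hF, fun c hc => ?_⟩
  simp only [hPF] at hc ⊢
  exact hm _ hc

@[fun_prop] theorem Rep.exists {P : A → M.N → Prop} (hP : Rep M fun p : A × M.N => P p.1 p.2) :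
    Rep M fun a => ∃ n, P a n := by
  intro Γ p hp
  obtain ⟨s, hs, hPs⟩ := hP.exists_search Γ p hp
  obtain ⟨χ, hχ, hPχ⟩ := hP Γ (fun c => (p c, s c)) ⟨hp, hs⟩
  exact ⟨χ, hχ, fun c => ⟨fun h => (hPχ c).1 (hPs c h), fun h => ⟨_, (hPχ c).2 h⟩⟩⟩

@[fun_prop] theorem Rep.forall {P : A → M.N → Prop} (hP : Rep M fun p : A × M.N => P p.1 p.2) :
    Rep M fun a => ∀ n, P a n :=
  (hP.not.exists (P := fun a n => ¬ P a n)).not.congr fun a => by push Not; rfl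

theorem Rep.of_graph {f : A → M.N} (h : Rep M fun p : A × M.N => f p.1 = p.2) : Rep M f := by
  intro Γ p hp
  obtain ⟨s, hs, h_eq⟩ := h.exists_search (P := fun a n => f a = n) Γ p hp
  rwa [show (fun c => f (p c)) = s from funext fun c => h_eq c ⟨_, rfl⟩]

@[fun_prop] theorem Rep.ite {P : A → Prop} [∀ a, Decidable (P a)] {f g : A → M.N} (hP : Rep M P)
    (hf : Rep M f) (hg : Rep M g) : Rep M fun a => if P a then f a else g a := by
  refine Rep.of_graph (Rep.congr (P := fun p : A × M.N =>
    (P p.1 ∧ f p.1 = p.2) ∨ (¬ P p.1 ∧ g p.1 = p.2)) (by fun_prop) fun p => ?_)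
  by_cases h : P p.1 <;> simp [h]

theorem induction {P : M.N → Prop} (hP : Rep M P) (h_zero : P M.zero)
    (h_succ : ∀ n, P n → P (M.succ ⬩ n)) (n : M.N) : P n := by
  obtain ⟨χ, ⟨F, -, hχF⟩, hPχ⟩ := hP [.nat] _ (Curried.head (Γ := []))
  have hPF : ∀ n, P n ↔ F () ⬩ n = M.zero := fun n => by
    rw [← hχF n ()]
    exact hPχ (n, ())
  simp only [hPF] at h_zero h_succ ⊢
  exact eq_zero_of_induction _ h_zero h_succ n

/-- Primitive recursion; meaningful if `f` is representable. -/
noncomputable def natRec (a : M.N) (f : M.N → M.N → M.N) (n : M.N) : M.N :=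
  M.recursor ⬩ a ⬩ lam (fun k => lam (f k)) ⬩ n

theorem natRec_zero (a : M.N) (f : M.N → M.N → M.N) : natRec a f M.zero = a := recursor_zero _ _

theorem natRec_succ (a : M.N) {f : M.N → M.N → M.N} (hf : Rep M fun p : M.N × M.N => f p.1 p.2)
    (n : M.N) : natRec a f (M.succ ⬩ n) = f n (natRec a f n) := by
  rw [natRec, recursor_succ, lam_app (by fun_prop), lam_app (hf.curry_right _)]
  rfl

@[fun_prop] theorem Rep.natRec {a : A → M.N} {f : A → M.N → M.N → M.N} {n : A → M.N}
    (ha : Rep M a) (hf : Rep M fun p : (A × M.N) × M.N => f p.1.1 p.1.2 p.2) (hn : Rep M n) :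
    Rep M fun x => Str.natRec (a x) (f x) (n x) := by
  unfold Str.natRec
  have h : Rep M fun x => Str.lam fun k => Str.lam (f x k) :=
    Rep.lam (f := fun x k => Str.lam (f x k)) (Rep.lam (f := fun p : A × M.N => f p.1 p.2) hf)
  fun_prop

end Representable

/-! ### Arithmetic of the numbers of a structure -/

variable {M : Str}

instance : Zero M.N := ⟨M.zero⟩
instance : One M.N := ⟨M.succ ⬩ M.zero⟩
instance : Add M.N := ⟨fun x y => M.add ⬩ x ⬩ y⟩
instance : Mul M.N := ⟨fun x y => M.mul ⬩ x ⬩ y⟩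
instance : LT M.N := ⟨M.lt⟩
instance : LE M.N := ⟨fun x y => x < y ∨ x = y⟩

theorem add_def (x y : M.N) : M.add ⬩ x ⬩ y = x + y := rfl

theorem mul_def (x y : M.N) : M.mul ⬩ x ⬩ y = x * y := rfl

variable [M.IsModel] {A : Type} [Space M A]

theorem succ_def (x : M.N) : M.succ ⬩ x = x + 1 := by
  change _ = M.add ⬩ x ⬩ (M.succ ⬩ M.zero)
  rw [app_add_succ, app_add_zero]

@[fun_prop] theorem Rep.add {f g : A → M.N} (hf : Rep M f) (hg : Rep M g) :
    Rep M fun a => f a + g a := by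
  simp only [← add_def]; fun_prop

@[fun_prop] theorem Rep.mul {f g : A → M.N} (hf : Rep M f) (hg : Rep M g) :
    Rep M fun a => f a * g a := by
  simp only [← mul_def]; fun_prop

@[fun_prop] theorem Rep.lt {f g : A → M.N} (hf : Rep M f) (hg : Rep M g) :
    Rep M fun a => f a < g a := rep_lt.comp (hf.prodMk hg)

@[fun_prop] theorem Rep.le {f g : A → M.N} (hf : Rep M f) (hg : Rep M g) :
    Rep M fun a => f a ≤ g a := (hf.lt hg).or (hf.eq hg)

theorem rep_induction {P : M.N → Prop} (rep : Rep M P) (zero : P 0)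
    (add_one : ∀ n, P n → P (n + 1))
    (n : M.N) : P n :=
  induction rep zero (fun n h => by rw [succ_def]; exact add_one n h) n

namespace N

theorem add_one_ne_zero (x : M.N) : x + 1 ≠ 0 := by
  rw [← succ_def]; exact app_succ_ne_zero x

theorem add_one_inj {x y : M.N} (h : x + 1 = y + 1) : x = y := by
  rw [← succ_def, ← succ_def] at h; exact app_succ_injective h

protected theorem add_zero (x : M.N) : x + 0 = x := app_add_zero x

theorem add_add_one (x y : M.N) : x + (y + 1) = x + y + 1 := by
  rw [← succ_def y, ← succ_def (x + y)]; exact app_add_succ x y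

protected theorem mul_zero (x : M.N) : x * 0 = 0 := app_mul_zero x

theorem mul_add_one (x y : M.N) : x * (y + 1) = x * y + x := by
  rw [← succ_def]; exact app_mul_succ x y

protected theorem add_assoc (x y z : M.N) : x + y + z = x + (y + z) := by
  induction z using rep_induction with
  | rep => fun_prop
  | zero => rw [N.add_zero, N.add_zero]
  | add_one z ih => rw [add_add_one, add_add_one, add_add_one, ih]

protected theorem zero_add (x : M.N) : 0 + x = x := by
  induction x using rep_induction with
  | rep => fun_prop
  | zero => rw [N.add_zero]
  | add_one x ih => rw [add_add_one, ih]

theorem add_one_add (x y : M.N) : x + 1 + y = x + y + 1 := by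
  induction y using rep_induction with
  | rep => fun_prop
  | zero => rw [N.add_zero, N.add_zero]
  | add_one y ih => rw [add_add_one, add_add_one, ih]

protected theorem add_comm (x y : M.N) : x + y = y + x := by
  induction y using rep_induction with
  | rep => fun_prop
  | zero => rw [N.add_zero, N.zero_add]
  | add_one y ih => rw [add_add_one, add_one_add, ih]

protected theorem zero_mul (x : M.N) : 0 * x = 0 := by
  induction x using rep_induction with
  | rep => fun_prop
  | zero => rw [N.mul_zero]
  | add_one x ih => rw [mul_add_one, ih, N.add_zero]

theorem add_one_mul (x y : M.N) : (x + 1) * y = x * y + y := by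
  induction y using rep_induction with
  | rep => fun_prop
  | zero => rw [N.mul_zero, N.mul_zero, N.add_zero]
  | add_one y ih =>
    rw [mul_add_one, mul_add_one, ih, add_add_one, add_add_one, N.add_assoc (x * y),
      N.add_assoc (x * y), N.add_comm y x, add_add_one, ← N.add_assoc (x * y)]

protected theorem mul_comm (x y : M.N) : x * y = y * x := by
  induction y using rep_induction with
  | rep => fun_prop
  | zero => rw [N.mul_zero, N.zero_mul]
  | add_one y ih => rw [mul_add_one, add_one_mul, ih]

protected theorem mul_add (x y z : M.N) : x * (y + z) = x * y + x * z := by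
  induction z using rep_induction with
  | rep => fun_prop
  | zero => rw [N.add_zero, N.mul_zero, N.add_zero]
  | add_one z ih => rw [add_add_one, mul_add_one, mul_add_one, ih, N.add_assoc]

protected theorem mul_assoc (x y z : M.N) : x * y * z = x * (y * z) := by
  induction z using rep_induction with
  | rep => fun_prop
  | zero => rw [N.mul_zero, N.mul_zero, N.mul_zero]
  | add_one z ih => rw [mul_add_one, mul_add_one, N.mul_add, ih]

protected theorem mul_one (x : M.N) : x * 1 = x := by
  rw [← N.zero_add 1, mul_add_one, N.mul_zero, N.zero_add]

end N

instance : CommSemiring M.N where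
  add_assoc := N.add_assoc
  zero_add := N.zero_add
  add_zero := N.add_zero
  add_comm := N.add_comm
  left_distrib := N.mul_add
  right_distrib x y z := by rw [N.mul_comm, N.mul_add, N.mul_comm z, N.mul_comm z]
  zero_mul := N.zero_mul
  mul_zero := N.mul_zero
  mul_assoc := N.mul_assoc
  one_mul x := by rw [N.mul_comm, N.mul_one]
  mul_one := N.mul_one
  mul_comm := N.mul_comm
  nsmul := nsmulRec

namespace N

theorem lt_add_one_iff_lt_or_eq {x y : M.N} : x < y + 1 ↔ x < y ∨ x = y := by
  rw [← succ_def]; exact lt_app_succ_iff x y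

protected theorem not_lt_zero (x : M.N) : ¬ x < 0 := Str.not_lt_zero x

protected theorem lt_trans {x y z : M.N} (hxy : x < y) (hyz : y < z) : x < z := by
  induction z using rep_induction with
  | rep => fun_prop
  | zero => exact (N.not_lt_zero _ hyz).elim
  | add_one z ih =>
    rw [lt_add_one_iff_lt_or_eq] at hyz ⊢
    rcases hyz with hyz | rfl
    · exact .inl (ih hyz)
    · exact .inl hxy

theorem add_one_lt {x y : M.N} (h : x < y) : x + 1 < y + 1 := by
  induction y using rep_induction with
  | rep => fun_prop
  | zero => exact (N.not_lt_zero _ h).elim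
  | add_one y ih =>
    rw [lt_add_one_iff_lt_or_eq]
    rcases lt_add_one_iff_lt_or_eq.1 h with h | rfl
    · exact .inl (ih h)
    · exact .inr rfl

protected theorem lt_irrefl (x : M.N) : ¬ x < x := by
  induction x using rep_induction with
  | rep => fun_prop
  | zero => exact N.not_lt_zero _
  | add_one x ih =>
    intro h
    have hx : x < x + 1 := lt_add_one_iff_lt_or_eq.2 (.inr rfl)
    rcases lt_add_one_iff_lt_or_eq.1 h with h | h
    · exact ih (N.lt_trans hx h)
    · rw [h] at hx; exact ih hx

protected theorem zero_lt_add_one (x : M.N) : 0 < x + 1 := by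
  induction x using rep_induction with
  | rep => fun_prop
  | zero => exact lt_add_one_iff_lt_or_eq.2 (.inr rfl)
  | add_one x ih => exact lt_add_one_iff_lt_or_eq.2 (.inl ih)

protected theorem lt_trichotomy (x y : M.N) : x < y ∨ x = y ∨ y < x := by
  induction x using rep_induction with
  | rep => fun_prop
  | zero =>
    induction y using rep_induction with
    | rep => fun_prop
    | zero => exact .inr (.inl rfl)
    | add_one y _ => exact .inl (N.zero_lt_add_one y)
  | add_one x ih =>
    rcases ih with h | rfl | h
    · exact (lt_add_one_iff_lt_or_eq.1 (add_one_lt h)).imp_right .inl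
    · exact .inr (.inr (lt_add_one_iff_lt_or_eq.2 (.inr rfl)))
    · exact .inr (.inr (lt_add_one_iff_lt_or_eq.2 (.inl h)))

end N

noncomputable instance : LinearOrder M.N where
  le_refl x := .inr rfl
  le_trans x y z hxy hyz := by
    rcases hxy with hxy | rfl
    · rcases hyz with hyz | rfl
      · exact .inl (N.lt_trans hxy hyz)
      · exact .inl hxy
    · exact hyz
  lt_iff_le_not_ge x y := by
    constructor
    · refine fun h => ⟨.inl h, ?_⟩
      rintro (h' | rfl)
      · exact N.lt_irrefl _ (N.lt_trans h h')
      · exact N.lt_irrefl _ h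
    · rintro ⟨h | rfl, h'⟩
      · exact h
      · exact (h' (.inr rfl)).elim
  le_antisymm x y hxy hyz := by
    rcases hxy with hxy | hxy
    · rcases hyz with hyz | hyz
      · exact (N.lt_irrefl _ (N.lt_trans hxy hyz)).elim
      · exact hyz.symm
    · exact hxy
  le_total x y := by
    rcases N.lt_trichotomy x y with h | h | h
    · exact .inl (.inl h)
    · exact .inl (.inr h)
    · exact .inr (.inl h)
  toDecidableLE := Classical.decRel _

namespace N

theorem lt_add_one_iff {x y : M.N} : x < y + 1 ↔ x ≤ y := by
  rw [lt_add_one_iff_lt_or_eq, le_iff_lt_or_eq]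

protected theorem zero_le (x : M.N) : 0 ≤ x := lt_add_one_iff.1 (N.zero_lt_add_one x)

theorem le_iff_exists_add {x y : M.N} : x ≤ y ↔ ∃ z, y = x + z := by
  constructor
  · intro h
    induction y using rep_induction with
    | rep => fun_prop
    | zero => exact ⟨0, by rw [add_zero]; exact le_antisymm (N.zero_le _) h⟩
    | add_one y ih =>
      rcases h.lt_or_eq with h | rfl
      · obtain ⟨z, rfl⟩ := ih (lt_add_one_iff.1 h)
        exact ⟨z + 1, add_assoc _ _ _⟩
      · exact ⟨0, (add_zero _).symm⟩
  · rintro ⟨z, rfl⟩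
    induction z using rep_induction with
    | rep => fun_prop
    | zero => rw [add_zero]
    | add_one z ih => rw [← add_assoc]; exact (lt_add_one_iff.2 ih).le

protected theorem add_left_lt {x y : M.N} (h : x < y) (z : M.N) : z + x < z + y := by
  rw [add_comm z, add_comm z]
  induction z using rep_induction with
  | rep => fun_prop
  | zero => rwa [add_zero, add_zero]
  | add_one z ih => rw [← add_assoc, ← add_assoc]; exact add_one_lt ih

end N

instance : IsOrderedCancelAddMonoid M.N where
  add_le_add_left x y h z := by
    rcases h.lt_or_eq with h | rfl
    · rw [add_comm x, add_comm y]; exact (N.add_left_lt h z).le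
    · exact le_rfl
  le_of_add_le_add_left x y z h := by
    by_contra hn
    exact (N.add_left_lt (not_le.1 hn) x).not_ge h

instance : Nontrivial M.N := ⟨1, 0, app_succ_ne_zero _⟩

instance : CanonicallyOrderedAdd M.N where
  exists_add_of_le h := N.le_iff_exists_add.1 h
  le_add_self x y := by rw [add_comm]; exact N.le_iff_exists_add.2 ⟨y, rfl⟩
  le_self_add x y := N.le_iff_exists_add.2 ⟨y, rfl⟩

theorem N.add_one_le_iff {x y : M.N} : x + 1 ≤ y ↔ x < y := by
  rw [← N.lt_add_one_iff]; exact ⟨fun h => lt_of_add_lt_add_right h, N.add_one_lt⟩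

theorem N.mul_left_lt {x y z : M.N} (hz : 0 < z) (h : x < y) : z * x < z * y := by
  obtain ⟨d, rfl⟩ := N.le_iff_exists_add.1 (N.add_one_le_iff.2 h)
  rw [mul_add, N.mul_add_one, add_assoc]
  exact lt_add_of_pos_right _ (hz.trans_le le_self_add)

instance : IsStrictOrderedRing M.N where
  zero_le_one := N.zero_le _
  mul_lt_mul_of_pos_left _ hz _ _ h := N.mul_left_lt hz h
  mul_lt_mul_of_pos_right z hz x y h := by
    rw [mul_comm x, mul_comm y]; exact N.mul_left_lt hz h

theorem N.one_le_iff_pos {x : M.N} : 1 ≤ x ↔ 0 < x := by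
  rw [← N.add_one_le_iff, zero_add]

theorem N.exists_add_one {x : M.N} (h : x ≠ 0) : ∃ y, x = y + 1 := by
  obtain ⟨y, hy⟩ := N.le_iff_exists_add.1 (N.add_one_le_iff.2 (pos_iff_ne_zero.2 h))
  exact ⟨y, by rw [hy, zero_add, add_comm]⟩

theorem exists_least {P : M.N → Prop} (hP : Rep M P) (h : ∃ n, P n) :
    ∃ n, P n ∧ ∀ m < n, ¬ P m := by
  by_contra! h_descend
  obtain ⟨n, hn⟩ := h
  have h_below : ∀ n, ∀ m, m < n → ¬ P m := fun n => by
    have : Rep M fun p : M.N × M.N => P p.2 := hP.comp (by fun_prop)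
    induction n using rep_induction with
    | rep => fun_prop
    | zero => exact fun m hm => (N.not_lt_zero _ hm).elim
    | add_one n ih =>
      intro m hm hPm
      obtain ⟨k, hk, hPk⟩ := h_descend m hPm
      exact ih k (hk.trans_le (N.lt_add_one_iff.1 hm)) hPk
  exact h_below (n + 1) n (N.lt_add_one_iff.2 le_rfl) hn

open Classical in
/-- The least number with property `P`, or `0` if there is none. -/
noncomputable def mu (P : M.N → Prop) : M.N :=
  if h : ∃ n, P n ∧ ∀ m < n, ¬ P m then h.choose else 0

theorem mu_eq {P : M.N → Prop} {n : M.N} (hPn : P n) (h_least : ∀ m < n, ¬ P m) : mu P = n := by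
  have h : ∃ n, P n ∧ ∀ m < n, ¬ P m := ⟨n, hPn, h_least⟩
  rw [mu, dif_pos h]
  exact le_antisymm (not_lt.1 fun h_lt => h.choose_spec.2 n h_lt hPn)
    (not_lt.1 fun h_lt => h_least _ h_lt h.choose_spec.1)

theorem mu_eq_iff {P : M.N → Prop} {n : M.N} : mu P = n ↔
    (P n ∧ ∀ m, m < n → ¬ P m) ∨ (n = 0 ∧ ¬ ∃ k, P k ∧ ∀ m, m < k → ¬ P m) := by
  by_cases h : ∃ n, P n ∧ ∀ m < n, ¬ P m
  · obtain ⟨k, hPk, hk⟩ := h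
    rw [mu_eq hPk hk, or_iff_left fun h' => h'.2 ⟨k, hPk, hk⟩]
    exact ⟨fun h_eq => h_eq ▸ ⟨hPk, hk⟩, fun h' => (mu_eq hPk hk).symm.trans (mu_eq h'.1 h'.2)⟩
  · rw [mu, dif_neg h, or_iff_right fun h' => h ⟨n, h'⟩, and_iff_left h, eq_comm]

theorem mu_of_not_exists {P : M.N → Prop} (h : ¬ ∃ n, P n) : mu P = 0 :=
  mu_eq_iff.2 (.inr ⟨rfl, fun ⟨n, hn, _⟩ => h ⟨n, hn⟩⟩)

theorem mu_spec {P : M.N → Prop} (hP : Rep M P) (h : ∃ n, P n) : P (mu P) := by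
  obtain ⟨n, hPn, hn⟩ := exists_least hP h
  rwa [mu_eq hPn hn]

theorem not_of_lt_mu {P : M.N → Prop} {n : M.N} (h : n < mu P) : ¬ P n := by
  rcases mu_eq_iff.1 (rfl : mu P = mu P) with h_mu | h_mu
  · exact h_mu.2 n h
  · exact (N.not_lt_zero n (h.trans_eq h_mu.1)).elim

@[fun_prop] theorem Rep.mu {P : A → M.N → Prop} (hP : Rep M fun p : A × M.N => P p.1 p.2) :
    Rep M fun a => Str.mu (P a) := by
  refine Rep.of_graph (Rep.congr ?_ fun p => mu_eq_iff.symm)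
  have : Rep M fun p : (A × M.N) × M.N => P p.1.1 p.2 :=
    hP.comp (f := fun p : (A × M.N) × M.N => (p.1.1, p.2)) (by fun_prop)
  have : Rep M fun p : ((A × M.N) × M.N) × M.N => P p.1.1.1 p.2 :=
    hP.comp (f := fun p : ((A × M.N) × M.N) × M.N => (p.1.1.1, p.2)) (by fun_prop)
  fun_prop

theorem natRec_at_zero (a : M.N) (f : M.N → M.N → M.N) : natRec a f 0 = a := natRec_zero a f

theorem natRec_add_one (a : M.N) {f : M.N → M.N → M.N}
    (hf : Rep M fun p : M.N × M.N => f p.1 p.2) (n : M.N) :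
    natRec a f (n + 1) = f n (natRec a f n) := by
  rw [← succ_def, natRec_succ a hf]

end Str

open scoped TensorProduct

/-! ### The ordered field of fractions of an ordered semiring -/

/-- The ring of differences of elements of `R`. -/
def DiffRing (R : Type) [CommSemiring R] : Type := ℤ ⊗[ℕ] R

namespace DiffRing

variable {R : Type} [CommSemiring R]

noncomputable instance : CommRing (DiffRing R) := inferInstanceAs (CommRing (ℤ ⊗[ℕ] R))

/-- The canonical homomorphism from `R` to its ring of differences. -/
noncomputable def of : R →+* DiffRing R :=
  (Algebra.TensorProduct.includeRight : R →ₐ[ℕ] ℤ ⊗[ℕ] R).toRingHom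

open Algebra in
theorem of_injective [IsCancelAdd R] : Function.Injective (of : R → DiffRing R) := by
  let ψ : ℤ ⊗[ℕ] R →ₗ[ℕ] GrothendieckAddGroup R := TensorProduct.lift <|
    LinearMap.mk₂ ℕ (fun n a => n • GrothendieckAddGroup.of a)
      (fun m n a => add_smul m n _) (fun k n a => smul_assoc k n _)
      (fun n a b => by rw [map_add, smul_add])
      (fun k n a => by rw [map_nsmul, smul_comm])
  have hψ : ∀ a, ψ (of a) = GrothendieckAddGroup.of a := fun a => one_smul ℤ _
  exact fun a b h => GrothendieckAddGroup.of_injective (by rw [← hψ, h, hψ])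

theorem exists_eq_sub (x : DiffRing R) : ∃ a b : R, x = of a - of b := by
  have natCast_tmul : ∀ (m : ℕ) (a : R), (m : ℤ) ⊗ₜ[ℕ] a = of (m • a) := fun m a => by
    rw [← nsmul_one m, TensorProduct.smul_tmul]
    rfl
  induction x using TensorProduct.induction_on with
  | zero => exact ⟨0, 0, (sub_self _).symm⟩
  | tmul n a =>
    obtain ⟨m, rfl | rfl⟩ := n.eq_nat_or_neg
    · exact ⟨m • a, 0, by rw [natCast_tmul, map_zero, sub_zero]⟩
    · exact ⟨0, m • a, by rw [TensorProduct.neg_tmul, natCast_tmul, map_zero, zero_sub]; rfl⟩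
  | add x y hx hy =>
    obtain ⟨a, b, rfl⟩ := hx
    obtain ⟨c, d, rfl⟩ := hy
    exact ⟨a + c, b + d, by rw [map_add, map_add]; exact sub_add_sub_comm _ _ _ _⟩

variable [LinearOrder R] [CanonicallyOrderedAdd R]

theorem eq_of_or_neg_of (x : DiffRing R) : (∃ a, x = of a) ∨ ∃ a, x = -of a := by
  obtain ⟨a, b, rfl⟩ := exists_eq_sub x
  rcases le_total b a with h | h <;> obtain ⟨c, rfl⟩ := exists_add_of_le h
  · exact .inl ⟨c, by rw [map_add, add_sub_cancel_left]⟩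
  · exact .inr ⟨c, by rw [map_add, sub_add_cancel_left]⟩

variable [IsStrictOrderedRing R]

instance : Nontrivial (DiffRing R) := of_injective.nontrivial

instance : NoZeroDivisors (DiffRing R) where
  eq_zero_or_eq_zero_of_mul_eq_zero {x y} h := by
    have of_mul_of : ∀ a b : R, of a * of b = 0 → of a = 0 ∨ of b = 0 := fun a b h => by
      simpa only [← map_mul, map_eq_zero_iff _ of_injective, mul_eq_zero] using h
    rcases eq_of_or_neg_of x with ⟨a, rfl⟩ | ⟨a, rfl⟩ <;>
      rcases eq_of_or_neg_of y with ⟨b, rfl⟩ | ⟨b, rfl⟩ <;>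
      simpa using of_mul_of a b (by simpa using h)

instance : IsDomain (DiffRing R) := NoZeroDivisors.to_isDomain _

end DiffRing

section FracField

variable (R : Type) [CommSemiring R] [LinearOrder R] [IsStrictOrderedRing R]
  [CanonicallyOrderedAdd R]

/-- The field of fractions of the ordered semiring `R`. -/
def FracField : Type := FractionRing (DiffRing R)

namespace FracField

variable {R}

noncomputable instance : Field (FracField R) := inferInstanceAs (Field (FractionRing (DiffRing R)))

/-- The embedding of `R` into its field of fractions. -/
noncomputable def of : R →+* FracField R :=
  (algebraMap (DiffRing R) (FractionRing (DiffRing R))).comp DiffRing.of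

theorem of_injective : Function.Injective (of (R := R)) :=
  (IsFractionRing.injective (DiffRing R) (FractionRing (DiffRing R))).comp DiffRing.of_injective

theorem of_ne_zero {a : R} (h : a ≠ 0) : of a ≠ 0 := (map_ne_zero_iff _ of_injective).2 h

/-- The cone of fractions of elements of `R`, which orders the field. -/
noncomputable def cone : RingCone (FracField R) where
  carrier := {x | ∃ a d : R, d ≠ 0 ∧ x = of a / of d}
  zero_mem' := ⟨0, 1, one_ne_zero, by simp⟩
  one_mem' := ⟨1, 1, one_ne_zero, by simp⟩
  add_mem' := by
    rintro _ _ ⟨a, d, hd, rfl⟩ ⟨b, e, he, rfl⟩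
    refine ⟨a * e + d * b, d * e, mul_ne_zero hd he, ?_⟩
    rw [div_add_div _ _ (of_ne_zero hd) (of_ne_zero he)]
    simp only [map_add, map_mul]
  mul_mem' := by
    rintro _ _ ⟨a, d, hd, rfl⟩ ⟨b, e, he, rfl⟩
    exact ⟨a * b, d * e, mul_ne_zero hd he, by simp only [div_mul_div_comm, map_mul]⟩
  eq_zero_of_mem_of_neg_mem' := by
    rintro _ ⟨a, d, hd, rfl⟩ ⟨b, e, he, h⟩
    rw [neg_eq_iff_add_eq_zero, div_add_div _ _ (of_ne_zero hd) (of_ne_zero he), div_eq_zero_iff,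
      or_iff_left (mul_ne_zero (of_ne_zero hd) (of_ne_zero he)), ← map_mul, ← map_mul, ← map_add,
      map_eq_zero_iff _ of_injective, add_eq_zero, mul_eq_zero, or_iff_left he] at h
    rw [h.1, map_zero, zero_div]

theorem mem_cone {x : FracField R} : x ∈ cone ↔ ∃ a d : R, d ≠ 0 ∧ x = of a / of d := Iff.rfl

instance : HasMemOrNegMem (cone (R := R)) where
  mem_or_neg_mem x := by
    let j : DiffRing R →+* FracField R := algebraMap (DiffRing R) (FractionRing (DiffRing R))
    obtain ⟨z, w, hw, rfl⟩ : ∃ z w, w ∈ nonZeroDivisors (DiffRing R) ∧ j z / j w = x :=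
      IsFractionRing.div_surjective (A := DiffRing R) (K := FractionRing (DiffRing R)) x
    have hw := nonZeroDivisors.ne_zero hw
    rcases DiffRing.eq_of_or_neg_of w with ⟨d, rfl⟩ | ⟨d, rfl⟩ <;>
      rcases DiffRing.eq_of_or_neg_of z with ⟨a, rfl⟩ | ⟨a, rfl⟩ <;>
      have hd : d ≠ 0 := by rintro rfl; simp at hw
    · exact .inl ⟨a, d, hd, rfl⟩
    · exact .inr ⟨a, d, hd, by rw [map_neg, neg_div, neg_neg]; rfl⟩
    · exact .inr ⟨a, d, hd, by rw [map_neg, div_neg, neg_neg]; rfl⟩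
    · exact .inl ⟨a, d, hd, by rw [map_neg, map_neg, neg_div_neg_eq]; rfl⟩

open Classical in
noncomputable instance : LinearOrder (FracField R) := .mkOfAddGroupCone cone

instance : IsOrderedRing (FracField R) := .mkOfCone cone

instance : IsStrictOrderedRing (FracField R) := .of_mul_pos fun _ _ hx hy =>
  (mul_nonneg hx.le hy.le).lt_of_ne' (mul_ne_zero hx.ne' hy.ne')

theorem nonneg_iff {x : FracField R} : 0 ≤ x ↔ ∃ a d : R, d ≠ 0 ∧ x = of a / of d := by
  change x - 0 ∈ cone ↔ _
  rw [sub_zero, mem_cone]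

theorem of_nonneg (a : R) : 0 ≤ of a := nonneg_iff.2 ⟨a, 1, one_ne_zero, by simp⟩

theorem of_strictMono : StrictMono (of (R := R)) :=
  Monotone.strictMono_of_injective (fun a b h => by
    obtain ⟨c, rfl⟩ := exists_add_of_le h
    rw [map_add]
    exact le_add_of_nonneg_right (of_nonneg c)) of_injective

theorem of_le_of {a b : R} : of a ≤ of b ↔ a ≤ b := of_strictMono.le_iff_le

theorem of_lt_of {a b : R} : of a < of b ↔ a < b := of_strictMono.lt_iff_lt

end FracField

end FracField

namespace Str

/-! ### Rational numbers of a structure -/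

variable {M : Str}

/-- The code of the pair `(i, j)`. -/
def pairCode (i j : M.N) : M.N := (i + j) * (i + j) + i

/-- The code of `(a - b) / (d + 1)`. -/
def code (a b d : M.N) : M.N := pairCode (pairCode a b) d

/-- `q` is the code of a rational number. -/
def Valid (q : M.N) : Prop := ∃ a b d, q = code a b d

theorem valid_code (a b d : M.N) : Valid (code a b d) := ⟨a, b, d, rfl⟩

variable [M.IsModel] {A : Type} [Space M A]

/-- The ordered field of fractions of the numbers of a structure. -/
abbrev K (M : Str) [M.IsModel] : Type := FracField M.N

/-- The embedding of numbers into fractions. -/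
noncomputable abbrev ι : M.N →+* M.K := FracField.of

/-- The powers of two. -/
def pw (n : M.N) : M.N := M.recursor ⬩ 1 ⬩ (M.combK _ _ ⬩ (M.mul ⬩ 2)) ⬩ n

@[fun_prop] theorem Rep.pw {f : A → M.N} (hf : Rep M f) : Rep M fun a => Str.pw (f a) := by
  unfold Str.pw; fun_prop

theorem pw_zero : pw (0 : M.N) = 1 := recursor_zero _ _

theorem pw_add_one (n : M.N) : pw (n + 1) = 2 * pw n := by
  rw [pw, ← succ_def, recursor_succ, app_combK]; rfl

theorem pw_add (m n : M.N) : pw (m + n) = pw m * pw n := by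
  induction n using rep_induction with
  | rep => fun_prop
  | zero => rw [add_zero, pw_zero, mul_one]
  | add_one n ih => rw [← add_assoc, pw_add_one, ih, pw_add_one]; ring

theorem lt_pw (n : M.N) : n < pw n := by
  induction n using rep_induction with
  | rep => fun_prop
  | zero => rw [pw_zero]; exact one_pos
  | add_one n ih =>
    rw [pw_add_one, two_mul]
    exact add_lt_add_of_lt_of_le ih (N.one_le_iff_pos.2 ((N.zero_le n).trans_lt ih))

theorem pw_pos (n : M.N) : 0 < pw n := (N.zero_le n).trans_lt (lt_pw n)

theorem ι_nonneg (n : M.N) : (0 : M.K) ≤ ι n := FracField.of_nonneg n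

theorem ι_le {m n : M.N} : ι m ≤ ι n ↔ m ≤ n := FracField.of_le_of

theorem ι_lt {m n : M.N} : ι m < ι n ↔ m < n := FracField.of_lt_of

theorem ι_pos {n : M.N} : 0 < ι n ↔ 0 < n := by rw [← map_zero ι, ι_lt]

theorem exists_lt_ι (x : M.K) : ∃ n, x < ι n := by
  rcases lt_or_ge x 0 with h | h
  · exact ⟨0, by rwa [map_zero]⟩
  · obtain ⟨a, d, hd, rfl⟩ := FracField.nonneg_iff.1 h
    refine ⟨a + 1, (div_le_self (ι_nonneg a) ?_).trans_lt (ι_lt.2 (N.lt_add_one_iff.2 le_rfl))⟩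
    rw [← map_one ι, ι_le]
    exact N.one_le_iff_pos.2 (pos_iff_ne_zero.2 hd)

/-- The number `2 ^ (-n)`. -/
noncomputable def eps (n : M.N) : M.K := 1 / ι (pw n)

theorem eps_zero : eps (0 : M.N) = 1 := by rw [eps, pw_zero, map_one, div_one]

theorem eps_pos (n : M.N) : 0 < eps n := one_div_pos.2 (ι_pos.2 (pw_pos n))

theorem eps_add_one (n : M.N) : eps (n + 1) = eps n / 2 := by
  rw [eps, eps, pw_add_one, map_mul, map_ofNat, div_div, mul_comm]

theorem ι_pw_mul_eps (n : M.N) : ι (pw n) * eps n = 1 :=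
  mul_one_div_cancel (ι_pos.2 (pw_pos n)).ne'

theorem eps_add (m n : M.N) : eps (m + n) = eps m * eps n := by
  rw [eps, eps, eps, pw_add, map_mul, div_mul_div_comm, one_mul]

theorem eps_add_le (m n : M.N) : eps (m + n) ≤ eps m := by
  refine one_div_le_one_div_of_le (ι_pos.2 (pw_pos m)) (ι_le.2 ?_)
  rw [pw_add]
  exact le_mul_of_one_le_right (N.zero_le _) (N.one_le_iff_pos.2 (pw_pos n))

theorem eps_add_le_right (m n : M.N) : eps (m + n) ≤ eps n := by
  rw [add_comm]
  exact eps_add_le n m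

theorem exists_eps_lt {x : M.K} (hx : 0 < x) : ∃ n : M.N, eps n < x := by
  obtain ⟨n, hn⟩ := exists_lt_ι x⁻¹
  refine ⟨n, ?_⟩
  rw [eps, one_div]
  exact inv_lt_of_inv_lt₀ hx (hn.trans (ι_lt.2 (lt_pw n)))

/-! ### Codes of rational numbers -/

theorem pairCode_lt_of_add_lt {i j i' j' : M.N} (h : i + j < i' + j') :
    pairCode i j < pairCode i' j' := by
  have h_sq := mul_self_le_mul_self (N.zero_le _) (N.add_one_le_iff.2 h)
  calc pairCode i j ≤ (i + j) * (i + j) + (i + j) := by unfold pairCode; gcongr; exact le_self_add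
    _ ≤ (i + j) * (i + j) + (i + j) + (i + j) := le_self_add
    _ < (i + j) * (i + j) + (i + j) + (i + j) + 1 := N.lt_add_one_iff.2 le_rfl
    _ = (i + j + 1) * (i + j + 1) := by ring
    _ ≤ (i' + j') * (i' + j') := h_sq
    _ ≤ pairCode i' j' := le_self_add

theorem pairCode_injective {i j i' j' : M.N} (h : pairCode i j = pairCode i' j') :
    i = i' ∧ j = j' := by
  have h_sum : i + j = i' + j' := le_antisymm
    (not_lt.1 fun h_lt => (pairCode_lt_of_add_lt h_lt).ne' h)
    (not_lt.1 fun h_lt => (pairCode_lt_of_add_lt h_lt).ne h)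
  unfold pairCode at h
  rw [h_sum] at h
  obtain rfl := add_left_cancel h
  exact ⟨rfl, add_left_cancel h_sum⟩

@[fun_prop] theorem Rep.code {f g h : A → M.N} (hf : Rep M f) (hg : Rep M g) (hh : Rep M h) :
    Rep M fun a => Str.code (f a) (g a) (h a) := by
  unfold Str.code pairCode; fun_prop

theorem code_injective {a b d a' b' d' : M.N} (h : code a b d = code a' b' d') :
    a = a' ∧ b = b' ∧ d = d' := by
  obtain ⟨hab, hd⟩ := pairCode_injective h
  obtain ⟨ha, hb⟩ := pairCode_injective hab
  exact ⟨ha, hb, hd⟩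

/-- The rational number with code `q`; arbitrary if `q` is not a code. -/
noncomputable def val (q : M.N) : M.K :=
  Classical.epsilon fun z => ∀ a b d, q = code a b d → z = (ι a - ι b) / (ι d + 1)

theorem val_code (a b d : M.N) : val (code a b d) = (ι a - ι b) / (ι d + 1) :=
  Classical.epsilon_spec (p := fun z => ∀ a' b' d', code a b d = code a' b' d' →
    z = (ι a' - ι b') / (ι d' + 1)) ⟨_, fun a' b' d' h => by
      obtain ⟨rfl, rfl, rfl⟩ := code_injective h; rfl⟩ a b d rfl

/-- `q` and `r` are codes of rational numbers with `q - r ≤ c / 2 ^ k`. -/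
def DiffLe (q r k c : M.N) : Prop := ∃ a b d a' b' d', q = code a b d ∧ r = code a' b' d' ∧
  pw k * (a * (d' + 1) + b' * (d + 1)) ≤
    c * ((d + 1) * (d' + 1)) + pw k * (b * (d' + 1) + a' * (d + 1))

@[fun_prop] theorem Rep.diffLe {f g h k : A → M.N} (hf : Rep M f) (hg : Rep M g) (hh : Rep M h)
    (hk : Rep M k) : Rep M fun a => DiffLe (f a) (g a) (h a) (k a) := by
  unfold DiffLe; fun_prop

theorem val_sub_val_le_iff {a b d a' b' d' k c : M.N} :
    val (code a b d) - val (code a' b' d') ≤ ι c * eps k ↔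
      pw k * (a * (d' + 1) + b' * (d + 1)) ≤
        c * ((d + 1) * (d' + 1)) + pw k * (b * (d' + 1) + a' * (d + 1)) := by
  have hd : (0 : M.K) < ι d + 1 := add_pos_of_nonneg_of_pos (ι_nonneg d) one_pos
  have hd' : (0 : M.K) < ι d' + 1 := add_pos_of_nonneg_of_pos (ι_nonneg d') one_pos
  have hk : (0 : M.K) < ι (pw k) := ι_pos.2 (pw_pos k)
  rw [val_code, val_code, eps, mul_one_div, ← ι_le, div_sub_div _ _ hd.ne' hd'.ne',
    div_le_div_iff₀ (mul_pos hd hd') hk]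
  simp only [map_add, map_mul, map_one]
  rw [← sub_nonneg, ← sub_nonneg (a := _ + _)]
  ring_nf

theorem diffLe_iff {q r k c : M.N} :
    DiffLe q r k c ↔ Valid q ∧ Valid r ∧ val q - val r ≤ ι c * eps k := by
  constructor
  · rintro ⟨a, b, d, a', b', d', rfl, rfl, h⟩
    exact ⟨valid_code _ _ _, valid_code _ _ _, val_sub_val_le_iff.2 h⟩
  · rintro ⟨⟨a, b, d, rfl⟩, ⟨a', b', d', rfl⟩, h⟩
    exact ⟨a, b, d, a', b', d', rfl, rfl, val_sub_val_le_iff.1 h⟩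

/-! ### Real numbers of a structure -/

/-- `x` is a fast-converging sequence of rationals. -/
def IsReal (x : M.Obj .one) : Prop :=
  ∀ k i, DiffLe (x ⬩ k) (x ⬩ (k + i)) k 1 ∧ DiffLe (x ⬩ (k + i)) (x ⬩ k) k 1

/-- `x =_ℝ y`. -/
def RealEq (x y : M.Obj .one) : Prop := ∀ k, DiffLe (x ⬩ k) (y ⬩ k) k 2 ∧ DiffLe (y ⬩ k) (x ⬩ k) k 2

/-- `x ≤_ℝ y`. -/
def RealLe (x y : M.Obj .one) : Prop := ∀ k, DiffLe (x ⬩ k) (y ⬩ k) k 2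

/-- The fraction `z` is smaller than the real number `x`. -/
def Below (z : M.K) (x : M.Obj .one) : Prop := ∃ k, z + eps k < val (x ⬩ k)

variable {x y : M.Obj .one} {z z' : M.K}

theorem IsReal.valid (hx : IsReal x) (k : M.N) : Valid (x ⬩ k) := (diffLe_iff.1 (hx k 0).1).1

theorem IsReal.le_add (hx : IsReal x) (k i : M.N) : val (x ⬩ k) ≤ val (x ⬩ (k + i)) + eps k := by
  have := (diffLe_iff.1 (hx k i).1).2.2
  rw [map_one, one_mul] at this
  linarith

theorem IsReal.add_le (hx : IsReal x) (k i : M.N) : val (x ⬩ (k + i)) ≤ val (x ⬩ k) + eps k := by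
  have := (diffLe_iff.1 (hx k i).2).2.2
  rw [map_one, one_mul] at this
  linarith

theorem realEq_iff (hx : IsReal x) (hy : IsReal y) : RealEq x y ↔
    ∀ k, val (x ⬩ k) ≤ val (y ⬩ k) + 2 * eps k ∧ val (y ⬩ k) ≤ val (x ⬩ k) + 2 * eps k := by
  simp only [RealEq, diffLe_iff, hx.valid, hy.valid, true_and, map_ofNat, sub_le_iff_le_add']

theorem RealEq.symm (h : RealEq x y) : RealEq y x := fun k => ⟨(h k).2, (h k).1⟩

theorem Below.mono (h : Below z x) (hz : z' ≤ z) : Below z' x := by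
  obtain ⟨k, hk⟩ := h
  exact ⟨k, by linarith⟩

theorem Below.lt (h : Below z x) (hx : IsReal x) (m : M.N) : z < val (x ⬩ m) + eps m := by
  obtain ⟨k, hk⟩ := h
  rcases le_total k m with h | h
  · obtain ⟨i, rfl⟩ := N.le_iff_exists_add.1 h
    have := hx.le_add k i
    have := eps_pos (k + i)
    linarith
  · obtain ⟨i, rfl⟩ := N.le_iff_exists_add.1 h
    have := hx.add_le m i
    have := eps_pos (m + i)
    linarith

theorem le_of_not_below (h : ¬ Below z x) (m : M.N) : val (x ⬩ m) ≤ z + eps m := by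
  by_contra! hn
  exact h ⟨m, hn⟩

theorem not_below_of_le (hx : IsReal x) (h : ∀ k, val (x ⬩ k) ≤ z + 2 * eps k) : ¬ Below z x := by
  rintro ⟨k, hk⟩
  obtain ⟨n, hn⟩ := exists_eps_lt (x := (val (x ⬩ k) - (z + eps k)) / 2) (by linarith)
  linarith [h (k + n), hx.le_add k n, eps_add_le_right k n]

theorem not_below_of_forall_eps (h : ∀ n, ¬ Below (z + eps n) x) : ¬ Below z x := by
  rintro ⟨k, hk⟩
  obtain ⟨n, hn⟩ := exists_eps_lt (x := val (x ⬩ k) - (z + eps k)) (by linarith)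
  exact h n ⟨k, by linarith⟩

theorem Below.congr (h : Below z x) (hx : IsReal x) (hy : IsReal y) (hxy : RealEq x y) :
    Below z y := by
  rw [realEq_iff hx hy] at hxy
  obtain ⟨k, hk⟩ := h
  obtain ⟨n, hn⟩ := exists_eps_lt (x := (val (x ⬩ k) - (z + eps k)) / 3) (by linarith)
  exact ⟨k + n, by linarith [(hxy (k + n)).1, hx.le_add k n, eps_add_le_right k n]⟩

theorem le_add_eps_of_separators (hy : IsReal y)
    (h : ∀ n, ∃ z, ¬ Below (z + eps n) x ∧ Below z y) (k : M.N) :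
    val (x ⬩ k) ≤ val (y ⬩ k) + 2 * eps k := by
  by_contra! h_lt
  obtain ⟨n, hn⟩ := exists_eps_lt (x := val (x ⬩ k) - (val (y ⬩ k) + 2 * eps k)) (by linarith)
  obtain ⟨z, hzx, hzy⟩ := h n
  linarith [le_of_not_below hzx k, hzy.lt hy k]

theorem realEq_of_cells (hx : IsReal x) (hy : IsReal y)
    (h : ∀ n, ∃ z, Below z x ∧ ¬ Below (z + eps n) x ∧ Below z y ∧ ¬ Below (z + eps n) y) :
    RealEq x y :=
  (realEq_iff hx hy).2 fun k =>
    ⟨le_add_eps_of_separators hy (fun n => (h n).imp fun _ hz => ⟨hz.2.1, hz.2.2.1⟩) k,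
      le_add_eps_of_separators hx (fun n => (h n).imp fun _ hz => ⟨hz.2.2.2, hz.1⟩) k⟩

/-- The rational number with code `q` is smaller than `x`. -/
def BelowCode (q : M.N) (x : M.Obj .one) : Prop := ∃ k, ¬ DiffLe (x ⬩ k) q k 1

@[fun_prop] theorem Rep.belowCode {f : A → M.N} {g : A → M.Obj .one} (hf : Rep M f)
    (hg : Rep M g) : Rep M fun a => BelowCode (f a) (g a) := by
  unfold BelowCode; fun_prop

theorem belowCode_iff (hx : IsReal x) {q : M.N} (hq : Valid q) :
    BelowCode q x ↔ Below (val q) x := by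
  refine exists_congr fun k => ?_
  rw [diffLe_iff, map_one, one_mul]
  simp only [hx.valid, hq, true_and, not_le, lt_sub_iff_add_lt']

namespace N

theorem add_two_ne_one (k : M.N) : k + 2 ≠ 1 := fun h => by
  rw [← one_add_one_eq_two, ← add_assoc] at h
  exact add_one_ne_zero k (add_one_inj (h.trans (zero_add 1).symm))

theorem add_two_ne_zero (k : M.N) : k + 2 ≠ 0 := fun h => by
  rw [← one_add_one_eq_two, ← add_assoc] at h
  exact add_one_ne_zero _ h

theorem cases_two (k : M.N) : k = 0 ∨ k = 1 ∨ ∃ l, k = l + 2 := by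
  by_cases hk : k = 0
  · exact .inl hk
  obtain ⟨l, rfl⟩ := exists_add_one hk
  by_cases hl : l = 0
  · exact .inr (.inl (by rw [hl, zero_add]))
  obtain ⟨m, rfl⟩ := exists_add_one hl
  exact .inr (.inr ⟨m, by rw [add_assoc, one_add_one_eq_two]⟩)

theorem two_mul_ne_two_mul_add_one (i j : M.N) : 2 * i ≠ 2 * j + 1 := by
  rcases le_or_gt i j with hij | hji
  · exact (lt_add_one_iff.2 (mul_le_mul_right hij 2)).ne
  · refine ne_of_gt (lt_of_lt_of_le ?_ (mul_le_mul_right (add_one_le_iff.2 hji) 2))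
    rw [mul_add, mul_one, ← one_add_one_eq_two (R := M.N), ← add_assoc]
    exact lt_add_one_iff.2 le_rfl

theorem even_or_odd (c : M.N) : ∃ i, c = 2 * i ∨ c = 2 * i + 1 := by
  induction c using rep_induction with
  | rep => fun_prop
  | zero => exact ⟨0, .inl (mul_zero _).symm⟩
  | add_one c ih =>
    obtain ⟨i, rfl | rfl⟩ := ih
    · exact ⟨i, .inr rfl⟩
    · exact ⟨i + 1, .inl (by ring)⟩

end N

/-! ### Coding of integers -/

/-- The positive part of the integer coded by `c`; here `2 * i` codes `i`, and `2 * i + 1` codes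
`-(i + 1)`. -/
noncomputable def posPart (c : M.N) : M.N := mu fun i => c = 2 * i

/-- The negative part of the integer coded by `c`. -/
noncomputable def negPart (c : M.N) : M.N := mu fun j => c + 1 = 2 * j

@[fun_prop] theorem Rep.posPart {f : A → M.N} (hf : Rep M f) :
    Rep M fun a => Str.posPart (f a) := by
  unfold Str.posPart; fun_prop

@[fun_prop] theorem Rep.negPart {f : A → M.N} (hf : Rep M f) :
    Rep M fun a => Str.negPart (f a) := by
  unfold Str.negPart; fun_prop

/-- The integer coded by `c`. -/
noncomputable def sg (c : M.N) : M.K := ι (posPart c) - ι (negPart c)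

theorem posPart_two_mul (i : M.N) : posPart (2 * i) = i :=
  (mul_left_cancel₀ two_ne_zero
    (mu_spec (P := fun j => 2 * i = 2 * j) (by fun_prop) ⟨i, rfl⟩)).symm

theorem negPart_two_mul (i : M.N) : negPart (2 * i) = 0 :=
  mu_of_not_exists fun ⟨j, hj⟩ => N.two_mul_ne_two_mul_add_one j i hj.symm

theorem posPart_two_mul_add_one (i : M.N) : posPart (2 * i + 1) = 0 :=
  mu_of_not_exists fun ⟨j, hj⟩ => N.two_mul_ne_two_mul_add_one j i hj.symm

theorem negPart_two_mul_add_one (i : M.N) : negPart (2 * i + 1) = i + 1 := by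
  have h_double : 2 * i + 1 + 1 = 2 * (i + 1) := by ring
  exact (mul_left_cancel₀ two_ne_zero (h_double.symm.trans
    (mu_spec (P := fun j => 2 * i + 1 + 1 = 2 * j) (by fun_prop) ⟨i + 1, h_double⟩))).symm

theorem sg_even (i : M.N) : sg (2 * i) = ι i := by
  rw [sg, posPart_two_mul, negPart_two_mul, map_zero, sub_zero]

theorem sg_odd (i : M.N) : sg (2 * i + 1) = -ι (i + 1) := by
  rw [sg, posPart_two_mul_add_one, negPart_two_mul_add_one, map_zero, zero_sub]

theorem sg_zero : sg (0 : M.N) = 0 := by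
  rw [← mul_zero 2, sg_even, map_zero]

theorem exists_sg_eq (i j : M.N) : ∃ c, sg c = ι i - ι j := by
  rcases le_or_gt j i with h | h
  · obtain ⟨k, rfl⟩ := N.le_iff_exists_add.1 h
    exact ⟨2 * k, by rw [sg_even, map_add]; ring⟩
  · obtain ⟨k, rfl⟩ := N.le_iff_exists_add.1 (N.add_one_le_iff.2 h)
    exact ⟨2 * k + 1, by rw [sg_odd]; simp only [map_add, map_one]; ring⟩

theorem sg_add_one_le {c c' : M.N} (h : sg c < sg c') : sg c + 1 ≤ sg c' := by
  unfold sg at h ⊢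
  have h_lt : posPart c + negPart c' < posPart c' + negPart c := by
    rw [← ι_lt, map_add, map_add]; linarith
  have h_le := ι_le.2 (N.add_one_le_iff.2 h_lt)
  simp only [map_add, map_one] at h_le
  linarith

theorem sg_odd_lt_sg_even (i j : M.N) : sg (2 * i + 1) < sg (2 * j) := by
  rw [sg_odd, sg_even]
  linarith [ι_pos.2 (N.zero_lt_add_one i), ι_nonneg j]

theorem sg_injective : Function.Injective (sg : M.N → M.K) := by
  intro c c' h
  obtain ⟨i, rfl | rfl⟩ := N.even_or_odd c <;> obtain ⟨j, rfl | rfl⟩ := N.even_or_odd c'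
  · rw [sg_even, sg_even] at h; rw [FracField.of_injective h]
  · exact ((sg_odd_lt_sg_even j i).ne' h).elim
  · exact ((sg_odd_lt_sg_even i j).ne h).elim
  · rw [sg_odd, sg_odd] at h; rw [N.add_one_inj (FracField.of_injective (neg_injective h))]

/-- The code of the dyadic rational `sg c + n / 2 ^ p`. -/
noncomputable def pt (c n p : M.N) : M.N :=
  code (posPart c * pw p + n) (negPart c * pw p) (mu fun d => d + 1 = pw p)

@[fun_prop] theorem Rep.pt {f g h : A → M.N} (hf : Rep M f) (hg : Rep M g) (hh : Rep M h) :
    Rep M fun a => Str.pt (f a) (g a) (h a) := by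
  unfold Str.pt; fun_prop

theorem valid_pt (c n p : M.N) : Valid (pt c n p) := valid_code _ _ _

theorem val_pt (c n p : M.N) : val (pt c n p) = sg c + ι n * eps p := by
  obtain ⟨d, hd⟩ := N.exists_add_one (pw_pos p).ne'
  have h_denom : (mu fun d => d + 1 = pw p) + 1 = pw p :=
    mu_spec (P := fun d => d + 1 = pw p) (by fun_prop) ⟨d, hd.symm⟩
  rw [pt, val_code, ← map_one ι, ← map_add, h_denom, eps, sg]
  have hp := (ι_pos.2 (pw_pos p)).ne'
  simp only [map_add, map_mul]
  field_simp
  ring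

/-! ### Binary expansions -/

/-- The real number `x` is in the interval `(sg c + n / 2 ^ p, sg c + (n + 1) / 2 ^ p]`. -/
def InCell (x : M.Obj .one) (c n p : M.N) : Prop :=
  Below (sg c + ι n * eps p) x ∧ ¬ Below (sg c + (ι n + 1) * eps p) x

theorem InCell.congr {c n p : M.N} (h : InCell x c n p) (hx : IsReal x) (hy : IsReal y)
    (hxy : RealEq x y) : InCell y c n p :=
  ⟨h.1.congr hx hy hxy, fun h' => h.2 (h'.congr hy hx hxy.symm)⟩

theorem InCell.le {c n m p : M.N} (hn : InCell x c n p) (hm : InCell x c m p) : m ≤ n := by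
  by_contra! h_lt
  have h_le := ι_le.2 (N.add_one_le_iff.2 h_lt)
  rw [map_add, map_one] at h_le
  exact hn.2 (hm.1.mono (by linarith [mul_le_mul_of_nonneg_right h_le (eps_pos p).le]))

theorem InCell.eq {c n m p : M.N} (hn : InCell x c n p) (hm : InCell x c m p) : n = m :=
  le_antisymm (hm.le hn) (hn.le hm)

theorem inCell_zero_iff {c : M.N} : InCell x c 0 0 ↔ Below (sg c) x ∧ ¬ Below (sg c + 1) x := by
  rw [InCell, map_zero, zero_mul, add_zero, zero_add, eps_zero, one_mul]

theorem InCell.eq_int {c c' : M.N} (h : InCell x c 0 0) (h' : InCell x c' 0 0) : c = c' := by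
  rw [inCell_zero_iff] at h h'
  refine sg_injective (le_antisymm ?_ ?_)
  · exact not_lt.1 fun hn => h'.2 (h.1.mono (sg_add_one_le hn))
  · exact not_lt.1 fun hn => h.2 (h'.1.mono (sg_add_one_le hn))

theorem InCell.refine {c n p : M.N} (h : InCell x c n p) :
    InCell x c (2 * n) (p + 1) ∨ InCell x c (2 * n + 1) (p + 1) := by
  unfold InCell at h ⊢
  simp only [eps_add_one, map_add, map_mul, map_ofNat, map_one]
  rw [show sg c + 2 * ι n * (eps p / 2) = sg c + ι n * eps p by ring,
    show sg c + (2 * ι n + 1 + 1) * (eps p / 2) = sg c + (ι n + 1) * eps p by ring]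
  tauto

theorem IsReal.exists_bounds (hx : IsReal x) : ∃ l u, Below (-ι l) x ∧ ¬ Below (ι u) x := by
  obtain ⟨l, hl⟩ := exists_lt_ι (-val (x ⬩ 0))
  obtain ⟨u, hu⟩ := exists_lt_ι (val (x ⬩ 0))
  refine ⟨l + 1, u + 1, ⟨0, ?_⟩, fun ⟨k, hk⟩ => ?_⟩
  · rw [map_add, map_one, eps_zero]
    linarith
  · have h_bound := hx.add_le 0 k
    rw [zero_add, eps_zero] at h_bound
    rw [map_add, map_one] at hk
    linarith [eps_pos k]

theorem IsReal.exists_inCell (hx : IsReal x) : ∃ c, InCell x c 0 0 := by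
  obtain ⟨l, u, hl, hu⟩ := hx.exists_bounds
  have h_below : ∀ n, BelowCode (code (n + 1) l 0) x ↔ Below (ι (n + 1) - ι l) x := fun n => by
    rw [belowCode_iff hx (valid_code _ _ _), val_code, map_zero, zero_add, div_one]
  have h_above : ¬ BelowCode (code (u + l + 1) l 0) x := fun h => by
    refine hu (((h_below _).1 h).mono ?_)
    simp only [map_add, map_one]
    linarith
  obtain ⟨n, hn, h_least⟩ :=
    exists_least (P := fun n => ¬ BelowCode (code (n + 1) l 0) x) (by fun_prop) ⟨_, h_above⟩
  obtain ⟨c, hc⟩ := exists_sg_eq n l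
  rw [h_below, map_add, map_one, ← sub_add_eq_add_sub, ← hc] at hn
  refine ⟨c, inCell_zero_iff.2 ⟨?_, hn⟩⟩
  rw [hc]
  by_cases h_zero : n = 0
  · rwa [h_zero, map_zero, zero_sub]
  · obtain ⟨m, rfl⟩ := N.exists_add_one h_zero
    simpa only [h_below, not_not] using h_least m (N.lt_add_one_iff.2 le_rfl)

/-- The code of the integer `z` with `z < x ≤ z + 1`. -/
noncomputable def intPart (x : M.Obj .one) : M.N :=
  mu fun c => BelowCode (pt c 0 0) x ∧ ¬ BelowCode (pt c 1 0) x

@[fun_prop] theorem Rep.intPart {f : A → M.Obj .one} (hf : Rep M f) :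
    Rep M fun a => Str.intPart (f a) := by
  unfold Str.intPart; fun_prop

theorem IsReal.belowCode_pt (hx : IsReal x) (c n p : M.N) :
    BelowCode (pt c n p) x ↔ Below (sg c + ι n * eps p) x := by
  rw [belowCode_iff hx (valid_pt _ _ _), val_pt]

theorem IsReal.inCell_intPart (hx : IsReal x) : InCell x (intPart x) 0 0 := by
  have h_cell : ∀ c, (BelowCode (pt c 0 0) x ∧ ¬ BelowCode (pt c 1 0) x) ↔ InCell x c 0 0 :=
    fun c => by rw [hx.belowCode_pt, hx.belowCode_pt, InCell, map_zero, zero_add, map_one]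
  obtain ⟨c, hc⟩ := hx.exists_inCell
  exact (h_cell _).1 (mu_spec (P := fun c => BelowCode (pt c 0 0) x ∧ ¬ BelowCode (pt c 1 0) x)
    (by fun_prop) ⟨c, (h_cell c).2 hc⟩)

/-- The number `n` with `x - z` in `(n / 2 ^ p, (n + 1) / 2 ^ p]`, for `z` the integer part. -/
noncomputable def approx (x : M.Obj .one) (p : M.N) : M.N :=
  mu fun n => ¬ BelowCode (pt (intPart x) (n + 1) p) x

@[fun_prop] theorem Rep.approx {f : A → M.Obj .one} {g : A → M.N} (hf : Rep M f) (hg : Rep M g) :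
    Rep M fun a => Str.approx (f a) (g a) := by
  unfold Str.approx; fun_prop

theorem IsReal.inCell_approx (hx : IsReal x) (p : M.N) :
    InCell x (intPart x) (approx x p) p := by
  obtain ⟨h_below, h_not_below⟩ := inCell_zero_iff.1 hx.inCell_intPart
  constructor
  · by_cases h_zero : approx x p = 0
    · rwa [h_zero, map_zero, zero_mul, add_zero]
    · obtain ⟨m, hm⟩ := N.exists_add_one h_zero
      have h_pred := not_of_lt_mu (P := fun n => ¬ BelowCode (pt (intPart x) (n + 1) p) x)
        (show m < approx x p from hm ▸ N.lt_add_one_iff.2 le_rfl)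
      rwa [not_not, hx.belowCode_pt, ← hm] at h_pred
  · obtain ⟨d, hd⟩ := N.exists_add_one (pw_pos p).ne'
    have h_spec := mu_spec (P := fun n => ¬ BelowCode (pt (intPart x) (n + 1) p) x) (by fun_prop)
      ⟨d, by rwa [hx.belowCode_pt, ← hd, ι_pw_mul_eps]⟩
    rwa [hx.belowCode_pt, map_add, map_one] at h_spec

theorem IsReal.approx_eq (hx : IsReal x) {c n p : M.N} (hc : InCell x c 0 0)
    (hn : InCell x c n p) : approx x p = n := by
  have h := hx.inCell_approx p
  rw [hx.inCell_intPart.eq_int hc] at h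
  exact h.eq hn

theorem IsReal.approx_add_one (hx : IsReal x) (p : M.N) :
    approx x (p + 1) = 2 * approx x p ∨ approx x (p + 1) = 2 * approx x p + 1 :=
  (hx.inCell_approx p).refine.imp (hx.approx_eq hx.inCell_intPart) (hx.approx_eq hx.inCell_intPart)

/-- The binary digit of `x` of weight `2 ^ (-(p + 1))` is `1`. -/
def Bit (x : M.Obj .one) (p : M.N) : Prop := approx x (p + 1) = 2 * approx x p + 1

@[fun_prop] theorem Rep.bit {f : A → M.Obj .one} {g : A → M.N} (hf : Rep M f) (hg : Rep M g) :
    Rep M fun a => Bit (f a) (g a) := by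
  unfold Bit; fun_prop

theorem IsReal.approx_add (hx : IsReal x) {p : M.N} (h : ∀ q, p ≤ q → ¬ Bit x q) (j : M.N) :
    approx x (p + j) = approx x p * pw j := by
  induction j using rep_induction with
  | rep => fun_prop
  | zero => rw [add_zero, pw_zero, mul_one]
  | add_one j ih =>
    rw [← add_assoc, (hx.approx_add_one _).resolve_right (h _ le_self_add), ih, pw_add_one]
    ring

/- Without further digits `1`, the lower ends of the cells of `x` would be constant, but `x` is
larger than the lower end of each of its cells. -/
theorem IsReal.exists_bit (hx : IsReal x) (p : M.N) : ∃ q, p ≤ q ∧ Bit x q := by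
  by_contra! h_none
  refine not_below_of_forall_eps (fun j hj => ?_) (hx.inCell_approx p).1
  have h_const : ι (approx x (p + j)) * eps (p + j) = ι (approx x p) * eps p := by
    rw [hx.approx_add h_none, map_mul, eps_add, ← mul_one (ι (approx x p) * eps p),
      ← ι_pw_mul_eps j]
    ring
  refine (hx.inCell_approx (p + j)).2 (hj.mono ?_)
  linarith [eps_add_le_right p j]

/-- The position of the `(k + 1)`-st digit `1` of `x`. -/
noncomputable def onePos (x : M.Obj .one) (k : M.N) : M.N :=
  natRec (mu fun p => Bit x p) (fun _ r => mu fun p => r < p ∧ Bit x p) k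

@[fun_prop] theorem Rep.onePos {f : A → M.Obj .one} {g : A → M.N} (hf : Rep M f) (hg : Rep M g) :
    Rep M fun a => Str.onePos (f a) (g a) := by
  unfold Str.onePos; fun_prop

theorem onePos_zero (x : M.Obj .one) : onePos x 0 = mu fun p => Bit x p := natRec_at_zero _ _

theorem onePos_add_one (x : M.Obj .one) (k : M.N) :
    onePos x (k + 1) = mu fun p => onePos x k < p ∧ Bit x p :=
  natRec_add_one _ (by fun_prop) k

theorem IsReal.onePos_add_one_spec (hx : IsReal x) (k : M.N) :
    onePos x k < onePos x (k + 1) ∧ Bit x (onePos x (k + 1)) := by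
  rw [onePos_add_one]
  obtain ⟨q, hq, hq'⟩ := hx.exists_bit (onePos x k + 1)
  exact mu_spec (P := fun p => onePos x k < p ∧ Bit x p) (by fun_prop)
    ⟨q, N.add_one_le_iff.1 hq, hq'⟩

theorem IsReal.bit_onePos (hx : IsReal x) (k : M.N) : Bit x (onePos x k) := by
  by_cases h : k = 0
  · rw [h, onePos_zero]
    obtain ⟨q, -, hq⟩ := hx.exists_bit 0
    exact mu_spec (P := fun p => Bit x p) (by fun_prop) ⟨q, hq⟩
  · obtain ⟨j, rfl⟩ := N.exists_add_one h
    exact (hx.onePos_add_one_spec j).2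

theorem IsReal.le_onePos (hx : IsReal x) (k : M.N) : k ≤ onePos x k := by
  induction k using rep_induction with
  | rep => fun_prop
  | zero => exact N.zero_le _
  | add_one k ih => exact N.add_one_le_iff.2 (ih.trans_lt (hx.onePos_add_one_spec k).1)

theorem IsReal.bit_iff (hx : IsReal x) (p : M.N) : Bit x p ↔ ∃ k, onePos x k = p := by
  refine ⟨fun hp => ?_, fun ⟨k, hk⟩ => hk ▸ hx.bit_onePos k⟩
  obtain ⟨k, hk, hk_least⟩ := exists_least (P := fun k => p ≤ onePos x k) (by fun_prop)
    ⟨p, hx.le_onePos p⟩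
  refine ⟨k, le_antisymm (not_lt.1 fun h_lt => ?_) hk⟩
  by_cases h_zero : k = 0
  · rw [h_zero, onePos_zero] at h_lt
    exact not_of_lt_mu h_lt hp
  · obtain ⟨j, rfl⟩ := N.exists_add_one h_zero
    rw [onePos_add_one] at h_lt
    exact not_of_lt_mu h_lt ⟨not_le.1 (hk_least j (N.lt_add_one_iff.2 le_rfl)), hp⟩

/-! ### From real numbers to Baire space -/

/-- The element of Baire space coding the integer part of `x` and the lengths of the gaps between
the digits `1` of `x`. -/
noncomputable def toBaire (x : M.Obj .one) : M.Obj .one :=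
  lam fun j => if j = 0 then intPart x else if j = 1 then onePos x 0 else
    mu fun v => ∃ k, j = k + 2 ∧ onePos x (k + 1) = onePos x k + v + 1

@[fun_prop] theorem Rep.toBaire {f : A → M.Obj .one} (hf : Rep M f) :
    Rep M fun a => Str.toBaire (f a) := by
  unfold Str.toBaire; fun_prop

theorem toBaire_zero (x : M.Obj .one) : toBaire x ⬩ 0 = intPart x := by
  rw [toBaire, lam_app (by fun_prop), if_pos rfl]

theorem toBaire_one (x : M.Obj .one) : toBaire x ⬩ 1 = onePos x 0 := by
  rw [toBaire, lam_app (by fun_prop), if_neg one_ne_zero, if_pos rfl]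

theorem IsReal.toBaire_add_two (hx : IsReal x) (k : M.N) :
    onePos x (k + 1) = onePos x k + toBaire x ⬩ (k + 2) + 1 := by
  rw [toBaire, lam_app (by fun_prop), if_neg (N.add_two_ne_zero k), if_neg (N.add_two_ne_one k)]
  obtain ⟨d, hd⟩ := N.le_iff_exists_add.1 (N.add_one_le_iff.2 (hx.onePos_add_one_spec k).1)
  obtain ⟨l, hl, h_gap⟩ := mu_spec
    (P := fun v => ∃ l, k + 2 = l + 2 ∧ onePos x (l + 1) = onePos x l + v + 1) (by fun_prop)
    ⟨d, k, rfl, by rw [hd, add_right_comm]⟩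
  rwa [← add_right_cancel hl] at h_gap

theorem intPart_congr (hx : IsReal x) (hy : IsReal y) (h : RealEq x y) : intPart x = intPart y :=
  (hx.inCell_intPart.congr hx hy h).eq_int hy.inCell_intPart

theorem approx_congr (hx : IsReal x) (hy : IsReal y) (h : RealEq x y) (p : M.N) :
    approx x p = approx y p :=
  (hy.approx_eq (hx.inCell_intPart.congr hx hy h) ((hx.inCell_approx p).congr hx hy h)).symm

theorem toBaire_congr (hx : IsReal x) (hy : IsReal y) (h : RealEq x y) :
    toBaire x = toBaire y := by
  have h_bit : ∀ p, Bit x p = Bit y p := fun p => by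
    unfold Bit; rw [approx_congr hx hy h, approx_congr hx hy h]
  have h_onePos : ∀ k, onePos x k = onePos y k := fun k => by unfold onePos; simp only [h_bit]
  simp only [toBaire, intPart_congr hx hy h, h_onePos]

/-! ### From Baire space to real numbers -/

section FromBaire

variable (f : M.Obj .one)

/-- The position of the `(k + 1)`-st digit `1` in the expansion coded by `f`. -/
noncomputable def gapPos (k : M.N) : M.N := natRec (f ⬩ 1) (fun k r => r + f ⬩ (k + 2) + 1) k

open Classical in
/-- The first `p` binary digits of the expansion coded by `f`, as a number. -/
noncomputable def digits (p : M.N) : M.N :=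
  natRec 0 (fun p r => if ∃ k, gapPos f k = p then 2 * r + 1 else 2 * r) p

/-- The real number coded by `f`. -/
noncomputable def fromBaire : M.Obj .one := lam fun p => pt (f ⬩ 0) (digits f p) p

variable {f}

@[fun_prop] theorem Rep.gapPos {f : A → M.Obj .one} {g : A → M.N} (hf : Rep M f) (hg : Rep M g) :
    Rep M fun a => Str.gapPos (f a) (g a) := by
  unfold Str.gapPos; fun_prop

@[fun_prop] theorem Rep.digits {f : A → M.Obj .one} {g : A → M.N} (hf : Rep M f) (hg : Rep M g) :
    Rep M fun a => Str.digits (f a) (g a) := by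
  unfold Str.digits; fun_prop

@[fun_prop] theorem Rep.fromBaire {f : A → M.Obj .one} (hf : Rep M f) :
    Rep M fun a => Str.fromBaire (f a) := by
  unfold Str.fromBaire; fun_prop

theorem gapPos_zero : gapPos f 0 = f ⬩ 1 := natRec_at_zero _ _

theorem gapPos_add_one (k : M.N) : gapPos f (k + 1) = gapPos f k + f ⬩ (k + 2) + 1 :=
  natRec_add_one _ (by fun_prop) k

theorem gapPos_lt (k : M.N) : gapPos f k < gapPos f (k + 1) := by
  rw [gapPos_add_one]; exact N.lt_add_one_iff.2 le_self_add

theorem gapPos_le_add (k i : M.N) : gapPos f k ≤ gapPos f (k + i) := by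
  induction i using rep_induction with
  | rep => fun_prop
  | zero => rw [add_zero]
  | add_one i ih => rw [← add_assoc]; exact ih.trans (gapPos_lt _).le

theorem gapPos_mono {k l : M.N} (h : k ≤ l) : gapPos f k ≤ gapPos f l := by
  obtain ⟨i, rfl⟩ := N.le_iff_exists_add.1 h
  exact gapPos_le_add k i

theorem le_gapPos (k : M.N) : k ≤ gapPos f k := by
  induction k using rep_induction with
  | rep => fun_prop
  | zero => exact N.zero_le _
  | add_one k ih => exact N.add_one_le_iff.2 (ih.trans_lt (gapPos_lt k))

theorem digits_zero : digits f 0 = 0 := natRec_at_zero _ _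

open Classical in
theorem digits_add_one (p : M.N) : digits f (p + 1) =
    if ∃ k, gapPos f k = p then 2 * digits f p + 1 else 2 * digits f p :=
  natRec_add_one _ (by fun_prop) p

theorem digits_of_exists {p : M.N} (h : ∃ k, gapPos f k = p) :
    digits f (p + 1) = 2 * digits f p + 1 := by rw [digits_add_one, if_pos h]

theorem digits_of_not_exists {p : M.N} (h : ¬ ∃ k, gapPos f k = p) :
    digits f (p + 1) = 2 * digits f p := by rw [digits_add_one, if_neg h]

theorem two_mul_digits_le (p : M.N) : 2 * digits f p ≤ digits f (p + 1) := by
  rw [digits_add_one]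
  split_ifs
  exacts [le_self_add, le_rfl]

theorem digits_le_two_mul_add_one (p : M.N) : digits f (p + 1) ≤ 2 * digits f p + 1 := by
  rw [digits_add_one]
  split_ifs
  exacts [le_rfl, le_self_add]

theorem digits_mul_pw_le (p i : M.N) : digits f p * pw i ≤ digits f (p + i) := by
  induction i using rep_induction with
  | rep => fun_prop
  | zero => rw [pw_zero, mul_one, add_zero]
  | add_one i ih =>
    rw [← add_assoc, pw_add_one, mul_left_comm]
    exact (mul_le_mul_right ih 2).trans (two_mul_digits_le _)

theorem digits_add_one_le_mul_pw (p i : M.N) :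
    digits f (p + i) + 1 ≤ (digits f p + 1) * pw i := by
  induction i using rep_induction with
  | rep => fun_prop
  | zero => rw [pw_zero, mul_one, add_zero]
  | add_one i ih =>
    calc digits f (p + (i + 1)) + 1
        ≤ 2 * digits f (p + i) + 1 + 1 := by
          rw [← add_assoc]; exact add_le_add_left (digits_le_two_mul_add_one _) 1
      _ = 2 * (digits f (p + i) + 1) := by ring
      _ ≤ 2 * ((digits f p + 1) * pw i) := mul_le_mul_right ih 2
      _ = (digits f p + 1) * pw (i + 1) := by rw [pw_add_one, mul_left_comm]

theorem fromBaire_app (p : M.N) : fromBaire f ⬩ p = pt (f ⬩ 0) (digits f p) p :=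
  lam_app (by fun_prop) p

theorem valid_fromBaire_app (p : M.N) : Valid (fromBaire f ⬩ p) := by
  rw [fromBaire_app]; exact valid_pt _ _ _

theorem val_fromBaire (p : M.N) :
    val (fromBaire f ⬩ p) = sg (f ⬩ 0) + ι (digits f p) * eps p := by
  rw [fromBaire_app, val_pt]

theorem ι_pw_mul_eps_add (p i : M.N) : ι (pw i) * eps (p + i) = eps p := by
  rw [eps_add, mul_left_comm, ι_pw_mul_eps, mul_one]

theorem val_fromBaire_le_add (p i : M.N) :
    val (fromBaire f ⬩ p) ≤ val (fromBaire f ⬩ (p + i)) := by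
  have h := mul_le_mul_of_nonneg_right (ι_le.2 (digits_mul_pw_le (f := f) p i)) (eps_pos (p + i)).le
  rw [map_mul, mul_assoc, ι_pw_mul_eps_add] at h
  rw [val_fromBaire, val_fromBaire]
  linarith

theorem val_fromBaire_add_eps_le (p i : M.N) :
    val (fromBaire f ⬩ (p + i)) + eps (p + i) ≤ val (fromBaire f ⬩ p) + eps p := by
  have h := mul_le_mul_of_nonneg_right (ι_le.2 (digits_add_one_le_mul_pw (f := f) p i))
    (eps_pos (p + i)).le
  simp only [map_add, map_mul, map_one, mul_assoc, ι_pw_mul_eps_add] at h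
  rw [val_fromBaire, val_fromBaire]
  linarith

theorem isReal_fromBaire (f : M.Obj .one) : IsReal (fromBaire f) := by
  intro k i
  simp only [diffLe_iff, valid_fromBaire_app, true_and, map_one, one_mul]
  constructor <;>
    linarith [val_fromBaire_le_add (f := f) k i, val_fromBaire_add_eps_le (f := f) k i,
      eps_pos k, eps_pos (k + i)]

/- Since the number of gaps is infinite, some digit `1` occurs at a position `≥ p`, which makes
the inequality strict. -/
theorem below_val_fromBaire (p : M.N) : Below (val (fromBaire f ⬩ p)) (fromBaire f) := by
  obtain ⟨i, hi⟩ := N.le_iff_exists_add.1 (le_gapPos (f := f) p)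
  have h_digit : val (fromBaire f ⬩ (p + i)) + eps (p + i + 1) =
      val (fromBaire f ⬩ (p + i + 1)) := by
    rw [val_fromBaire, val_fromBaire, digits_of_exists ⟨p, hi⟩, eps_add_one]
    simp only [map_add, map_mul, map_ofNat, map_one]
    ring
  refine ⟨p + i + 1 + 1, ?_⟩
  linarith [val_fromBaire_le_add (f := f) p i, val_fromBaire_le_add (f := f) (p + i + 1) 1,
    eps_add_one (p + i + 1), eps_pos (p + i + 1)]

theorem not_below_val_fromBaire_add_eps (p : M.N) :
    ¬ Below (val (fromBaire f ⬩ p) + eps p) (fromBaire f) := by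
  rintro ⟨k, hk⟩
  rcases le_total p k with h | h
  · obtain ⟨i, rfl⟩ := N.le_iff_exists_add.1 h
    linarith [val_fromBaire_add_eps_le (f := f) p i, eps_pos (p + i)]
  · obtain ⟨i, rfl⟩ := N.le_iff_exists_add.1 h
    linarith [val_fromBaire_le_add (f := f) k i, eps_pos k, eps_pos (k + i)]

theorem inCell_fromBaire (f : M.Obj .one) (p : M.N) :
    InCell (fromBaire f) (f ⬩ 0) (digits f p) p := by
  rw [InCell, add_mul, one_mul, ← add_assoc, ← val_fromBaire]
  exact ⟨below_val_fromBaire p, not_below_val_fromBaire_add_eps p⟩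

theorem inCell_fromBaire_zero (f : M.Obj .one) : InCell (fromBaire f) (f ⬩ 0) 0 0 := by
  have h := inCell_fromBaire f 0
  rwa [digits_zero] at h

theorem intPart_fromBaire (f : M.Obj .one) : intPart (fromBaire f) = f ⬩ 0 :=
  (isReal_fromBaire f).inCell_intPart.eq_int (inCell_fromBaire_zero f)

theorem approx_fromBaire (f : M.Obj .one) (p : M.N) : approx (fromBaire f) p = digits f p :=
  (isReal_fromBaire f).approx_eq (inCell_fromBaire_zero f) (inCell_fromBaire f p)

theorem bit_fromBaire (f : M.Obj .one) (p : M.N) :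
    Bit (fromBaire f) p ↔ ∃ k, gapPos f k = p := by
  rw [Bit, approx_fromBaire, approx_fromBaire]
  refine ⟨fun h => ?_, digits_of_exists⟩
  by_contra h_none
  rw [digits_of_not_exists h_none] at h
  exact N.two_mul_ne_two_mul_add_one _ _ h

theorem onePos_fromBaire (f : M.Obj .one) (k : M.N) : onePos (fromBaire f) k = gapPos f k := by
  induction k using rep_induction with
  | rep => fun_prop
  | zero =>
    rw [onePos_zero]
    refine mu_eq ((bit_fromBaire f _).2 ⟨0, rfl⟩) fun m hm h_bit => ?_
    obtain ⟨l, rfl⟩ := (bit_fromBaire f _).1 h_bit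
    exact (gapPos_mono (N.zero_le l)).not_gt hm
  | add_one k ih =>
    rw [onePos_add_one, ih]
    refine mu_eq ⟨gapPos_lt k, (bit_fromBaire f _).2 ⟨k + 1, rfl⟩⟩ fun m hm ⟨hk, h_bit⟩ => ?_
    obtain ⟨l, rfl⟩ := (bit_fromBaire f _).1 h_bit
    rcases le_or_gt l k with hlk | hkl
    · exact (gapPos_mono hlk).not_gt hk
    · exact (gapPos_mono (N.add_one_le_iff.2 hkl)).not_gt hm

theorem toBaire_fromBaire (f : M.Obj .one) : toBaire (fromBaire f) = f := by
  refine ext fun j => ?_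
  rcases N.cases_two j with rfl | rfl | ⟨k, rfl⟩
  · rw [toBaire_zero, intPart_fromBaire]
  · rw [toBaire_one, onePos_fromBaire, gapPos_zero]
  · have h_gap := (isReal_fromBaire f).toBaire_add_two k
    rw [onePos_fromBaire, onePos_fromBaire, gapPos_add_one, add_assoc, add_assoc] at h_gap
    exact (add_right_cancel (add_left_cancel h_gap)).symm

theorem IsReal.gapPos_toBaire (hx : IsReal x) (k : M.N) : gapPos (toBaire x) k = onePos x k := by
  induction k using rep_induction with
  | rep => fun_prop
  | zero => rw [gapPos_zero, toBaire_one]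
  | add_one k ih => rw [gapPos_add_one, ih, hx.toBaire_add_two]

theorem IsReal.digits_toBaire (hx : IsReal x) (p : M.N) : digits (toBaire x) p = approx x p := by
  have h_bit : ∀ p, (∃ k, gapPos (toBaire x) k = p) ↔ Bit x p := fun p => by
    simp only [hx.gapPos_toBaire, hx.bit_iff]
  induction p using rep_induction with
  | rep => fun_prop
  | zero => rw [digits_zero, hx.approx_eq hx.inCell_intPart hx.inCell_intPart]
  | add_one p ih =>
    by_cases h : Bit x p
    · rw [digits_of_exists ((h_bit p).2 h), ih]; exact h.symm
    · rw [digits_of_not_exists (by rwa [h_bit]), ih]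
      exact ((hx.approx_add_one p).resolve_right h).symm

theorem realEq_of_toBaire_eq (hx : IsReal x) (hy : IsReal y) (h : toBaire x = toBaire y) :
    RealEq x y := by
  have h_int : intPart x = intPart y := by rw [← toBaire_zero, h, toBaire_zero]
  have h_approx : ∀ n, approx x n = approx y n := fun n => by
    rw [← hx.digits_toBaire, h, hy.digits_toBaire]
  refine realEq_of_cells hx hy fun n => ⟨sg (intPart x) + ι (approx x n) * eps n, ?_⟩
  rw [add_assoc, ← add_one_mul]
  have hx_cell := hx.inCell_approx n
  have hy_cell := hy.inCell_approx n
  rw [← h_int, ← h_approx] at hy_cell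
  exact ⟨hx_cell.1, hx_cell.2, hy_cell.1, hy_cell.2⟩

theorem realEq_fromBaire_toBaire (hx : IsReal x) : RealEq (fromBaire (toBaire x)) x :=
  realEq_of_toBaire_eq (isReal_fromBaire _) hx (toBaire_fromBaire _)

end FromBaire

/-! ### The unit interval -/

/-- The constant sequence with value `q`. -/
def constSeq (q : M.N) : M.Obj .one := M.combK _ _ ⬩ q

theorem constSeq_app (q k : M.N) : constSeq q ⬩ k = q := app_combK q k

/-- `x ∈ [0, 1]`. -/
def InUnit (x : M.Obj .one) : Prop :=
  IsReal x ∧ RealLe (constSeq (code 0 0 0)) x ∧ RealLe x (constSeq (code 1 0 0))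

theorem val_code_zero : val (code 0 0 0 : M.N) = 0 := by simp [val_code]

theorem val_code_one : val (code 1 0 0 : M.N) = 1 := by simp [val_code]

theorem zero_realLe_iff (hx : IsReal x) :
    RealLe (constSeq (code 0 0 0)) x ↔ ∀ k, 0 ≤ val (x ⬩ k) + 2 * eps k := by
  simp only [RealLe, diffLe_iff, hx.valid, constSeq_app, valid_code, true_and, val_code_zero,
    map_ofNat, sub_le_iff_le_add']

theorem realLe_one_iff (hx : IsReal x) :
    RealLe x (constSeq (code 1 0 0)) ↔ ∀ k, val (x ⬩ k) ≤ 1 + 2 * eps k := by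
  simp only [RealLe, diffLe_iff, hx.valid, constSeq_app, valid_code, true_and, val_code_one,
    map_ofNat, sub_le_iff_le_add']

theorem inUnit_zero : InUnit (constSeq (code 0 0 0) : M.Obj .one) := by
  have hx : IsReal (constSeq (code 0 0 0) : M.Obj .one) := fun k i => by
    simp only [constSeq_app, diffLe_iff, valid_code, sub_self, map_one, one_mul,
      (eps_pos k).le, and_self]
  refine ⟨hx, (zero_realLe_iff hx).2 fun k => ?_, (realLe_one_iff hx).2 fun k => ?_⟩ <;>
  · rw [constSeq_app, val_code_zero]
    linarith [eps_pos k]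

theorem IsReal.intPart_eq_zero_iff (hx : IsReal x) :
    intPart x = 0 ↔ Below 0 x ∧ ¬ Below 1 x := by
  have h_cell : InCell x 0 0 0 ↔ Below 0 x ∧ ¬ Below 1 x := by
    rw [inCell_zero_iff, sg_zero, zero_add]
  rw [← h_cell]
  exact ⟨fun h => h ▸ hx.inCell_intPart, fun h => hx.inCell_intPart.eq_int h⟩

theorem IsReal.inUnit (hx : IsReal x) (h : intPart x = 0) : InUnit x := by
  obtain ⟨h_zero, h_one⟩ := hx.intPart_eq_zero_iff.1 h
  refine ⟨hx, (zero_realLe_iff hx).2 fun k => ?_, (realLe_one_iff hx).2 fun k => ?_⟩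
  · linarith [h_zero.lt hx k, eps_pos k]
  · linarith [le_of_not_below h_one k, eps_pos k]

theorem InUnit.intPart_eq_zero_iff (hx : InUnit x) : intPart x = 0 ↔ Below 0 x :=
  hx.1.intPart_eq_zero_iff.trans
    (and_iff_left (not_below_of_le hx.1 ((realLe_one_iff hx.1).1 hx.2.2)))

theorem intPart_constSeq_zero_ne_zero : intPart (constSeq (code 0 0 0) : M.Obj .one) ≠ 0 := by
  rw [Ne, inUnit_zero.intPart_eq_zero_iff]
  rintro ⟨k, hk⟩
  rw [constSeq_app, val_code_zero] at hk
  linarith [eps_pos k]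

theorem InUnit.below_neg_eps (hx : InUnit x) (n : M.N) : Below (-eps n) x := by
  refine ⟨n + 1 + 1, ?_⟩
  linarith [(zero_realLe_iff hx.1).1 hx.2.1 (n + 1 + 1), eps_add_one n, eps_add_one (n + 1),
    eps_pos n]

theorem InUnit.realEq_of_intPart_ne_zero (hx : InUnit x) (hy : InUnit y) (hx₀ : intPart x ≠ 0)
    (hy₀ : intPart y ≠ 0) : RealEq x y := by
  rw [Ne, hx.intPart_eq_zero_iff] at hx₀
  rw [Ne, hy.intPart_eq_zero_iff] at hy₀
  refine realEq_of_cells hx.1 hy.1 fun n => ⟨-eps n, hx.below_neg_eps n, ?_, hy.below_neg_eps n, ?_⟩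
  · rwa [neg_add_cancel]
  · rwa [neg_add_cancel]

/-! ### Bijections with the natural numbers -/

/-- Some `Y` of type `2` is a bijection from `X`, with equality `E`, to the numbers. -/
def Bij (X : M.Obj .one → Prop) (E : M.Obj .one → M.Obj .one → Prop) : Prop :=
  ∃ Y : M.Obj .two, (∀ f g, X f → X g → E f g → Y ⬩ f = Y ⬩ g) ∧
    (∀ f g, X f → X g → Y ⬩ f = Y ⬩ g → E f g) ∧ ∀ n, ∃ g, X g ∧ Y ⬩ g = n

section Transport

variable {X X' : M.Obj .one → Prop} {E E' : M.Obj .one → M.Obj .one → Prop}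

theorem Bij.comap {F : M.Obj .one → M.Obj .one} (hF : Rep M F)
    (h_maps : ∀ x, X x → X' (F x))
    (h_iff : ∀ x y, X x → X y → (E' (F x) (F y) ↔ E x y))
    (h_surj : ∀ z, X' z → ∃ x, X x ∧ E' (F x) z) (h : Bij X' E') : Bij X E := by
  obtain ⟨Y, hY_congr, hY_inj, hY_surj⟩ := h
  have hY : ∀ x, lam (fun x => Y ⬩ F x) ⬩ x = Y ⬩ F x := lam_app (by fun_prop)
  refine ⟨lam fun x => Y ⬩ F x, fun x y hx hy hxy => ?_, fun x y hx hy hxy => ?_, fun n => ?_⟩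
  · rw [hY, hY, hY_congr _ _ (h_maps x hx) (h_maps y hy) ((h_iff x y hx hy).2 hxy)]
  · rw [hY, hY] at hxy
    exact (h_iff x y hx hy).1 (hY_inj _ _ (h_maps x hx) (h_maps y hy) hxy)
  · obtain ⟨z, hz, hzn⟩ := hY_surj n
    obtain ⟨x, hx, hxz⟩ := h_surj z hz
    exact ⟨x, hx, by rw [hY, hY_congr _ _ (h_maps x hx) hz hxz, hzn]⟩

/-- Up to `E`, the point `a` is the only one of `X` that does not satisfy `P`. -/
structure IsPointCompl (X : M.Obj .one → Prop) (E : M.Obj .one → M.Obj .one → Prop)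
    (P : M.Obj .one → Prop) (a : M.Obj .one) : Prop where
  mem : X a
  not_prop : ¬ P a
  congr : ∀ x y, X x → X y → E x y → (P x ↔ P y)
  eq : ∀ x y, X x → X y → ¬ P x → ¬ P y → E x y

variable {P : M.Obj .one → Prop} {a : M.Obj .one}

/- Hilbert's hotel: the point `a` moves into room `0`, everybody else into the next room. -/
open Classical in
theorem IsPointCompl.bij (ha : IsPointCompl X E P a) (hP : Rep M P)
    (h : Bij (fun x => X x ∧ P x) E) : Bij X E := by
  obtain ⟨Y, hY_congr, hY_inj, hY_surj⟩ := h
  have hZ : ∀ x, lam (fun x => if P x then Y ⬩ x + 1 else 0) ⬩ x = if P x then Y ⬩ x + 1 else 0 :=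
    lam_app (by fun_prop)
  refine ⟨lam fun x => if P x then Y ⬩ x + 1 else 0, fun x y hx hy hxy => ?_,
    fun x y hx hy hxy => ?_, fun n => ?_⟩
  · rw [hZ, hZ]
    by_cases hPx : P x
    · have hPy := (ha.congr x y hx hy hxy).1 hPx
      rw [if_pos hPx, if_pos hPy, hY_congr x y ⟨hx, hPx⟩ ⟨hy, hPy⟩ hxy]
    · rw [if_neg hPx, if_neg (mt (ha.congr x y hx hy hxy).2 hPx)]
  · rw [hZ, hZ] at hxy
    split_ifs at hxy with hPx hPy hPy
    · exact hY_inj x y ⟨hx, hPx⟩ ⟨hy, hPy⟩ (N.add_one_inj hxy)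
    · exact (N.add_one_ne_zero _ hxy).elim
    · exact (N.add_one_ne_zero _ hxy.symm).elim
    · exact ha.eq x y hx hy hPx hPy
  · by_cases hn : n = 0
    · exact ⟨a, ha.mem, by rw [hZ, if_neg ha.not_prop, hn]⟩
    · obtain ⟨m, rfl⟩ := N.exists_add_one hn
      obtain ⟨x, ⟨hx, hPx⟩, hxm⟩ := hY_surj m
      exact ⟨x, hx, by rw [hZ, if_pos hPx, hxm]⟩

/-- The order isomorphism from the numbers to the numbers distinct from `b`. -/
noncomputable def N.succAbove (b m : M.N) : M.N := if m < b then m else m + 1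

theorem N.strictMono_succAbove (b : M.N) : StrictMono (N.succAbove b) := by
  intro m n hmn
  unfold N.succAbove
  split_ifs with hm hn hn
  · exact hmn
  · exact hmn.trans (N.lt_add_one_iff.2 le_rfl)
  · exact (hm (hmn.trans hn)).elim
  · exact N.add_one_lt hmn

theorem N.succAbove_ne (b m : M.N) : N.succAbove b m ≠ b := by
  unfold N.succAbove
  split_ifs with hm
  · exact hm.ne
  · exact (N.lt_add_one_iff.2 (not_lt.1 hm)).ne'

theorem N.exists_succAbove_eq {b n : M.N} (h : n ≠ b) : ∃ m, N.succAbove b m = n := by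
  rcases h.lt_or_gt with h_lt | h_gt
  · exact ⟨n, if_pos h_lt⟩
  · obtain ⟨m, rfl⟩ := N.exists_add_one ((N.zero_le b).trans_lt h_gt).ne'
    exact ⟨m, if_neg (N.lt_add_one_iff.1 h_gt).not_gt⟩

theorem IsPointCompl.bij_compl (ha : IsPointCompl X E P a) (h : Bij X E) :
    Bij (fun x => X x ∧ P x) E := by
  obtain ⟨Y, hY_congr, hY_inj, hY_surj⟩ := h
  let pred : M.N → M.N := fun n => mu fun m => N.succAbove (Y ⬩ a) m = n
  have h_pred : Rep M pred := by unfold pred N.succAbove; fun_prop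
  have hZ : ∀ x, lam (fun x => pred (Y ⬩ x)) ⬩ x = pred (Y ⬩ x) :=
    lam_app (h_pred.comp (by fun_prop))
  have h_succ : ∀ {n}, n ≠ Y ⬩ a → N.succAbove (Y ⬩ a) (pred n) = n := fun {n} hn =>
    mu_spec (P := fun m => N.succAbove (Y ⬩ a) m = n) (by unfold N.succAbove; fun_prop)
      (N.exists_succAbove_eq hn)
  have h_ne : ∀ {x}, X x → P x → Y ⬩ x ≠ Y ⬩ a := fun {x} hx hPx hxa =>
    ha.not_prop ((ha.congr x a hx ha.mem (hY_inj x a hx ha.mem hxa)).1 hPx)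
  refine ⟨lam fun x => pred (Y ⬩ x), fun x y hx hy hxy => ?_, fun x y hx hy hxy => ?_, fun n => ?_⟩
  · rw [hZ, hZ, hY_congr x y hx.1 hy.1 hxy]
  · rw [hZ, hZ] at hxy
    refine hY_inj x y hx.1 hy.1 ?_
    rw [← h_succ (h_ne hx.1 hx.2), hxy, h_succ (h_ne hy.1 hy.2)]
  · obtain ⟨x, hx, hxn⟩ := hY_surj (N.succAbove (Y ⬩ a) n)
    have h_ne_point := N.succAbove_ne (Y ⬩ a) n
    refine ⟨x, ⟨hx, ?_⟩, ?_⟩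
    · by_contra hPx
      exact h_ne_point (hxn.symm.trans
        (hY_congr x a hx ha.mem (ha.eq x a hx ha.mem hPx ha.not_prop)))
    · rw [hZ, hxn]
      exact (N.strictMono_succAbove _).injective (h_succ h_ne_point)

end Transport

theorem bij_real_iff_bij_baire :
    Bij (M := M) IsReal RealEq ↔ Bij (M := M) (fun _ => True) Eq := by
  constructor
  · refine Bij.comap (F := fromBaire) (by fun_prop) (fun f _ => isReal_fromBaire f)
      (fun f g _ _ => ⟨fun h => ?_, fun h => ?_⟩)
      fun x hx => ⟨toBaire x, trivial, realEq_fromBaire_toBaire hx⟩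
    · rw [← toBaire_fromBaire f, toBaire_congr (isReal_fromBaire f) (isReal_fromBaire g) h,
        toBaire_fromBaire]
    · exact realEq_of_toBaire_eq (isReal_fromBaire f) (isReal_fromBaire g) (h ▸ rfl)
  · exact Bij.comap (F := toBaire) (by fun_prop) (fun _ _ => trivial)
      (fun x y hx hy => ⟨realEq_of_toBaire_eq hx hy, toBaire_congr hx hy⟩)
      fun f _ => ⟨fromBaire f, isReal_fromBaire f, toBaire_fromBaire f⟩

/-- The sequence with first entry `0` and then the entries of `f`. -/
noncomputable def consZero (f : M.Obj .one) : M.Obj .one :=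
  lam fun n => mu fun v => ∃ k, n = k + 1 ∧ v = f ⬩ k

/-- The sequence `f` without its first entry. -/
noncomputable def tail (f : M.Obj .one) : M.Obj .one := lam fun n => f ⬩ (n + 1)

theorem consZero_zero (f : M.Obj .one) : consZero f ⬩ 0 = 0 := by
  rw [consZero, lam_app (by fun_prop)]
  exact mu_of_not_exists fun ⟨_, k, hk, _⟩ => N.add_one_ne_zero k hk.symm

theorem consZero_add_one (f : M.Obj .one) (n : M.N) : consZero f ⬩ (n + 1) = f ⬩ n := by
  rw [consZero, lam_app (by fun_prop)]
  obtain ⟨k, hk, h⟩ := mu_spec (P := fun v => ∃ k, n + 1 = k + 1 ∧ v = f ⬩ k) (by fun_prop)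
    ⟨f ⬩ n, n, rfl, rfl⟩
  rw [h, add_right_cancel hk]

theorem tail_app (f : M.Obj .one) (n : M.N) : tail f ⬩ n = f ⬩ (n + 1) := lam_app (by fun_prop) n

theorem tail_consZero (f : M.Obj .one) : tail (consZero f) = f :=
  ext fun n => by rw [tail_app, consZero_add_one]

theorem consZero_tail {f : M.Obj .one} (h : f ⬩ 0 = 0) : consZero (tail f) = f := by
  refine ext fun n => ?_
  by_cases hn : n = 0
  · rw [hn, consZero_zero, h]
  · obtain ⟨k, rfl⟩ := N.exists_add_one hn
    rw [consZero_add_one, tail_app]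

theorem consZero_tail_toBaire (h : intPart x = 0) : consZero (tail (toBaire x)) = toBaire x :=
  consZero_tail ((toBaire_zero x).trans h)

theorem intPart_fromBaire_consZero (f : M.Obj .one) : intPart (fromBaire (consZero f)) = 0 := by
  rw [intPart_fromBaire, consZero_zero]

/-- `x ∈ (0, 1]`. -/
def InPosUnit (x : M.Obj .one) : Prop := InUnit x ∧ intPart x = 0

theorem inPosUnit_fromBaire_consZero (f : M.Obj .one) : InPosUnit (fromBaire (consZero f)) :=
  have h := intPart_fromBaire_consZero f
  ⟨(isReal_fromBaire _).inUnit h, h⟩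

theorem isPointCompl_zero : IsPointCompl (M := M) InUnit RealEq (fun x => intPart x = 0)
    (constSeq (code 0 0 0)) where
  mem := inUnit_zero
  not_prop := intPart_constSeq_zero_ne_zero
  congr _ _ hx hy h := by rw [intPart_congr hx.1 hy.1 h]
  eq _ _ hx hy hx₀ hy₀ := hx.realEq_of_intPart_ne_zero hy hx₀ hy₀

theorem bij_unit_iff_bij_posUnit : Bij (M := M) InUnit RealEq ↔ Bij (M := M) InPosUnit RealEq :=
  ⟨isPointCompl_zero.bij_compl, isPointCompl_zero.bij (by fun_prop)⟩

theorem bij_posUnit_iff_bij_baire :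
    Bij (M := M) InPosUnit RealEq ↔ Bij (M := M) (fun _ => True) Eq := by
  constructor
  · refine Bij.comap (F := fun f => fromBaire (consZero f)) (by unfold consZero; fun_prop)
      (fun f _ => inPosUnit_fromBaire_consZero f) (fun f g _ _ => ⟨fun h => ?_, fun h => ?_⟩)
      fun x hx => ⟨tail (toBaire x), trivial, ?_⟩
    · have h_cons := toBaire_congr (isReal_fromBaire _) (isReal_fromBaire _) h
      rw [toBaire_fromBaire, toBaire_fromBaire] at h_cons
      rw [← tail_consZero f, h_cons, tail_consZero]
    · exact realEq_of_toBaire_eq (isReal_fromBaire _) (isReal_fromBaire _) (h ▸ rfl)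
    · rw [consZero_tail_toBaire hx.2]
      exact realEq_fromBaire_toBaire hx.1.1
  · refine Bij.comap (F := fun x => tail (toBaire x)) (by unfold tail; fun_prop)
      (fun _ _ => trivial) (fun x y hx hy => ⟨fun h => ?_, fun h => ?_⟩)
      fun f _ => ⟨_, inPosUnit_fromBaire_consZero f, by rw [toBaire_fromBaire, tail_consZero]⟩
    · refine realEq_of_toBaire_eq hx.1.1 hy.1.1 ?_
      rw [← consZero_tail_toBaire hx.2, h, consZero_tail_toBaire hy.2]
    · rw [toBaire_congr hx.1.1 hy.1.1 h]

theorem bij_unit_iff_bij_baire :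
    Bij (M := M) InUnit RealEq ↔ Bij (M := M) (fun _ => True) Eq :=
  bij_unit_iff_bij_posUnit.trans bij_posUnit_iff_bij_baire

end Str

/-! ### Satisfaction of the sentences -/

theorem Tm.liftNat_zero {σ : Ty} (t : Tm σ) : t.liftNat 0 = t := by
  simp only [liftNat, Nat.add_zero, ite_self, rename_eq_subst]
  exact t.subst_id

theorem Tm.liftNat_succ {σ : Ty} (t : Tm σ) (m : ℕ) :
    t.liftNat (m + 1) = (t.liftNat m).rename (shift .nat) := by
  simp only [liftNat, rename_eq_subst, subst_subst]
  congr 1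
  funext τ i
  by_cases h : τ = .nat <;> simp [Subst.comp, subst, shift, h, Nat.add_assoc]

namespace Str

variable {M : Str}

theorem eval_push_liftNat_succ {σ : Ty} (t : Tm σ) (m : ℕ) (e : M.Env) (n : M.N) :
    M.eval (e.push n) (t.liftNat (m + 1)) = M.eval e (t.liftNat m) := by
  rw [Tm.liftNat_succ, eval_rename_shift]

theorem eval_ratCode (a b d : Tm .nat) (e : M.Env) :
    M.eval e (ratCode a b d) = code (M.eval e a) (M.eval e b) (M.eval e d) := rfl

theorem eval_add (s t : Tm .nat) (e : M.Env) :
    M.eval e (.add ⬝ s ⬝ t) = M.eval e s + M.eval e t := rfl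

theorem eval_mul (s t : Tm .nat) (e : M.Env) :
    M.eval e (.mul ⬝ s ⬝ t) = M.eval e s * M.eval e t := rfl

theorem sat_noBijection {X : Tm .one → Formula} {E : Tm .one → Tm .one → Formula}
    {X' : M.Obj .one → Prop} {E' : M.Obj .one → M.Obj .one → Prop}
    (hX : ∀ t e, M.Sat (X t) e ↔ X' (M.eval e t))
    (hE : ∀ s t e, M.Sat (E s t) e ↔ E' (M.eval e s) (M.eval e t)) (e : M.Env) :
    M.Sat (noBijection X E) e ↔ ¬ Bij X' E' := by
  simp only [noBijection, sat_neg, sat_ex, sat_and, Sat, hX, hE, eval]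
  simp [Env.push, Bij]

variable [M.IsModel]

theorem eval_succ (t : Tm .nat) (e : M.Env) : M.eval e (.succ ⬝ t) = M.eval e t + 1 := succ_def _

theorem eval_num (c : ℕ) (e : M.Env) : M.eval e (num c) = (c : M.N) := by
  induction c with
  | zero => rw [Nat.cast_zero]; rfl
  | succ c ih => rw [num, eval_succ, ih, Nat.cast_succ]

theorem eval_pow2 (k : Tm .nat) (e : M.Env) : M.eval e (pow2 k) = pw (M.eval e k) := by
  simp only [pow2, eval, eval_num, Nat.cast_one, Nat.cast_ofNat]
  rfl

theorem sat_le (s t : Tm .nat) (e : M.Env) : M.Sat (le s t) e ↔ M.eval e s ≤ M.eval e t := by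
  rw [← N.lt_add_one_iff, ← eval_succ]; rfl

theorem sat_diffLe (q r k : Tm .nat) (c : ℕ) (e : M.Env) :
    M.Sat (diffLe q r k c) e ↔ DiffLe (M.eval e q) (M.eval e r) (M.eval e k) c := by
  simp only [diffLe, sat_ex, sat_and, sat_le, Sat.eq_1, eval_ratCode, eval_add, eval_mul, eval_succ,
    eval_pow2, eval_num, eval_push_liftNat_succ, Tm.liftNat_zero]
  simp only [eval, Env.push, dite_true]
  rfl

theorem sat_distLe (q r k : Tm .nat) (c : ℕ) (e : M.Env) :
    M.Sat (distLe q r k c) e ↔ DiffLe (M.eval e q) (M.eval e r) (M.eval e k) c ∧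
      DiffLe (M.eval e r) (M.eval e q) (M.eval e k) c := by
  rw [distLe, sat_and, sat_diffLe, sat_diffLe]

theorem sat_isReal (t : Tm .one) (e : M.Env) : M.Sat (isReal t) e ↔ IsReal (M.eval e t) := by
  simp only [isReal, Sat, sat_distLe, eval, eval_push_liftNat_succ, Tm.liftNat_zero, Env.push_zero,
    Env.push_succ, Nat.cast_one]
  rfl

theorem sat_realEq (s t : Tm .one) (e : M.Env) :
    M.Sat (realEq s t) e ↔ RealEq (M.eval e s) (M.eval e t) := by
  simp only [realEq, Sat, sat_distLe, eval, eval_push_liftNat_succ, Tm.liftNat_zero,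
    Env.push_zero, Nat.cast_ofNat]
  rfl

theorem sat_realLe (s t : Tm .one) (e : M.Env) :
    M.Sat (realLe s t) e ↔ RealLe (M.eval e s) (M.eval e t) := by
  simp only [realLe, Sat, sat_diffLe, eval, eval_push_liftNat_succ, Tm.liftNat_zero,
    Env.push_zero, Nat.cast_ofNat]
  rfl

theorem sat_inUnitInterval (t : Tm .one) (e : M.Env) :
    M.Sat (inUnitInterval t) e ↔ InUnit (M.eval e t) := by
  simp only [inUnitInterval, sat_and, sat_isReal, sat_realLe]
  rfl

theorem sat_NBI (e : M.Env) : M.Sat NBI e ↔ ¬ Bij (M := M) InUnit RealEq :=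
  sat_noBijection sat_inUnitInterval sat_realEq e

theorem sat_NBIReal (e : M.Env) : M.Sat NBIReal e ↔ ¬ Bij (M := M) IsReal RealEq :=
  sat_noBijection sat_isReal sat_realEq e

theorem sat_NBIBaire (e : M.Env) : M.Sat NBIBaire e ↔ ¬ Bij (M := M) (fun _ => True) Eq :=
  sat_noBijection (fun _ e => by simp [sat_neg, Sat]) (sat_eqAt IsModel.extensional) e

end Str

theorem Proves.and_left {T : Set Formula} {Γ : List Formula} {φ ψ : Formula}
    (h : Proves T Γ (φ.and ψ)) : Proves T Γ φ := by
  refine .byContra (.impElim (h.weaken (List.subset_cons_self _ _)) (.impIntro (.impIntro ?_)))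
  exact .impElim (φ := φ) (.hyp (by simp [Formula.neg])) (.hyp (by simp))

theorem Proves.iff_of_forall_model {φ ψ : Formula}
    (h : ∀ M : Str, M.IsModel → ∀ e, M.Sat φ e ↔ M.Sat ψ e) : Proves ACA [] (φ.iff ψ) :=
  .of_forall_sat (fun _ _ F x y => .inl (.ext F x y)) substClosed_ACA fun M hM h_sat e =>
    (Str.sat_iff φ ψ e).2 (h M ⟨hM, h_sat⟩ e)

end HigherOrderArith

open HigherOrderArith Str in
theorem mainTheorem6_general : Proves ACA [] (NBI.iff NBIReal) ∧ Proves ACA [] (NBI.iff NBIBaire) :=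
  ⟨.iff_of_forall_model fun M _ e => by
    rw [sat_NBI, sat_NBIReal, bij_unit_iff_bij_baire, bij_real_iff_bij_baire],
  .iff_of_forall_model fun M _ e => by rw [sat_NBI, sat_NBIBaire, bij_unit_iff_bij_baire]⟩

theorem mainTheorem6 :
    HigherOrderArith.Proves HigherOrderArith.ACA []
        (HigherOrderArith.Formula.iff HigherOrderArith.NBI HigherOrderArith.NBIReal) ∧
      HigherOrderArith.Proves HigherOrderArith.ACA []
        (HigherOrderArith.Formula.imp HigherOrderArith.NBI HigherOrderArith.NBIBaire) :=
  ⟨mainTheorem6_general.1, mainTheorem6_general.2.and_left⟩
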